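/- Write points of $\mathbb H\times\mathbb C$ as $(\tau,z)$, put $q^{1/l}=e^{2\pi i\tau/l}$, and set $\lambda(\tau,z)=\frac{z-\bar z}{\tau-\bar\tau}$, $\mu(\tau,z)=\frac1{\tau-\bar\tau}$. Let $\mathcal M$ be the set of meromorphic functions $f$ on $\mathbb H\times\mathbb C$ whose poles lie on $\{z\in\mathbb Z\tau+\mathbb Z\}$ and which belong to $\mathbb C\{q^{1/l},z\}[z^{-1}]$ for some $l\ge 1$ (that is, for some $N\ge 0$ the function $z^Nf$ is given near $q=0$, $z=0$ by a convergent power series in $q^{1/l}$ and $z$). An almost meromorphic Jacobi form of weight $k\in\mathbb Z$, index zero and depth $(s,t)$ (for the full Jacobi group $SL_2(\mathbb Z)\ltimes\mathbb Z^2$) is a function $F=\sum_{0\le i\le s,\,0\le j\le t}f_{i,j}\lambda^i\mu^j$ with all $f_{i,j}\in\mathcal M$ such that $$F\Big(\frac{a\tau+b}{c\tau+d},\frac z{c\tau+d}\Big)=(c\tau+d)^kF(\tau,z),\qquad F(\tau,z+m\tau+n)=F(\tau,z)$$ for all $\begin{pmatrix}a&b\\c&d\end{pmatrix}\in SL_2(\mathbb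 Z)$, $m,n\in\mathbb Z$ and $z\notin\mathbb Z\tau+\mathbb Z$. A quasi-Jacobi form of weight $k$ and depth $(s,t)$ is the constant term $f_{0,0}$ of such an $F$, considered as a polynomial in $\lambda,\mu$. For $n\ge1$ let $E_n(z,\tau)=\sum_{(a,b)\in\mathbb Z^2}(z+a\tau+b)^{-n}$ and let $e_2(\tau)=\sum_{(a,b)\ne(0,0)}(a\tau+b)^{-2}$, where $E_1$, $E_2$ and $e_2$ are defined by Eisenstein summation $\lim_{A\to\infty}\sum_{a=-A}^{A}\lim_{B\to\infty}\sum_{b=-B}^{B}$ (for $n\ge3$ the sum converges absolutely). **Proposition.** The space of finite sums of quasi-Jacobi forms (of all weights and depths) is equal to the $\mathbb C$-algebra of functions generated by the functions $E_n(z,\tau)$, $n\ge1$, and $e_2(\tau)$. In particular it is an algebra. -/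

import Mathlib

open scoped MatrixGroups

noncomputable section

namespace QuasiJacobi

/-- The points `(τ, z)` of `ℍ × ℂ` such that `z` does not lie in the lattice `ℤ τ + ℤ`. -/
def latticeCompl : Set (ℂ × ℂ) :=
  {p | 0 < p.1.im ∧ ∀ a b : ℤ, p.2 ≠ a * p.1 + b}

/-- `c τ + d ≠ 0` for an integral unimodular `(a b; c d)` and `τ` in the upper half plane. -/
theorem denom_ne_zero (γ : SL(2, ℤ)) (τ : ℂ) (hτ : 0 < τ.im) :
    ((γ 1 0 : ℤ) : ℂ) * τ + ((γ 1 1 : ℤ) : ℂ) ≠ 0 := by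
  have h := UpperHalfPlane.denom_ne_zero (γ : GL (Fin 2) ℝ) (⟨τ, hτ⟩ : UpperHalfPlane)
  simpa [UpperHalfPlane.denom] using h

theorem modular_mem (γ : SL(2, ℤ)) (p : ℂ × ℂ) (hp : p ∈ latticeCompl) :
    ((((γ 0 0 : ℤ) : ℂ) * p.1 + ((γ 0 1 : ℤ) : ℂ)) /
        (((γ 1 0 : ℤ) : ℂ) * p.1 + ((γ 1 1 : ℤ) : ℂ)),
      p.2 / (((γ 1 0 : ℤ) : ℂ) * p.1 + ((γ 1 1 : ℤ) : ℂ))) ∈ latticeCompl := by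
  obtain ⟨h1, h2⟩ := hp
  have hd := denom_ne_zero γ p.1 h1
  refine ⟨?_, fun m n h => ?_⟩
  · have h := (γ • (⟨p.1, h1⟩ : UpperHalfPlane)).im_pos
    rw [← UpperHalfPlane.coe_im, UpperHalfPlane.specialLinearGroup_apply] at h
    simpa using h
  · refine h2 (m * γ 0 0 + n * γ 1 0) (m * γ 0 1 + n * γ 1 1) ?_
    simp only at h
    field_simp at h
    rw [h]
    push_cast
    ring

theorem translate_mem (m n : ℤ) (p : ℂ × ℂ) (hp : p ∈ latticeCompl) :
    (p.1, p.2 + m * p.1 + n) ∈ latticeCompl := by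
  refine ⟨hp.1, fun a b h => hp.2 (a - m) (b - n) ?_⟩
  simp only at h
  push_cast
  linear_combination h

/-- `(τ, z) ↦ ((a τ + b) / (c τ + d), z / (c τ + d))` for `γ = (a b; c d)`. -/
def modularAct (γ : SL(2, ℤ)) (p : latticeCompl) : latticeCompl :=
  ⟨_, modular_mem γ p.1 p.2⟩

/-- `(τ, z) ↦ (τ, z + m τ + n)`. -/
def translate (m n : ℤ) (p : latticeCompl) : latticeCompl :=
  ⟨_, translate_mem m n p.1 p.2⟩

/-- The functional equations of Jacobi forms of weight `k` and index zero
for the full Jacobi group `SL(2, ℤ) ⋉ ℤ²`. -/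
def JacobiEquations (k : ℤ) (F : latticeCompl → ℂ) : Prop :=
  (∀ (γ : SL(2, ℤ)) (p : latticeCompl),
    F (modularAct γ p) = (((γ 1 0 : ℤ) : ℂ) * p.1.1 + ((γ 1 1 : ℤ) : ℂ)) ^ k * F p) ∧
  ∀ (m n : ℤ) (p : latticeCompl), F (translate m n p) = F p

/-- `λ(τ, z) = (z - z̄) / (τ - τ̄)`. -/
def lam (p : latticeCompl) : ℂ :=
  (p.1.2 - starRingEnd ℂ p.1.2) / (p.1.1 - starRingEnd ℂ p.1.1)

/-- `μ(τ, z) = 1 / (τ - τ̄)`. -/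
def mu (p : latticeCompl) : ℂ :=
  1 / (p.1.1 - starRingEnd ℂ p.1.1)

/-- `f` is holomorphic (jointly complex differentiable) on the open set `latticeCompl`. -/
def Holomorphic (f : latticeCompl → ℂ) : Prop :=
  ∃ G : ℂ × ℂ → ℂ, DifferentiableOn ℂ G latticeCompl ∧ ∀ p : latticeCompl, f p = G p

/-- `f` is (the restriction of) a meromorphic function on `ℍ × ℂ`: near each point of `ℍ × ℂ` it
is a quotient `g / h` of holomorphic functions, where `h` vanishes on no nonempty open set. -/
def Meromorphic (f : latticeCompl → ℂ) : Prop :=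
  ∀ x : ℂ × ℂ, 0 < x.1.im → ∃ (U : Set (ℂ × ℂ)) (g h : ℂ × ℂ → ℂ),
    IsOpen U ∧ x ∈ U ∧ DifferentiableOn ℂ g U ∧ DifferentiableOn ℂ h U ∧
    U ⊆ closure {y ∈ U | h y ≠ 0} ∧
    ∀ p : latticeCompl, (p : ℂ × ℂ) ∈ U → h p * f p = g p

/-- `f` belongs to `ℂ{q^(1/l), z}[z⁻¹]` for some `l ≥ 1`: for some `N`, the function `z ^ N f` is
given near `q = 0`, `z = 0` by a function of `(q^(1/l), z)` holomorphic near `(0, 0)`,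
where `q^(1/l) = exp (2 π i τ / l)`. -/
def HasExpansion (f : latticeCompl → ℂ) : Prop :=
  ∃ (l N : ℕ) (ε : ℝ) (g : ℂ × ℂ → ℂ), 0 < l ∧ 0 < ε ∧
    DifferentiableOn ℂ g (Metric.ball 0 ε) ∧
    ∀ p : latticeCompl,
      ‖Complex.exp (2 * Real.pi * Complex.I * p.1.1 / l)‖ < ε → ‖p.1.2‖ < ε →
        p.1.2 ^ N * f p = g (Complex.exp (2 * Real.pi * Complex.I * p.1.1 / l), p.1.2)

/-- The admissible coefficients: meromorphic functions on `ℍ × ℂ` whose poles lie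
on `z ∈ ℤ τ + ℤ` and which belong to `ℂ{q^(1/l), z}[z⁻¹]` for some `l ≥ 1`. -/
structure IsCoefficient (f : latticeCompl → ℂ) : Prop where
  holomorphic : Holomorphic f
  meromorphic : Meromorphic f
  hasExpansion : HasExpansion f

/-- The polynomial `∑_{i ≤ s, j ≤ t} f i j * λ ^ i * μ ^ j` in `λ` and `μ`. -/
def polyLamMu (s t : ℕ) (f : ℕ → ℕ → latticeCompl → ℂ) : latticeCompl → ℂ :=
  fun p => ∑ i ∈ Finset.range (s + 1), ∑ j ∈ Finset.range (t + 1), f i j p * lam p ^ i * mu p ^ j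

/-- The coefficients `f i j` define an almost meromorphic Jacobi form of weight `k`, index zero
and depth `(s, t)`. -/
def IsAlmostMeromorphicJacobi (k : ℤ) (s t : ℕ) (f : ℕ → ℕ → latticeCompl → ℂ) : Prop :=
  (∀ i j, IsCoefficient (f i j)) ∧ JacobiEquations k (polyLamMu s t f)

/-- `f₀` is a quasi-Jacobi form of weight `k` and depth `(s, t)`: the constant term, with respect
to `λ` and `μ`, of an almost meromorphic Jacobi form of index zero. -/
def IsQuasiJacobi (k : ℤ) (s t : ℕ) (f₀ : latticeCompl → ℂ) : Prop :=
  ∃ f : ℕ → ℕ → latticeCompl → ℂ, IsAlmostMeromorphicJacobi k s t f ∧ f 0 0 = f₀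

/-- The space of all (finite sums of) quasi-Jacobi forms, of all weights and depths. -/
def quasiJacobiForms : Submodule ℂ (latticeCompl → ℂ) :=
  Submodule.span ℂ {f₀ | ∃ (k : ℤ) (s t : ℕ), IsQuasiJacobi k s t f₀}

/-- The twisted Eisenstein series `E_n(z, τ) = ∑_{(a, b) ∈ ℤ²} 1 / (z + a τ + b) ^ n`: an absolutely
convergent sum for `n ≥ 3`, and an Eisenstein summation
`lim_{A → ∞} ∑_{a = -A}^{A} lim_{B → ∞} ∑_{b = -B}^{B}` for `n = 1, 2`. -/
def twistedEisenstein (n : ℕ) (p : latticeCompl) : ℂ :=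
  if 3 ≤ n then ∑' ab : ℤ × ℤ, 1 / (p.1.2 + ab.1 * p.1.1 + ab.2) ^ n
  else ∑'[SummationFilter.symmetricIcc ℤ] a : ℤ, ∑'[SummationFilter.symmetricIcc ℤ] b : ℤ,
    1 / (p.1.2 + a * p.1.1 + b) ^ n

/-- `e_2(τ) = ∑_a ∑_b 1 / (a τ + b) ^ 2`, the sum over `(a, b) ∈ ℤ² \ {(0, 0)}` taken in the sense
of Eisenstein summation, as a function of `(τ, z)`. -/
def eisensteinTwo (p : latticeCompl) : ℂ :=
  EisensteinSeries.G2 ⟨p.1.1, p.2.1⟩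

end QuasiJacobi

end

/-! Write j = cτ + d. The modular action sends λ to jλ − cz and μ to j²μ − cj, and z ↦ z + mτ + n
sends λ to λ + m. The functions E_1 and e_2 have the same defects up to a factor ±2πi, so Λ = λ +
E_1/(2πi) and M = μ − e_2/(2πi) satisfy the Jacobi equations in weights 1 and 2, while E_2 − e_2 = ℘
(weight 2) and E_n for n ≥ 3 (weight n) satisfy them without correction.

The algebra consists of quasi-Jacobi forms: the generators are the constant terms of E_1 + 2πiλ, E_2
− 2πiμ, e_2 − 2πiμ and E_n, n ≥ 3. Taking constant terms is multiplicative, so the span of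
quasi-Jacobi forms is a subalgebra (`toSubmodule_eisensteinAlgebra_le`).

Conversely, rewrite F as a polynomial in Λ and M with meromorphic coefficients g_ij. Since Λ and M
are algebraically independent over the holomorphic functions (`eq_zero_of_sum_lam_mu_eq_zero`),
comparing coefficients in the equations of F shows that g_ij is itself a Jacobi form, of weight k −
i − 2j (`jacobiEquations_coeff`). Setting λ = μ = 0 gives f_00 = Σ g_ij (E_1/2πi)^i (−e_2/2πi)^j,
and only the meromorphic Jacobi forms g_ij remain.

These are treated by induction on a bound N for the pole order at z = 0
(`mem_eisensteinAlgebra_of_jacobiEquations`). The coefficient a(τ) of z^(−N) is holomorphic on ℍ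
(`exists_leading_coefficient`), bounded at the cusp, and modular of weight k − N. For N ≥ 2 subtract
a·E_N, or a·(E_2 − e_2) when N = 2. For N = 1 the coefficient vanishes, because a·E_1 would
contribute a nonzero quasi-period. For N = 0 the form does not depend on z by Liouville
(`eq_const_of_quasiPeriodic`) and equals a. Finally, level one modular forms are polynomials in the
Eisenstein series of weights 4 and 6 (`pullback_modularForm_mem`), and these are polynomials in E_2
− e_2, E_3 and E_4 by the Weierstrass equation and its derivative (`eis_two_sq`, `g₂_eq_eis`).

The properties of the E_n come from E_1 = π cot πz + a Lambert series in the nome, and from the E_n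
being iterated z-derivatives of E_1; comparison with ℘ identifies these with the lattice sums. -/

noncomputable section

namespace QuasiJacobi
open Complex Filter Topology Metric

/-! ### Holomorphic functions on normed spaces: normal convergence and directional derivatives. -/

section SeveralVariables

variable {E : Type*} [NormedAddCommGroup E] [NormedSpace ℂ E]

/-- Cauchy's estimate for the derivative of a bounded holomorphic function. -/
theorem norm_fderiv_le_of_bounded {f : E → ℂ} {x : E} {r C : ℝ} (hr : 0 < r)
    (hf : DifferentiableOn ℂ f (ball x r)) (hC : ∀ y ∈ ball x r, ‖f y‖ ≤ C) :
    ‖fderiv ℂ f x‖ ≤ 2 * C / r := by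
  refine norm_fderiv_le_div_of_mapsTo_ball hf (fun y hy => ?_) hr
  rw [mem_closedBall, dist_eq_norm]
  calc _ ≤ ‖f y‖ + ‖f x‖ := norm_sub_le _ _
    _ ≤ C + C := add_le_add (hC y hy) (hC x (mem_ball_self hr))
    _ = 2 * C := by ring

/-- Weierstrass' theorem for normally convergent series of holomorphic functions on a ball of a
normed space. -/
theorem hasFDerivAt_tsum_of_bounded {f : ℕ → E → ℂ} {u : ℕ → ℝ} (hu : Summable u) {x : E} {r : ℝ}
    (hr : 0 < r) (hf : ∀ n, DifferentiableOn ℂ (f n) (ball x r))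
    (hb : ∀ n, ∀ y ∈ ball x r, ‖f n y‖ ≤ u n) :
    Summable (fun n => fderiv ℂ (f n) x) ∧
      HasFDerivAt (fun y => ∑' n, f n y) (∑' n, fderiv ℂ (f n) x) x := by
  have hsub : ∀ y ∈ ball x (r / 2), ball y (r / 2) ⊆ ball x r := fun y hy =>
    ball_subset_ball' (by have := mem_ball.1 hy; linarith)
  have hd : ∀ n, ∀ y ∈ ball x (r / 2), ‖fderiv ℂ (f n) y‖ ≤ 2 * u n / (r / 2) := fun n y hy =>
    norm_fderiv_le_of_bounded (half_pos hr) ((hf n).mono (hsub y hy))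
      fun w hw => hb n w (hsub y hy hw)
  have hu' : Summable fun n => 2 * u n / (r / 2) := (hu.mul_left 2).div_const _
  have hx : x ∈ ball x (r / 2) := mem_ball_self (half_pos hr)
  refine ⟨.of_norm_bounded hu' fun n => hd n x hx, ?_⟩
  -- Real scalars serve only to speak of the convexity, hence connectedness, of the ball.
  let : NormedSpace ℝ E := NormedSpace.restrictScalars ℝ ℂ E
  refine hasFDerivAt_tsum_of_isPreconnected hu' isOpen_ball
    (convex_ball x (r / 2)).isPreconnected (fun n y hy => ?_) hd hx
    (.of_norm_bounded hu fun n => hb n x (mem_ball_self hr)) hx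
  exact ((hf n).differentiableAt (isOpen_ball.mem_nhds
    (hsub y hy (mem_ball_self (half_pos hr))))).hasFDerivAt

/-- A series of functions differentiable at `x` whose tail is normally convergent near `x`. -/
theorem hasFDerivAt_tsum_of_tail {f : ℕ → E → ℂ} {u : ℕ → ℝ} (hu : Summable u) {x : E} {r : ℝ}
    (hr : 0 < r) (N : ℕ) (hx : ∀ n, DifferentiableAt ℂ (f n) x)
    (hf : ∀ n, N ≤ n → DifferentiableOn ℂ (f n) (ball x r))
    (hb : ∀ n, N ≤ n → ∀ y ∈ ball x r, ‖f n y‖ ≤ u n) :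
    Summable (fun n => fderiv ℂ (f n) x) ∧
      HasFDerivAt (fun y => ∑' n, f n y) (∑' n, fderiv ℂ (f n) x) x := by
  have hu' : Summable fun n => u (n + N) := (summable_nat_add_iff N).2 hu
  obtain ⟨h1, h2⟩ := hasFDerivAt_tsum_of_bounded (f := fun n => f (n + N)) hu' hr
    (fun n => hf (n + N) (Nat.le_add_left N n)) (fun n => hb (n + N) (Nat.le_add_left N n))
  have h3 : Summable (fun n => fderiv ℂ (f n) x) :=
    (summable_nat_add_iff (f := fun n => fderiv ℂ (f n) x) N).1 h1
  refine ⟨h3, ?_⟩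
  have h4 : HasFDerivAt (fun y => ∑ n ∈ Finset.range N, f n y)
      (∑ n ∈ Finset.range N, fderiv ℂ (f n) x) x :=
    HasFDerivAt.fun_sum fun n _ => (hx n).hasFDerivAt
  have h5 : ∀ y ∈ ball x r,
      ∑ n ∈ Finset.range N, f n y + ∑' n, f (n + N) y = ∑' n, f n y := fun y hy =>
    ((summable_nat_add_iff (f := fun n => f n y) N).1 <|
      .of_norm_bounded hu' fun n => hb (n + N) (Nat.le_add_left N n) y hy).sum_add_tsum_nat_add N
  have h6 := h4.fun_add h2
  rw [h3.sum_add_tsum_nat_add N] at h6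
  refine h6.congr_of_eventuallyEq ?_
  filter_upwards [isOpen_ball.mem_nhds (mem_ball_self hr)] with y hy
  exact (h5 y hy).symm

/-- The second difference vanishes at 0 together with its derivative and is bounded by 4C, so a
Schwarz lemma of order two applies. It controls the change of a difference quotient when the step is
halved. -/
theorem norm_second_difference_le {g : ℂ → ℂ} {R C : ℝ} (hg : DifferentiableOn ℂ g (ball 0 R))
    (hC : ∀ s ∈ ball 0 R, ‖g s‖ ≤ C) {s : ℂ} (hs : s ∈ ball 0 R) :
    ‖2 * g (s / 2) - g 0 - g s‖ ≤ 4 * C * (‖s‖ / R) ^ 2 := by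
  have hR : 0 < R := nonempty_ball.1 ⟨s, hs⟩
  have hhalf : ∀ t ∈ ball (0 : ℂ) R, t / 2 ∈ ball (0 : ℂ) R := by
    intro t ht
    simp only [mem_ball_zero_iff, norm_div, norm_ofNat] at ht ⊢
    linarith [norm_nonneg t]
  set k : ℂ → ℂ := fun s => 2 * g (s / 2) - g 0 - g s with hk
  have hk0 : k 0 = 0 := by simp [hk]; ring
  have hd : DifferentiableOn ℂ k (ball 0 R) :=
    (((hg.comp (by fun_prop) hhalf).const_mul 2).sub_const _).sub hg
  have hm : Set.MapsTo k (ball 0 R) (closedBall (k 0) (4 * C)) := by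
    intro t ht
    rw [hk0, mem_closedBall_zero_iff]
    have h1 := hC _ (hhalf t ht)
    have h2 := hC 0 (mem_ball_self hR)
    have h3 := hC t ht
    calc ‖k t‖ ≤ ‖2 * g (t / 2) - g 0‖ + ‖g t‖ := norm_sub_le _ _
      _ ≤ ‖2 * g (t / 2)‖ + ‖g 0‖ + ‖g t‖ := by gcongr; exact norm_sub_le _ _
      _ ≤ 4 * C := by rw [norm_mul, norm_ofNat]; linarith
  have h0 : HasDerivAt g (deriv g 0) 0 :=
    (hg.differentiableAt (isOpen_ball.mem_nhds (mem_ball_self hR))).hasDerivAt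
  have hk' : HasDerivAt k 0 0 := by
    have h1 : HasDerivAt (fun s : ℂ => g (s / 2)) (deriv g 0 * (1 / 2)) 0 :=
      HasDerivAt.comp (h₂ := g) (h := fun s : ℂ => s / 2) 0 (by simpa using h0)
        ((hasDerivAt_id _).div_const 2)
    have h2 := ((h1.const_mul 2).sub_const (g 0)).sub h0
    rwa [show 2 * (deriv g 0 * (1 / 2)) - deriv g 0 = 0 by ring] at h2
  have := dist_le_mul_div_pow_of_mapsTo_ball_of_isLittleO (n := 1) hd hm ?_ hs
  · simpa [hk0, dist_eq_norm] using this
  · have := hk'.isLittleO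
    simp only [smul_zero, sub_zero, pow_one] at this ⊢
    exact this.norm_right

/-- Directional derivatives of holomorphic functions are holomorphic. -/
theorem differentiableOn_fderiv_apply {f : E → ℂ} {U : Set E} (hU : IsOpen U)
    (hf : DifferentiableOn ℂ f U) (v : E) :
    DifferentiableOn ℂ (fun x => fderiv ℂ f x v) U := by
  intro x₀ hx₀
  apply DifferentiableAt.differentiableWithinAt
  obtain ⟨r, hr, hrU⟩ : ∃ r > 0, ball x₀ r ⊆ U ∧ ∀ y ∈ ball x₀ r, ‖f y‖ ≤ ‖f x₀‖ + 1 := by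
    have h1 : ∀ᶠ y in 𝓝 x₀, ‖f y‖ < ‖f x₀‖ + 1 :=
      (hf.continuousOn.continuousAt (hU.mem_nhds hx₀)).norm.eventually_lt_const (by simp)
    obtain ⟨r, hr, h⟩ := Metric.eventually_nhds_iff_ball.1 (h1.and (hU.mem_nhds hx₀))
    exact ⟨r, hr, fun y hy => (h y hy).2, fun y hy => (h y hy).1.le⟩
  obtain ⟨hrU, hC⟩ := hrU
  set C := ‖f x₀‖ + 1
  obtain ⟨R, hR, hRv⟩ : ∃ R > 0, R * ‖v‖ ≤ r / 2 := by
    refine ⟨r / 2 / (‖v‖ + 1), by positivity, ?_⟩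
    rw [div_mul_eq_mul_div, div_le_iff₀ (by positivity)]
    nlinarith [norm_nonneg v]
  have hmem : ∀ x ∈ ball x₀ (r / 2), ∀ s ∈ ball (0 : ℂ) R, x + s • v ∈ ball x₀ r := by
    intro x hx s hs
    rw [mem_ball, dist_eq_norm] at hx ⊢
    rw [mem_ball_zero_iff] at hs
    calc ‖x + s • v - x₀‖ = ‖(x - x₀) + s • v‖ := by congr 1; abel
      _ ≤ ‖x - x₀‖ + ‖s‖ * ‖v‖ := by rw [← norm_smul]; exact norm_add_le _ _
      _ < r / 2 + r / 2 := by
        have : ‖s‖ * ‖v‖ ≤ R * ‖v‖ := by gcongr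
        linarith
      _ = r := by ring
  obtain ⟨ε, hε, hεR⟩ : ∃ ε > 0, ε < R := ⟨R / 2, by positivity, by linarith⟩
  -- The difference quotients `h n` with step ε/2^n are holomorphic in x. Consecutive ones differ by
  -- a second difference divided by `s n`, which is O(2^(-n)), so their telescoping series converges
  -- normally to the derivative along v.
  set s : ℕ → ℂ := fun n => (ε : ℂ) * (1 / 2) ^ n with hsdef
  have hsn : ∀ n, ‖s n‖ = ε * (1 / 2) ^ n := by intro n; simp [hsdef, abs_of_pos hε]
  have hs0 : ∀ n, s n ≠ 0 := fun n => by simp [hsdef, hε.ne']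
  have hsR : ∀ n, s n ∈ ball (0 : ℂ) R := by
    intro n
    rw [mem_ball_zero_iff, hsn]
    have : (1 / 2 : ℝ) ^ n ≤ 1 := pow_le_one₀ (by norm_num) (by norm_num)
    nlinarith
  set h : ℕ → E → ℂ := fun n x => (s n)⁻¹ * (f (x + s n • v) - f x) with hh
  have hx₀r : ∀ x ∈ ball x₀ (r / 2), x ∈ ball x₀ r := fun x hx =>
    ball_subset_ball (by linarith) hx
  have hhd : ∀ n, DifferentiableOn ℂ (h n) (ball x₀ (r / 2)) := by
    intro n
    have hf' := hf.mono hrU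
    exact ((hf'.comp (by fun_prop) fun x hx => hmem x hx _ (hsR n)).sub (hf'.mono hx₀r)).const_mul _
  have hline : ∀ x ∈ ball x₀ (r / 2),
      DifferentiableOn ℂ (fun t : ℂ => f (x + t • v)) (ball 0 R) := fun x hx =>
    (hf.mono hrU).comp (by fun_prop) fun t ht => hmem x hx t ht
  have hbd : ∀ n, ∀ x ∈ ball x₀ (r / 2), ‖h (n + 1) x - h n x‖ ≤
      4 * C * ε / R ^ 2 * (1 / 2) ^ n := by
    intro n x hx
    have hs1 : s (n + 1) = s n / 2 := by simp only [hsdef, pow_succ]; ring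
    have h1 := norm_second_difference_le (hline x hx) (fun t ht => hC _ (hmem x hx t ht)) (hsR n)
    have h2 : h (n + 1) x - h n x = (s n)⁻¹ *
        (2 * f (x + (s n / 2) • v) - f (x + (0 : ℂ) • v) - f (x + s n • v)) := by
      simp only [hh, hs1, zero_smul, add_zero]
      have := hs0 n
      field_simp
      ring
    rw [h2, norm_mul, norm_inv]
    have h3 : 0 < ‖s n‖ := norm_pos_iff.2 (hs0 n)
    calc _ ≤ ‖s n‖⁻¹ * (4 * C * (‖s n‖ / R) ^ 2) := by gcongr
      _ = 4 * C * ‖s n‖ / R ^ 2 := by field_simp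
      _ = _ := by rw [hsn]; ring
  have hsum : Summable fun n : ℕ => 4 * C * ε / R ^ 2 * (1 / 2 : ℝ) ^ n :=
    summable_geometric_two.mul_left _
  obtain ⟨-, hT⟩ := hasFDerivAt_tsum_of_bounded hsum (half_pos hr)
    (fun n => (hhd (n + 1)).sub (hhd n)) hbd
  have hx₀' : x₀ ∈ ball x₀ (r / 2) := mem_ball_self (half_pos hr)
  refine (((hhd 0).differentiableAt (isOpen_ball.mem_nhds hx₀')).add
    hT.differentiableAt).congr_of_eventuallyEq ?_
  filter_upwards [isOpen_ball.mem_nhds hx₀'] with x hx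
  have h1 : HasSum (fun n => h (n + 1) x - h n x) (fderiv ℂ f x v - h 0 x) := by
    rw [Summable.hasSum_iff_tendsto_nat (.of_norm_bounded hsum fun n => hbd n x hx)]
    simp only [Finset.sum_range_sub (fun n => h n x)]
    refine Tendsto.sub_const ?_ _
    have h2 : HasFDerivAt f (fderiv ℂ f x) x := ((hf.mono hrU).differentiableAt
      (isOpen_ball.mem_nhds (hx₀r x hx))).hasFDerivAt
    have h3 := (h2.hasLineDerivAt v).tendsto_slope_zero
    refine h3.comp (tendsto_nhdsWithin_iff.2 ⟨?_, .of_forall hs0⟩)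
    have := (tendsto_pow_atTop_nhds_zero_of_norm_lt_one
      (x := (1 / 2 : ℂ)) (by norm_num)).const_mul (ε : ℂ)
    simpa [hsdef] using this
  have := h1.tsum_eq
  simp only [Pi.add_apply, Pi.sub_apply] at this ⊢
  rw [this]
  ring

end SeveralVariables

end QuasiJacobi

end

/-! ### Cauchy integrals with parameters and leading Laurent coefficients along z = 0. -/

noncomputable section

namespace QuasiJacobi
open Complex Filter Topology Metric

/-- A Cauchy type integral depends holomorphically on parameters. -/
theorem differentiableOn_circleIntegral {F : ℂ × ℂ → ℂ} {U : Set (ℂ × ℂ)} (hU : IsOpen U)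
    (hF : DifferentiableOn ℂ F U) {c : ℂ → ℂ} {r : ℝ} (hr : 0 ≤ r)
    (hc : ContinuousOn c (sphere 0 r)) {V : Set ℂ} (hV : IsOpen V)
    (hVU : ∀ τ ∈ V, ∀ w ∈ sphere (0 : ℂ) r, (τ, w) ∈ U) :
    DifferentiableOn ℂ (fun τ => ∮ w in C(0, r), c w * F (τ, w)) V := by
  intro τ₀ hτ₀
  obtain ⟨δ, hδ, hδV⟩ := nhds_basis_closedBall.mem_iff.1 (hV.mem_nhds hτ₀)
  have hdF := differentiableOn_fderiv_apply hU hF ((1 : ℂ), (0 : ℂ))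
  have hKU : closedBall τ₀ δ ×ˢ sphere (0 : ℂ) r ⊆ U := fun x hx => hVU x.1 (hδV hx.1) x.2 hx.2
  have hs : ∀ θ : ℝ, circleMap 0 r θ ∈ sphere (0 : ℂ) r := fun θ => circleMap_mem_sphere 0 hr θ
  have hcont : ∀ G : ℂ × ℂ → ℂ, ContinuousOn G U → ∀ τ ∈ closedBall τ₀ δ, Continuous fun θ : ℝ =>
      deriv (circleMap 0 r) θ • (c (circleMap 0 r θ) * G (τ, circleMap 0 r θ)) := by
    intro G hG τ hτ
    have h1 : Continuous fun θ : ℝ => c (circleMap 0 r θ) :=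
      hc.comp_continuous (continuous_circleMap 0 r) hs
    have h2 : Continuous fun θ : ℝ => G (τ, circleMap 0 r θ) :=
      hG.comp_continuous (by fun_prop) fun θ => hVU τ (hδV hτ) _ (hs θ)
    simp only [deriv_circleMap]
    exact ((continuous_circleMap 0 r).mul continuous_const).smul (h1.mul h2)
  -- The partial derivative in τ is itself holomorphic, hence bounded on this compact set; this
  -- dominates the differentiated integrand.
  obtain ⟨M, hM⟩ := ((isCompact_closedBall τ₀ δ).prod (isCompact_sphere (0 : ℂ) r)).exists_bound_of_continuousOn
    (hdF.continuousOn.mono hKU)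
  obtain ⟨M', hM'⟩ := (isCompact_sphere (0 : ℂ) r).exists_bound_of_continuousOn hc
  have hball : ball τ₀ δ ∈ 𝓝 τ₀ := ball_mem_nhds _ hδ
  have hsub := ball_subset_closedBall (x := τ₀) (ε := δ)
  have hτ₀' : τ₀ ∈ closedBall τ₀ δ := mem_closedBall_self hδ.le
  have key := intervalIntegral.hasDerivAt_integral_of_dominated_loc_of_deriv_le
    (μ := MeasureTheory.volume) (a := 0) (b := 2 * Real.pi) (bound := fun _ => r * (M' * M))
    (F := fun τ θ => deriv (circleMap 0 r) θ • (c (circleMap 0 r θ) * F (τ, circleMap 0 r θ)))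
    (F' := fun τ θ => deriv (circleMap 0 r) θ •
      (c (circleMap 0 r θ) * fderiv ℂ F (τ, circleMap 0 r θ) ((1 : ℂ), (0 : ℂ)))) hball
    (by
      filter_upwards [hball] with τ hτ
      exact (hcont F hF.continuousOn τ (hsub hτ)).aestronglyMeasurable)
    ((hcont F hF.continuousOn τ₀ hτ₀').intervalIntegrable _ _)
    (hcont _ hdF.continuousOn τ₀ hτ₀').aestronglyMeasurable
    (.of_forall fun θ _ τ hτ => by
      have h1 := hM (τ, circleMap 0 r θ) ⟨hsub hτ, hs θ⟩
      have h2 := hM' _ (hs θ)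
      rw [norm_smul, norm_mul]
      have h3 : ‖deriv (circleMap 0 r) θ‖ = r := by simp [abs_of_nonneg hr]
      rw [h3]
      gcongr
      exact (norm_nonneg _).trans h2)
    intervalIntegrable_const
    (.of_forall fun θ _ τ hτ => by
      have h1 : HasFDerivAt F (fderiv ℂ F (τ, circleMap 0 r θ)) (τ, circleMap 0 r θ) :=
        (hF.differentiableAt (hU.mem_nhds (hVU τ (hδV (hsub hτ)) _ (hs θ)))).hasFDerivAt
      have h2 : HasDerivAt (fun τ : ℂ => (τ, circleMap 0 r θ)) ((1 : ℂ), (0 : ℂ)) τ :=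
        (hasDerivAt_id τ).prodMk (hasDerivAt_const τ _)
      have h3 := h1.comp_hasDerivAt τ h2
      exact (h3.const_mul (c (circleMap 0 r θ))).fun_const_smul (deriv (circleMap 0 r) θ))
  exact key.2.differentiableAt.differentiableWithinAt

/-- A bounded holomorphic function on a punctured neighbourhood has an extension. -/
theorem exists_differentiableOn_ball_of_bounded {f : ℂ → ℂ} {R : ℝ} (hR : 0 < R)
    (hf : ∀ z ∈ ball (0 : ℂ) R, z ≠ 0 → DifferentiableAt ℂ f z)
    (hb : IsBoundedUnder (· ≤ ·) (𝓝[≠] 0) fun z => ‖f z‖) :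
    ∃ h : ℂ → ℂ, DifferentiableOn ℂ h (ball 0 R) ∧ ∀ z, z ≠ 0 → h z = f z := by
  refine ⟨Function.update f 0 (limUnder (𝓝[≠] 0) f),
    differentiableOn_update_limUnder_of_isLittleO (ball_mem_nhds 0 hR)
      (fun z hz => (hf z hz.1 hz.2).differentiableWithinAt) ?_, fun z hz => by simp [hz]⟩
  refine IsBoundedUnder.isLittleO_sub_self_inv ?_
  obtain ⟨C, hC⟩ := hb
  refine ⟨C + ‖f 0‖, ?_⟩
  rw [eventually_map] at hC ⊢
  filter_upwards [hC] with z hz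
  exact (norm_sub_le _ _).trans (by simpa using hz)

theorem mem_latticeCompl_of_norm_lt {y : ℝ} {τ z : ℂ} (hy : 0 < y) (hτ : y < τ.im) (hz : z ≠ 0)
    (hz' : ‖z‖ < min 1 y) : (τ, z) ∈ latticeCompl := by
  refine ⟨hy.trans hτ, fun a b h => hz ?_⟩
  simp only at h
  have h1 : z.im = a * τ.im := by simp [h]
  have ha : a = 0 := by
    by_contra ha
    have h2 : (1 : ℝ) ≤ |(a : ℝ)| := by exact_mod_cast Int.one_le_abs ha
    have h3 := abs_im_le_norm z
    rw [h1, abs_mul, abs_of_pos (hy.trans hτ)] at h3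
    have := hz'.trans_le (min_le_right _ _)
    nlinarith
  have h2 : z = b := by simp [h, ha]
  have hb : b = 0 := by
    by_contra hb
    have h3 : (1 : ℝ) ≤ |(b : ℝ)| := by exact_mod_cast Int.one_le_abs hb
    have := hz'.trans_le (min_le_left _ _)
    rw [h2, norm_intCast] at this
    linarith
  simp [h2, hb]

/-- In the real coordinates (a, b) with z = aτ + b, which depend continuously on (τ, z), the
excluded set is the preimage of the closed set ℤ × ℤ. -/
theorem isOpen_latticeCompl : IsOpen latticeCompl := by
  have h1 : IsOpen {p : ℂ × ℂ | 0 < p.1.im} := isOpen_lt continuous_const (by fun_prop)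
  set f : ℂ × ℂ → ℝ × ℝ := fun p => (p.2.im / p.1.im, p.2.re - p.2.im / p.1.im * p.1.re) with hf
  have hfc : ContinuousOn f {p : ℂ × ℂ | 0 < p.1.im} := by
    have h2 : ContinuousOn (fun p : ℂ × ℂ => p.2.im / p.1.im) {p : ℂ × ℂ | 0 < p.1.im} :=
      ContinuousOn.div (by fun_prop) (by fun_prop) fun p hp => ne_of_gt hp
    fun_prop
  have hZ : IsClosed (Set.range ((↑) : ℤ → ℝ)) := Int.isClosedEmbedding_coe_real.isClosed_range
  have := hfc.isOpen_inter_preimage h1 (hZ.prod hZ).isOpen_compl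
  convert this using 1
  ext ⟨τ, z⟩
  refine and_congr_right fun hτ => ?_
  simp only at hτ
  simp only [Set.mem_preimage, Set.mem_compl_iff, Set.mem_prod, Set.mem_range, hf, not_and,
    not_exists, forall_exists_index]
  constructor
  · intro h a ha b hb
    refine h a b (Complex.ext ?_ ?_)
    · simp only [add_re, mul_re, intCast_re, intCast_im, zero_mul, sub_zero]
      rw [ha, hb]; ring
    · simp only [add_im, mul_im, intCast_re, intCast_im, zero_mul, add_zero]
      rw [ha]; field_simp
  · intro h a b hab
    have h2 : z.im = a * τ.im := by simp [hab]
    have h3 : z.re = a * τ.re + b := by simp [hab]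
    have h4 : (a : ℝ) = z.im / τ.im := by rw [h2]; field_simp
    refine h a h4 b ?_
    rw [← h4, h3]; ring

/-- If `z ^ N F(τ, z)` is bounded as `z → 0` for `τ` near the cusp, then it has a limit for all `τ`
in the upper half plane, and the limit is holomorphic. -/
theorem exists_leading_coefficient {F : ℂ × ℂ → ℂ} (hF : DifferentiableOn ℂ F latticeCompl)
    (N : ℕ) {T : ℝ} (hb : ∀ τ : ℂ, 0 < τ.im → T < τ.im →
      IsBoundedUnder (· ≤ ·) (𝓝[≠] 0) fun z => ‖z ^ N * F (τ, z)‖) :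
    ∃ a : ℂ → ℂ, DifferentiableOn ℂ a {τ | 0 < τ.im} ∧
      ∀ τ : ℂ, 0 < τ.im → Tendsto (fun z => z ^ N * F (τ, z)) (𝓝[≠] 0) (𝓝 (a τ)) := by
  -- For Im τ > y the punctured disc of radius min 1 y misses the lattice, so a single circle serves
  -- all these τ.
  have main : ∀ y : ℝ, 0 < y → ∃ a : ℂ → ℂ, DifferentiableOn ℂ a {τ | y < τ.im} ∧
      ∀ τ : ℂ, y < τ.im → Tendsto (fun z => z ^ N * F (τ, z)) (𝓝[≠] 0) (𝓝 (a τ)) := by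
    intro y hy
    set R := min 1 y with hR
    have hR0 : 0 < R := lt_min one_pos hy
    set r := R / 2 with hr
    have hr0 : 0 < r := half_pos hR0
    have hrR : r < R := half_lt_self hR0
    set H : ℂ × ℂ → ℂ := fun p => p.2 ^ N * F p with hH
    have hHd : DifferentiableOn ℂ H latticeCompl :=
      DifferentiableOn.mul (by fun_prop) hF
    have hVo : IsOpen {τ : ℂ | y < τ.im} := isOpen_lt continuous_const continuous_im
    have hVc : IsPreconnected {τ : ℂ | y < τ.im} := (convex_halfSpace_im_gt y).isPreconnected
    have hVU : ∀ τ ∈ {τ : ℂ | y < τ.im}, ∀ w ∈ sphere (0 : ℂ) r, (τ, w) ∈ latticeCompl := by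
      intro τ hτ w hw
      rw [mem_sphere_zero_iff_norm] at hw
      exact mem_latticeCompl_of_norm_lt hy hτ (norm_pos_iff.1 (hw ▸ hr0)) (hw ▸ hrR)
    -- This Cauchy integral makes sense whether or not the singularity of `H` at z = 0 is removable.
    -- Near the cusp it is removable and `G` reproduces `H`; for fixed z ≠ 0 both sides are
    -- holomorphic in τ, so the identity theorem extends the equality to the whole half-plane.
    set G : ℂ → ℂ → ℂ := fun z τ => (2 * Real.pi * I : ℂ)⁻¹ • ∮ w in C(0, r), (w - z)⁻¹ • H (τ, w)
      with hG
    have hGd : ∀ z ∈ ball (0 : ℂ) r, DifferentiableOn ℂ (G z) {τ | y < τ.im} := by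
      intro z hz
      refine DifferentiableOn.const_smul (differentiableOn_circleIntegral isOpen_latticeCompl hHd
        (c := fun w => (w - z)⁻¹) hr0.le ?_ hVo hVU) (2 * Real.pi * I : ℂ)⁻¹
      refine ContinuousOn.inv₀ (by fun_prop) fun w hw h => ?_
      rw [sub_eq_zero.1 h, mem_sphere_zero_iff_norm] at hw
      rw [mem_ball_zero_iff] at hz
      linarith
    have hslice : ∀ τ : ℂ, y < τ.im → ∀ z ∈ ball (0 : ℂ) R, z ≠ 0 →
        DifferentiableAt ℂ (fun z => H (τ, z)) z := by
      intro τ hτ z hz hz0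
      have h1 := hHd.differentiableAt (isOpen_latticeCompl.mem_nhds
        (mem_latticeCompl_of_norm_lt hy hτ hz0 (mem_ball_zero_iff.1 hz)))
      exact h1.comp z (by fun_prop : DifferentiableAt ℂ (fun z : ℂ => (τ, z)) z)
    have hnear : ∀ τ : ℂ, y < τ.im → T < τ.im → ∀ z ∈ ball (0 : ℂ) r, z ≠ 0 →
        G z τ = H (τ, z) := by
      intro τ hτ hτT z hz hz0
      obtain ⟨h, hd, he⟩ := exists_differentiableOn_ball_of_bounded hR0 (hslice τ hτ)
        (hb τ (hy.trans hτ) hτT)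
      rw [← he z hz0]
      have h1 := (hd.mono (closedBall_subset_ball hrR)).circleIntegral_sub_inv_smul hz
      have h2 : (∮ w in C(0, r), (w - z)⁻¹ • H (τ, w)) = ∮ w in C(0, r), (w - z)⁻¹ • h w := by
        refine circleIntegral.integral_congr hr0.le fun w hw => ?_
        have hw0 : w ≠ 0 := by
          rintro rfl
          simp [hr0.ne] at hw
        simp only [he w hw0]
      simp only [hG, h2, h1]
      rw [inv_smul_smul₀]
      simp [Real.pi_ne_zero]
    have hall : ∀ τ : ℂ, y < τ.im → ∀ z ∈ ball (0 : ℂ) r, z ≠ 0 → G z τ = H (τ, z) := by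
      intro τ hτ z hz hz0
      have hd2 : DifferentiableOn ℂ (fun τ => H (τ, z)) {τ | y < τ.im} := by
        refine hHd.comp (by fun_prop : DifferentiableOn ℂ (fun τ : ℂ => (τ, z)) _) fun τ hτ => ?_
        exact mem_latticeCompl_of_norm_lt hy hτ hz0 ((mem_ball_zero_iff.1 hz).trans hrR)
      have h0 : (I * ((max y T + 1 : ℝ) : ℂ)) ∈ {τ : ℂ | y < τ.im} := by
        simp only [Set.mem_ofPred_eq, mul_im, I_re, I_im, ofReal_im, ofReal_re]
        linarith [le_max_left y T]
      refine ((hGd z hz).analyticOnNhd hVo).eqOn_of_preconnected_of_eventuallyEq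
        (hd2.analyticOnNhd hVo) hVc h0 ?_ hτ
      have h1 : ∀ᶠ τ : ℂ in 𝓝 (I * ((max y T + 1 : ℝ) : ℂ)), max y T < τ.im := by
        refine (isOpen_lt continuous_const continuous_im).mem_nhds ?_
        simp only [Set.mem_ofPred_eq, mul_im, I_re, I_im, ofReal_im, ofReal_re]
        linarith
      filter_upwards [h1] with τ hτ
      exact hnear τ ((le_max_left _ _).trans_lt hτ) ((le_max_right _ _).trans_lt hτ) z hz hz0
    refine ⟨G 0, hGd 0 (mem_ball_self hr0), fun τ hτ => ?_⟩
    have hci : CircleIntegrable (fun w => H (τ, w)) 0 r := by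
      refine ContinuousOn.circleIntegrable hr0.le ?_
      exact hHd.continuousOn.comp (by fun_prop) fun w hw => hVU τ hτ w hw
    have hps := hasFPowerSeriesOn_cauchy_integral (R := ⟨r, hr0.le⟩) hci hr0
    have hcont : ContinuousAt (fun z => G z τ) 0 := hps.analyticAt.continuousAt
    refine (hcont.tendsto.mono_left nhdsWithin_le_nhds).congr' ?_
    filter_upwards [self_mem_nhdsWithin, mem_nhdsWithin_of_mem_nhds (ball_mem_nhds 0 hr0)]
      with z hz0 hz
    exact hall τ hτ z hz hz0
  choose! a ha hat using main
  -- The bound y = Im τ / 2 varies with τ, but uniqueness of limits makes the glued function agree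
  -- locally with a single holomorphic one.
  refine ⟨fun τ => a (τ.im / 2) τ, fun τ hτ => ?_, fun τ hτ => ?_⟩
  · have hτ' : (0 : ℝ) < τ.im := hτ
    have h1 : {σ : ℂ | τ.im / 2 < σ.im} ∈ 𝓝 τ :=
      (isOpen_lt continuous_const continuous_im).mem_nhds (by simp [hτ'])
    refine (((ha (τ.im / 2) (half_pos hτ')).differentiableAt h1).congr_of_eventuallyEq
      ?_).differentiableWithinAt
    filter_upwards [h1] with σ hσ
    have hσ0 : 0 < σ.im := (half_pos hτ').trans hσ
    exact tendsto_nhds_unique (hat _ (half_pos hσ0) σ (by linarith)) (hat _ (half_pos hτ') σ hσ)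
  · exact hat _ (half_pos hτ) τ (by linarith)

end QuasiJacobi

end

/-! ### Slices of fixed τ and a Liouville theorem for quasi-periodic functions. -/

noncomputable section

namespace QuasiJacobi
open Complex Filter Topology Metric

/-- The lattice `ℤ τ + ℤ`. -/
def periodPair (τ : ℂ) (hτ : 0 < τ.im) : PeriodPair where
  ω₁ := τ
  ω₂ := 1
  indep := by
    rw [LinearIndependent.pair_iff]
    intro s t h
    have h1 := congrArg Complex.im h
    have h2 := congrArg Complex.re h
    simp only [real_smul, mul_one, add_im, mul_im, ofReal_re, ofReal_im, zero_mul, add_zero,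
      zero_im, mul_eq_zero] at h1
    have hs : s = 0 := h1.resolve_right hτ.ne'
    subst hs
    simpa using h2

theorem mem_latticeCompl_iff {τ : ℂ} (hτ : 0 < τ.im) {z : ℂ} :
    (τ, z) ∈ latticeCompl ↔ z ∉ (periodPair τ hτ).lattice := by
  simp only [latticeCompl, Set.mem_ofPred_eq, hτ, true_and, PeriodPair.mem_lattice, periodPair,
    mul_one, not_exists, ne_eq, eq_comm]

theorem countable_lattice_slice (τ : ℂ) (hτ : 0 < τ.im) :
    {z : ℂ | (τ, z) ∈ latticeCompl}ᶜ.Countable := by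
  refine (Set.countable_range fun p : ℤ × ℤ => (p.1 : ℂ) * τ + p.2).mono fun z hz => ?_
  simp only [Set.mem_compl_iff, Set.mem_ofPred_eq, latticeCompl, hτ, true_and, not_forall,
    not_not] at hz
  obtain ⟨a, b, h⟩ := hz
  exact ⟨(a, b), h.symm⟩

theorem dense_slice (τ : ℂ) (hτ : 0 < τ.im) : Dense {z : ℂ | (τ, z) ∈ latticeCompl} := by
  simpa using (countable_lattice_slice τ hτ).dense_compl ℝ

theorem isOpen_slice (τ : ℂ) : IsOpen {z : ℂ | (τ, z) ∈ latticeCompl} :=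
  isOpen_latticeCompl.preimage (by fun_prop : Continuous fun z : ℂ => (τ, z))

theorem isPreconnected_slice (τ : ℂ) (hτ : 0 < τ.im) :
    IsPreconnected {z : ℂ | (τ, z) ∈ latticeCompl} := by
  have := (countable_lattice_slice τ hτ).isConnected_compl_of_one_lt_rank (E := ℂ)
    (by simp [Complex.rank_real_complex])
  simpa using this.isPreconnected

theorem eventually_mem_slice {τ : ℂ} (hτ : 0 < τ.im) :
    ∀ᶠ z in 𝓝[≠] (0 : ℂ), (τ, z) ∈ latticeCompl := by
  have hR : 0 < min 1 (τ.im / 2) := lt_min one_pos (half_pos hτ)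
  filter_upwards [self_mem_nhdsWithin, mem_nhdsWithin_of_mem_nhds (ball_mem_nhds 0 hR)]
    with z hz0 hz
  exact mem_latticeCompl_of_norm_lt (half_pos hτ) (half_lt_self hτ) hz0 (mem_ball_zero_iff.1 hz)

theorem translate_mem_iff {τ z : ℂ} (m n : ℤ) :
    (τ, z + m * τ + n) ∈ latticeCompl ↔ (τ, z) ∈ latticeCompl := by
  refine ⟨fun h => ?_, fun h => translate_mem m n (τ, z) h⟩
  have := translate_mem (-m) (-n) _ h
  simp only [Int.cast_neg] at this
  convert this using 2
  ring

/-- A function holomorphic off a lattice with one true and one quasi-period, and with a bounded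
singularity, is constant. -/
theorem eq_const_of_quasiPeriodic {τ : ℂ} (hτ : 0 < τ.im) {h : ℂ → ℂ} {κ : ℂ}
    (hd : ∀ z, (τ, z) ∈ latticeCompl → DifferentiableAt ℂ h z)
    (h1 : ∀ z, (τ, z) ∈ latticeCompl → h (z + 1) = h z)
    (h2 : ∀ z, (τ, z) ∈ latticeCompl → h (z + τ) = h z + κ)
    (hb : IsBoundedUnder (· ≤ ·) (𝓝[≠] 0) fun z => ‖h z‖) :
    κ = 0 ∧ ∃ c, ∀ z, (τ, z) ∈ latticeCompl → h z = c := by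
  have t1 : ∀ z, (τ, z) ∈ latticeCompl → (τ, z + 1) ∈ latticeCompl := fun z hz => by
    simpa using (translate_mem_iff 0 1).2 hz
  have t2 : ∀ z, (τ, z) ∈ latticeCompl → (τ, z + τ) ∈ latticeCompl := fun z hz => by
    simpa using (translate_mem_iff 1 0).2 hz
  have hn : ∀ (n : ℤ) (z : ℂ), (τ, z) ∈ latticeCompl → h (z + n) = h z := by
    intro n
    induction n using Int.induction_on with
    | zero => intro z _; simp
    | succ i ih =>
      intro z hz
      have h3 := h1 (z + i) (by simpa using (translate_mem_iff 0 i).2 hz)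
      have h4 := ih z hz
      push_cast at h4 ⊢
      rw [← add_assoc, h3, h4]
    | pred i ih =>
      intro z hz
      have h3 := h1 (z + (-(i : ℤ) - 1 : ℤ))
        (by simpa using (translate_mem_iff 0 (-(i : ℤ) - 1)).2 hz)
      have h4 := ih z hz
      push_cast at h3 h4 ⊢
      rw [← h3, ← h4]
      ring_nf
  have hm : ∀ (m : ℤ) (z : ℂ), (τ, z) ∈ latticeCompl → h (z + m * τ) = h z + m * κ := by
    intro m
    induction m using Int.induction_on with
    | zero => intro z _; simp
    | succ i ih =>
      intro z hz
      have h3 := h2 (z + i * τ) (by simpa using (translate_mem_iff i 0).2 hz)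
      have h4 := ih z hz
      push_cast at h4 ⊢
      rw [h4] at h3
      rw [show z + (i + 1) * τ = z + i * τ + τ by ring, h3]; ring
    | pred i ih =>
      intro z hz
      have h3 := h2 (z + (-(i : ℤ) - 1 : ℤ) * τ)
        (by simpa using (translate_mem_iff (-(i : ℤ) - 1) 0).2 hz)
      have h4 := ih z hz
      push_cast at h3 h4 ⊢
      rw [show z + (-(i : ℂ) - 1) * τ + τ = z + -i * τ by ring, h4] at h3
      linear_combination -h3
  have hmn : ∀ (m n : ℤ) (z : ℂ), (τ, z) ∈ latticeCompl → h (z + m * τ + n) = h z + m * κ := by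
    intro m n z hz
    rw [hn n _ (by simpa using (translate_mem_iff m 0).2 hz), hm m z hz]
  -- The quasi-period relations carry the removable singularity at 0 to every lattice point, so
  -- taking limits yields an entire extension.
  set H : ℂ → ℂ := fun z => limUnder (𝓝[≠] z) h with hH
  have hHS : ∀ z, (τ, z) ∈ latticeCompl → H z = h z := fun z hz =>
    ((hd z hz).continuousAt.tendsto.mono_left nhdsWithin_le_nhds).limUnder_eq
  have hR : 0 < min 1 (τ.im / 2) := lt_min one_pos (half_pos hτ)
  obtain ⟨h0, h0d, h0e⟩ := exists_differentiableOn_ball_of_bounded hR (fun z hz hz0 => hd z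
    (mem_latticeCompl_of_norm_lt (half_pos hτ) (half_lt_self hτ) hz0 (mem_ball_zero_iff.1 hz))) hb
  have h0d' : DifferentiableAt ℂ h0 0 := h0d.differentiableAt (ball_mem_nhds 0 hR)
  have hHd : Differentiable ℂ H := by
    intro z
    by_cases hz : (τ, z) ∈ latticeCompl
    · refine (hd z hz).congr_of_eventuallyEq ?_
      filter_upwards [(isOpen_slice τ).mem_nhds hz] with w hw using hHS w hw
    · obtain ⟨m, n, rfl⟩ : ∃ m n : ℤ, z = m * τ + n := by
        simpa [latticeCompl, hτ] using hz
      have hev : ∀ᶠ w in 𝓝[≠] (m * τ + n : ℂ),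
          (τ, w - (m * τ + n)) ∈ latticeCompl ∧ w - (m * τ + n) ≠ 0 := by
        have htd : Tendsto (fun w : ℂ => w - (m * τ + n)) (𝓝[≠] (m * τ + n : ℂ)) (𝓝[≠] 0) := by
          refine tendsto_nhdsWithin_iff.2 ⟨?_, ?_⟩
          · have : Continuous fun w : ℂ => w - (m * τ + n) := by fun_prop
            simpa using (this.tendsto (m * τ + n : ℂ)).mono_left nhdsWithin_le_nhds
          · filter_upwards [self_mem_nhdsWithin] with w hw using sub_ne_zero.2 hw
        exact htd.eventually ((eventually_mem_slice hτ).and self_mem_nhdsWithin)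
      have hloc : ∀ w : ℂ, (τ, w - (m * τ + n)) ∈ latticeCompl → w - (m * τ + n) ≠ 0 →
          h w = h0 (w - (m * τ + n)) + m * κ := by
        intro w hw hw0
        rw [h0e _ hw0, ← hmn m n _ hw]
        congr 1; ring
      have hdd : DifferentiableAt ℂ (fun w => h0 (w - (m * τ + n)) + m * κ) (m * τ + n) := by
        refine DifferentiableAt.add_const _ ?_
        refine DifferentiableAt.comp (g := h0) (f := fun w : ℂ => w - (m * τ + n)) _ ?_ (by fun_prop)
        simpa using h0d'
      refine hdd.congr_of_eventuallyEq ?_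
      have hev' := eventually_nhdsWithin_iff.1 hev
      filter_upwards [hev'] with w hw
      by_cases hw0 : w = m * τ + n
      · subst hw0
        refine Tendsto.limUnder_eq ?_
        refine (hdd.continuousAt.tendsto.mono_left nhdsWithin_le_nhds).congr' ?_
        filter_upwards [hev] with v hv using (hloc v hv.1 hv.2).symm
      · have h3 := hw hw0
        have h4 : (τ, w) ∈ latticeCompl := by
          have := (translate_mem_iff m n).2 h3.1
          rwa [show w - (m * τ + n) + m * τ + n = w by ring] at this
        rw [hHS w h4, hloc w h3.1 h3.2]
  have hHc := hHd.continuous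
  have hH1 : ∀ z, H (z + 1) = H z := by
    refine congrFun (Continuous.ext_on (dense_slice τ hτ) (by fun_prop) hHc fun z hz => ?_)
    rw [hHS z hz, hHS _ (t1 z hz), h1 z hz]
  have hH2 : ∀ z, H (z + τ) = H z + κ := by
    refine congrFun (Continuous.ext_on (dense_slice τ hτ) (by fun_prop) (by fun_prop) fun z hz => ?_)
    rw [hHS z hz, hHS _ (t2 z hz), h2 z hz]
  -- Differentiation removes κ, so `D` is entire and doubly periodic, hence constant. Then `H` is
  -- affine; the period 1 makes its slope zero, and the quasi-period τ then gives κ = 0.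
  set D := deriv H with hD
  have hD1 : ∀ z, D (z + 1) = D z := fun z => by
    rw [hD, ← deriv_comp_add_const H 1 z]; simp only [hH1]
  have hD2 : ∀ z, D (z + τ) = D z := fun z => by
    rw [hD, ← deriv_comp_add_const H τ z]; simp only [hH2]; simp
  have hDd : Differentiable ℂ D := by
    rw [hD, ← differentiableOn_univ]
    exact hHd.differentiableOn.deriv isOpen_univ
  have hper : ∀ (m n : ℤ) (z : ℂ), D (z - m * τ - n) = D z := by
    intro m n z
    have h3 : Function.Periodic D τ := hD2
    have h4 : Function.Periodic D 1 := hD1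
    rw [← mul_one (n : ℂ), h4.sub_int_mul_eq n, h3.sub_int_mul_eq m]
  have hDb : Bornology.IsBounded (Set.range D) := by
    refine ((isCompact_closedBall (0 : ℂ) (1 + τ.im)).image hDd.continuous).isBounded.subset ?_
    rintro _ ⟨z, rfl⟩
    set m := ⌊z.im / τ.im⌋ with hm'
    set n := ⌊(z - m * τ).re⌋ with hn'
    refine ⟨z - m * τ - n, ?_, hper m n z⟩
    rw [mem_closedBall_zero_iff]
    refine (norm_le_abs_re_add_abs_im _).trans (add_le_add ?_ ?_)
    · have h3 := Int.floor_le (z - m * τ).re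
      have h4 := Int.lt_floor_add_one (z - m * τ).re
      rw [sub_re (z - m * τ), intCast_re, abs_le]
      constructor <;> linarith
    · have h3 := Int.floor_le (z.im / τ.im)
      have h4 := Int.lt_floor_add_one (z.im / τ.im)
      rw [← hm'] at h3 h4
      rw [le_div_iff₀ hτ] at h3
      rw [div_lt_iff₀ hτ] at h4
      have h5 : (z - m * τ - n).im = z.im - m * τ.im := by simp
      rw [h5, abs_le]
      constructor <;> nlinarith
  obtain ⟨c, hc⟩ := hDd.exists_const_forall_eq_of_bounded hDb
  have hconst : ∀ z, H z - c * z = H 0 - c * 0 := fun z => by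
    refine is_const_of_deriv_eq_zero (f := fun z => H z - c * z) (by fun_prop) (fun z => ?_) z 0
    have h3 : HasDerivAt (fun z => H z - c * z) (D z - c * 1) z :=
      (hHd z).hasDerivAt.sub ((hasDerivAt_id z).const_mul c)
    rw [h3.deriv, hc z]; ring
  have hc0 : c = 0 := by
    have h3 := hconst 1
    have h4 := hH1 0
    rw [zero_add] at h4
    rw [h4] at h3
    linear_combination -h3
  refine ⟨?_, H 0, fun z hz => ?_⟩
  · have h3 := hconst τ
    have h4 := hH2 0
    rw [zero_add] at h4
    rw [h4, hc0] at h3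
    linear_combination h3
  · rw [← hHS z hz]
    have := hconst z
    rw [hc0] at this
    linear_combination this

/-- If `u(z) → c` as `z → 0`, then the singularity of `(u(z) - c) / z` at the origin is
bounded. -/
theorem isBoundedUnder_sub_div {u : ℂ → ℂ} {c : ℂ}
    (hd : ∀ᶠ z in 𝓝[≠] (0 : ℂ), DifferentiableAt ℂ u z) (hu : Tendsto u (𝓝[≠] 0) (𝓝 c)) :
    IsBoundedUnder (· ≤ ·) (𝓝[≠] 0) fun z => ‖(u z - c) / z‖ := by
  set v := Function.update u 0 c with hv
  have hv0 : ContinuousAt v 0 := by rwa [hv, continuousAt_update_same]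
  have hve : ∀ z, z ≠ 0 → v z = u z := fun z hz => by simp [hv, hz]
  have hvd : AnalyticAt ℂ v 0 := by
    refine analyticAt_of_differentiable_on_punctured_nhds_of_continuousAt ?_ hv0
    filter_upwards [hd, self_mem_nhdsWithin] with z hz hz0
    refine hz.congr_of_eventuallyEq ?_
    filter_upwards [isOpen_ne.mem_nhds hz0] with w hw using hve w hw
  have h1 := (hasDerivAt_iff_tendsto_slope_zero.1 hvd.differentiableAt.hasDerivAt).norm.isBoundedUnder_le
  obtain ⟨C, hC⟩ := h1
  refine ⟨C, ?_⟩
  rw [eventually_map] at hC ⊢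
  filter_upwards [hC, self_mem_nhdsWithin] with z hz hz0
  rw [zero_add, hve z hz0, smul_eq_mul, hv, Function.update_self] at hz
  rwa [div_eq_inv_mul]

end QuasiJacobi

end

/-! ### The partial fraction expansion of the cotangent and its derivative. -/

noncomputable section

namespace QuasiJacobi
open Complex Filter Topology Metric SummationFilter

theorem hasSum_symmetricIcc_of_nat {f : ℤ → ℂ} {s : ℂ}
    (h : HasSum (fun n : ℕ => f (n + 1) + f (-(n + 1))) s) :
    HasSum f (f 0 + s) (symmetricIcc ℤ) := by
  rw [hasSum_symmetricIcc_iff]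
  have h1 : ∀ N : ℕ, ∑ n ∈ Finset.Icc (-(N : ℤ)) N, f n =
      f 0 + ∑ n ∈ Finset.range N, (f (n + 1) + f (-(n + 1))) := by
    intro N
    induction N with
    | zero => simp
    | succ N ih =>
      push_cast
      rw [Finset.sum_Icc_succ_eq_add_endpoints, ih, Finset.sum_range_succ]
      ring
  simp only [h1]
  exact h.tendsto_sum_nat.const_add _

/-- `π cot (π w)`. -/
def piCot (w : ℂ) : ℂ := Real.pi * cot (Real.pi * w)

theorem piCot_neg (w : ℂ) : piCot (-w) = -piCot w := by
  simp [piCot, cot_eq_cos_div_sin, div_neg]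

theorem piCot_eq_exp (w : ℂ) : piCot w =
    Real.pi * ((exp (2 * Real.pi * I * w) + 1) / (I * (1 - exp (2 * Real.pi * I * w)))) := by
  rw [piCot, cot_pi_eq_exp_ratio]

theorem exp_two_pi_add_int (w : ℂ) (n : ℤ) :
    exp (2 * Real.pi * I * (w + n)) = exp (2 * Real.pi * I * w) := by
  rw [mul_add, exp_add, mul_comm (2 * Real.pi * I) (n : ℂ), exp_int_mul_two_pi_mul_I, mul_one]

theorem piCot_add_one (w : ℂ) : piCot (w + 1) = piCot w := by
  have := exp_two_pi_add_int w 1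
  rw [Int.cast_one] at this
  rw [piCot_eq_exp, piCot_eq_exp, this]

theorem exp_two_pi_ne_one {w : ℂ} (hw : w ∈ integerComplement) :
    exp (2 * Real.pi * I * w) ≠ 1 := by
  intro h
  obtain ⟨n, hn⟩ := exp_eq_one_iff.1 h
  refine mem_integerComplement_iff.1 hw ⟨n, ?_⟩
  have : (2 * Real.pi * I : ℂ) ≠ 0 := by simp [Real.pi_ne_zero]
  rw [mul_comm] at hn
  exact (mul_right_cancel₀ this hn).symm

theorem hasSum_piCot {w : ℂ} (hw : w ∈ integerComplement) :
    HasSum (fun b : ℤ => 1 / (w + b)) (piCot w) (symmetricIcc ℤ) := by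
  have h1 := (summable_cotTerm hw).hasSum
  rw [← cot_series_rep' hw] at h1
  have := hasSum_symmetricIcc_of_nat (f := fun b : ℤ => 1 / (w + b)) (s := piCot w - 1 / w) ?_
  · simpa using this
  · refine h1.congr_fun fun n => ?_
    simp only [cotTerm]
    push_cast
    ring

theorem summable_one_div_add_int_pow (w : ℂ) {k : ℕ} (hk : 2 ≤ k) :
    Summable fun b : ℤ => 1 / (w + b) ^ k := by
  have := EisensteinSeries.linear_right_summable w 1 (k := k) (by exact_mod_cast hk)
  simpa using this

/-- The terms of the cotangent series, with n and −n paired, are locally uniformly O(1/n²), so the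
series may be differentiated termwise. The resulting sum converges absolutely and the pairing can be
undone. -/
theorem hasDerivAt_piCot {w : ℂ} (hw : w ∈ integerComplement) :
    HasDerivAt piCot (-∑' b : ℤ, 1 / (w + b) ^ 2) w := by
  have hopen : IsOpen integerComplement := isOpen_compl_range_intCast
  have hne : ∀ x ∈ integerComplement, ∀ n : ℕ, x - (n + 1) ≠ 0 ∧ x + (n + 1) ≠ 0 := by
    intro x hx n
    refine ⟨?_, ?_⟩
    · have := integerComplement_add_ne_zero hx (-(n + 1))
      push_cast at this
      rwa [← sub_eq_add_neg] at this
    · have := integerComplement_add_ne_zero hx (n + 1)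
      exact_mod_cast this
  have hcd : ∀ x ∈ integerComplement, ∀ n : ℕ, HasDerivAt (fun x => cotTerm x n)
      (-(1 / (x - (n + 1)) ^ 2 + 1 / (x + (n + 1)) ^ 2)) x := by
    intro x hx n
    have h1 := ((hasDerivAt_id x).sub_const ((n : ℂ) + 1)).fun_inv (hne x hx n).1
    have h2 := ((hasDerivAt_id x).add_const ((n : ℂ) + 1)).fun_inv (hne x hx n).2
    have h3 := h1.fun_add h2
    simp only [id] at h3
    refine (h3.congr_deriv ?_).congr_of_eventuallyEq (.of_forall fun y => ?_)
    · ring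
    · simp [cotTerm]
  obtain ⟨ε, hε, hεs⟩ := Metric.isOpen_iff.1 hopen w hw
  -- From this index on, |y ± (n + 1)| ≥ (n + 1)/2 for every y in the ball.
  obtain ⟨N, hN⟩ := exists_nat_ge (2 * (‖w‖ + ε))
  have hbound : ∀ n, N ≤ n → ∀ y ∈ ball w ε, ‖cotTerm y n‖ ≤
      8 * (‖w‖ + ε) * (1 / ((n : ℝ) + 1) ^ 2) := by
    intro n hn y hy
    have hyn : ‖y‖ ≤ ‖w‖ + ε := by
      have h1 := mem_ball_iff_norm.1 hy
      have h2 := norm_le_norm_add_norm_sub' y w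
      linarith
    rw [cotTerm_identity (hεs hy) n, norm_mul, norm_mul, norm_div, norm_one, norm_mul, norm_ofNat]
    have hn' : (N : ℝ) ≤ n := by exact_mod_cast hn
    have h4 : ‖((n : ℂ) + 1)‖ = (n : ℝ) + 1 := by
      rw [show ((n : ℂ) + 1) = ((n + 1 : ℕ) : ℂ) by push_cast; ring, norm_natCast]
      push_cast; ring
    have h5 : ((n : ℝ) + 1) / 2 ≤ ‖y + (n + 1)‖ := by
      have := norm_sub_norm_le ((n : ℂ) + 1) (-y)
      rw [norm_neg, h4, sub_neg_eq_add, add_comm ((n : ℂ) + 1) y] at this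
      linarith
    have h6 : ((n : ℝ) + 1) / 2 ≤ ‖y - (n + 1)‖ := by
      have := norm_sub_norm_le ((n : ℂ) + 1) y
      rw [h4, norm_sub_rev] at this
      linarith
    have h7 : ((n : ℝ) + 1) / 2 * (((n : ℝ) + 1) / 2) ≤ ‖y + (n + 1)‖ * ‖y - (n + 1)‖ :=
      mul_le_mul h5 h6 (by positivity) (by positivity)
    calc 2 * ‖y‖ * (1 / (‖y + (n + 1)‖ * ‖y - (n + 1)‖))
        ≤ 2 * (‖w‖ + ε) * (1 / (((n : ℝ) + 1) / 2 * (((n : ℝ) + 1) / 2))) := by gcongr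
      _ = 8 * (‖w‖ + ε) * (1 / ((n : ℝ) + 1) ^ 2) := by field_simp; ring
  have hsum : Summable fun n : ℕ => 8 * (‖w‖ + ε) * (1 / ((n : ℝ) + 1) ^ 2) := by
    refine Summable.mul_left _ ?_
    have := (summable_nat_add_iff 1).2 (Real.summable_one_div_nat_pow.2 one_lt_two)
    simpa using this
  obtain ⟨h1, h2⟩ := hasFDerivAt_tsum_of_tail hsum hε N
    (fun n => (hcd w hw n).differentiableAt)
    (fun n _ y hy => (hcd y (hεs hy) n).differentiableAt.differentiableWithinAt) hbound
  have hw0 : w ≠ 0 := by simpa using integerComplement_add_ne_zero hw 0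
  have h3 : HasDerivAt (fun x : ℂ => 1 / x + ∑' n, cotTerm x n)
      (-(1 / w ^ 2) + (∑' n, fderiv ℂ (fun x => cotTerm x n) w) 1) w := by
    refine HasDerivAt.fun_add ?_ h2.hasDerivAt
    exact ((hasDerivAt_inv hw0).congr_of_eventuallyEq (.of_forall fun x => one_div x)).congr_deriv
      (by rw [one_div])
  refine (h3.congr_deriv ?_).congr_of_eventuallyEq ?_
  · have hev : Summable fun n : ℕ => -(1 / (w - (n + 1)) ^ 2 + 1 / (w + (n + 1)) ^ 2) := by
      have := (ContinuousLinearMap.apply ℂ ℂ (1 : ℂ)).summable h1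
      refine this.congr fun n => ?_
      simp only [ContinuousLinearMap.apply_apply]
      exact (hcd w hw n).hasFDerivAt.fderiv ▸ by simp
    have h4 : (∑' n, fderiv ℂ (fun x => cotTerm x n) w) 1 =
        ∑' n : ℕ, -(1 / (w - (n + 1)) ^ 2 + 1 / (w + (n + 1)) ^ 2) := by
      have := (ContinuousLinearMap.apply ℂ ℂ (1 : ℂ)).map_tsum h1
      simp only [ContinuousLinearMap.apply_apply] at this
      rw [this]
      refine tsum_congr fun n => ?_
      rw [(hcd w hw n).hasFDerivAt.fderiv]
      simp
    rw [h4]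
    have h5 := hasSum_symmetricIcc_of_nat (f := fun b : ℤ => 1 / (w + b) ^ 2)
      (s := -∑' n : ℕ, -(1 / (w - (n + 1)) ^ 2 + 1 / (w + (n + 1)) ^ 2)) ?_
    · have h6 := (summable_one_div_add_int_pow w le_rfl).hasSum.mono_left
        (SummationFilter.LeAtTop.le_atTop (L := symmetricIcc ℤ))
      have h7 := HasSum.unique (L := symmetricIcc ℤ) h6 h5
      rw [h7]
      simp
      ring
    · rw [← tsum_neg]
      refine hev.neg.hasSum.congr_fun fun n => ?_
      push_cast
      ring
  · filter_upwards [hopen.mem_nhds hw] with x hx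
    rw [← cot_series_rep' hx, piCot]
    ring

end QuasiJacobi

end

/-! ### The function E_1 as a Lambert series, and its quasi-periods. -/

noncomputable section

namespace QuasiJacobi
open Complex Filter Topology Metric SummationFilter

/-- The nome `exp (2 π i τ)`. -/
def nome (τ : ℂ) : ℂ := exp (2 * Real.pi * I * τ)

theorem norm_nome_lt_one {τ : ℂ} (hτ : 0 < τ.im) : ‖nome τ‖ < 1 :=
  UpperHalfPlane.norm_exp_two_pi_I_lt_one ⟨τ, hτ⟩

theorem nome_add (τ σ : ℂ) : nome (τ + σ) = nome τ * nome σ := by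
  rw [nome, mul_add, exp_add]; rfl

theorem nome_neg (τ : ℂ) : nome (-τ) = (nome τ)⁻¹ := by
  rw [nome, mul_neg, exp_neg]; rfl

theorem nome_nat_mul (n : ℕ) (τ : ℂ) : nome (n * τ) = nome τ ^ n := by
  rw [nome, nome, ← exp_nat_mul]; ring_nf

theorem differentiable_nome : Differentiable ℂ nome := by unfold nome; fun_prop

theorem nome_zero : nome 0 = 1 := by simp [nome]

/-- The terms of the Lambert series in the expansion of `E_1` in powers of the nome. -/
def lambertTerm (n : ℕ) (x : ℂ × ℂ) : ℂ :=
  2 * Real.pi * I * (nome (-x.2) * x.1 ^ (n + 1) / (1 - nome (-x.2) * x.1 ^ (n + 1)) -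
    nome x.2 * x.1 ^ (n + 1) / (1 - nome x.2 * x.1 ^ (n + 1)))

theorem lambertTerm_neg (n : ℕ) (q z : ℂ) : lambertTerm n (q, -z) = -lambertTerm n (q, z) := by
  simp only [lambertTerm, neg_neg]; ring

theorem differentiableAt_lambertTerm {n : ℕ} {x : ℂ × ℂ}
    (h1 : nome x.2 * x.1 ^ (n + 1) ≠ 1) (h2 : nome (-x.2) * x.1 ^ (n + 1) ≠ 1) :
    DifferentiableAt ℂ (lambertTerm n) x := by
  have h3 : DifferentiableAt ℂ (fun x : ℂ × ℂ => nome x.2 * x.1 ^ (n + 1)) x := by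
    unfold nome; fun_prop
  have h4 : DifferentiableAt ℂ (fun x : ℂ × ℂ => nome (-x.2) * x.1 ^ (n + 1)) x := by
    unfold nome; fun_prop
  have h5 := h3.fun_mul ((h3.const_sub 1).fun_inv (sub_ne_zero.2 h1.symm))
  have h6 := h4.fun_mul ((h4.const_sub 1).fun_inv (sub_ne_zero.2 h2.symm))
  exact (h6.fun_sub h5).const_mul _

theorem norm_nome_le (z : ℂ) : ‖nome z‖ ≤ Real.exp (2 * Real.pi * ‖z‖) := by
  refine (norm_exp_le_exp_norm _).trans_eq ?_
  simp [abs_of_pos Real.pi_pos]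

theorem norm_div_one_sub_le {w : ℂ} (hw : ‖w‖ ≤ 1 / 2) : ‖w / (1 - w)‖ ≤ 2 * ‖w‖ := by
  have h1 : 1 / 2 ≤ ‖1 - w‖ := by
    have := norm_sub_norm_le 1 w
    rw [norm_one] at this
    linarith
  rw [norm_div, div_le_iff₀ (by linarith)]
  nlinarith [norm_nonneg w]

/-- Local normal convergence of the Lambert series. -/
theorem exists_lambertTerm_bound {x₀ : ℂ × ℂ} (hx₀ : ‖x₀.1‖ < 1) :
    ∃ (r : ℝ) (N : ℕ) (u : ℕ → ℝ), 0 < r ∧ Summable u ∧ ∀ n, N ≤ n → ∀ y ∈ ball x₀ r,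
      DifferentiableAt ℂ (lambertTerm n) y ∧ ‖lambertTerm n y‖ ≤ u n := by
  obtain ⟨ρ, hρ, hρ1⟩ := exists_between hx₀
  have hρ0 : 0 ≤ ρ := (norm_nonneg _).trans hρ.le
  set M := Real.exp (2 * Real.pi * (‖x₀.2‖ + 1)) with hM
  have hM0 : 0 < M := Real.exp_pos _
  have htend : Tendsto (fun n : ℕ => M * ρ ^ (n + 1)) atTop (𝓝 0) := by
    have := ((tendsto_pow_atTop_nhds_zero_of_lt_one hρ0 hρ1).comp (tendsto_add_atTop_nat 1)).const_mul M
    simpa using this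
  obtain ⟨N, hN⟩ := eventually_atTop.1 (htend.eventually_le_const (show (0 : ℝ) < 1 / 2 by norm_num))
  refine ⟨min 1 (ρ - ‖x₀.1‖), N, fun n => 8 * Real.pi * M * ρ ^ (n + 1),
    lt_min one_pos (sub_pos.2 hρ), ?_, fun n hn y hy => ?_⟩
  · exact ((summable_nat_add_iff 1).2 (summable_geometric_of_lt_one hρ0 hρ1)).mul_left _
  have hy' := mem_ball_iff_norm.1 hy
  have hy1 : ‖y.1‖ ≤ ρ := by
    have h1 : ‖y.1 - x₀.1‖ ≤ ‖y - x₀‖ := norm_fst_le (y - x₀)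
    have h2 := norm_le_norm_add_norm_sub' y.1 x₀.1
    have h3 := hy'.trans_le (min_le_right _ _)
    linarith
  have hy2 : ‖y.2‖ ≤ ‖x₀.2‖ + 1 := by
    have h1 : ‖y.2 - x₀.2‖ ≤ ‖y - x₀‖ := norm_snd_le (y - x₀)
    have h2 := norm_le_norm_add_norm_sub' y.2 x₀.2
    have h3 := hy'.trans_le (min_le_left _ _)
    linarith
  have hb : ∀ z : ℂ, ‖z‖ ≤ ‖x₀.2‖ + 1 → ‖nome z * y.1 ^ (n + 1)‖ ≤ M * ρ ^ (n + 1) := by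
    intro z hz
    rw [norm_mul, norm_pow]
    have : ‖nome z‖ ≤ M := (norm_nome_le z).trans (by rw [hM]; gcongr)
    gcongr
  have hA := hb y.2 hy2
  have hB := hb (-y.2) (by rwa [norm_neg])
  have hne : ∀ w : ℂ, ‖w‖ ≤ M * ρ ^ (n + 1) → w ≠ 1 := by
    rintro w hw rfl
    have := hN n hn
    rw [norm_one] at hw
    linarith
  refine ⟨differentiableAt_lambertTerm (hne _ hA) (hne _ hB), ?_⟩
  rw [lambertTerm, norm_mul]
  have h1 := norm_div_one_sub_le (hA.trans (hN n hn))
  have h2 := norm_div_one_sub_le (hB.trans (hN n hn))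
  have h3 : ‖(2 * Real.pi * I : ℂ)‖ = 2 * Real.pi := by simp [abs_of_pos Real.pi_pos]
  rw [h3]
  calc 2 * Real.pi * _ ≤ 2 * Real.pi * (2 * (M * ρ ^ (n + 1)) + 2 * (M * ρ ^ (n + 1))) := by
        gcongr
        refine (norm_sub_le _ _).trans (add_le_add (h2.trans ?_) (h1.trans ?_)) <;> gcongr
    _ = 8 * Real.pi * M * ρ ^ (n + 1) := by ring

/-- The normal bound covers all but finitely many terms; the two nonvanishing conditions make the
remaining ones differentiable at the point. -/
theorem hasFDerivAt_tsum_lambertTerm {x : ℂ × ℂ} (hx : ‖x.1‖ < 1)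
    (h1 : ∀ n : ℕ, nome x.2 * x.1 ^ (n + 1) ≠ 1) (h2 : ∀ n : ℕ, nome (-x.2) * x.1 ^ (n + 1) ≠ 1) :
    Summable (fun n => fderiv ℂ (lambertTerm n) x) ∧
      HasFDerivAt (fun y => ∑' n, lambertTerm n y) (∑' n, fderiv ℂ (lambertTerm n) x) x := by
  obtain ⟨r, N, u, hr, hu, h⟩ := exists_lambertTerm_bound hx
  exact hasFDerivAt_tsum_of_tail hu hr N (fun n => differentiableAt_lambertTerm (h1 n) (h2 n))
    (fun n hn y hy => (h n hn y hy).1.differentiableWithinAt) fun n hn y hy => (h n hn y hy).2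

theorem summable_lambertTerm {x : ℂ × ℂ} (hx : ‖x.1‖ < 1) :
    Summable fun n => lambertTerm n x := by
  obtain ⟨r, N, u, hr, hu, h⟩ := exists_lambertTerm_bound hx
  exact (summable_nat_add_iff N).1 <| .of_norm_bounded ((summable_nat_add_iff N).2 hu) fun n =>
    (h (n + N) (Nat.le_add_left N n) x (mem_ball_self hr)).2

/-- The function `E_1` on `ℍ × ℂ` as a sum over the nome. -/
def eisOne (p : ℂ × ℂ) : ℂ := piCot p.2 + ∑' n, lambertTerm n (nome p.1, p.2)

theorem add_mul_mem_integerComplement {τ z : ℂ} (h : (τ, z) ∈ latticeCompl) (a : ℤ) :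
    z + a * τ ∈ integerComplement := by
  rintro ⟨n, hn⟩
  refine h.2 (-a) n ?_
  simp only at hn ⊢
  push_cast
  linear_combination -hn

/-- With e = exp(2πiw), π cot πw = −πi − 2πi e/(1 − e). Since the cotangent is odd, the constants
−πi and πi of the rows n + 1 and −(n + 1) cancel, and what is left is summable. -/
theorem lambertTerm_nome {τ z : ℂ} (h : (τ, z) ∈ latticeCompl) (n : ℕ) :
    lambertTerm n (nome τ, z) = piCot (z + (n + 1) * τ) + piCot (z - (n + 1) * τ) := by
  have h1 : nome (z + (n + 1) * τ) = nome z * nome τ ^ (n + 1) := by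
    rw [nome_add, ← nome_nat_mul]; push_cast; rfl
  have h2 : nome (-z + (n + 1) * τ) = nome (-z) * nome τ ^ (n + 1) := by
    rw [nome_add, ← nome_nat_mul]; push_cast; rfl
  have h3 : z - (n + 1) * τ = -(-z + (n + 1) * τ) := by ring
  have h4 : nome (z + (n + 1) * τ) ≠ 1 := by
    have := exp_two_pi_ne_one (add_mul_mem_integerComplement h (n + 1))
    push_cast at this
    exact this
  have h5 : nome (-z + (n + 1) * τ) ≠ 1 := by
    have := exp_two_pi_ne_one (add_mul_mem_integerComplement h (-(n + 1)))
    intro h6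
    refine this ?_
    change nome _ = 1
    rw [show z + ((-((n : ℤ) + 1) : ℤ) : ℂ) * τ = -(-z + (n + 1) * τ) by push_cast; ring, nome_neg,
      h6, inv_one]
  rw [h3, piCot_neg, piCot_eq_exp, piCot_eq_exp]
  change lambertTerm n (nome τ, z) = Real.pi * ((nome _ + 1) / (I * (1 - nome _))) -
    Real.pi * ((nome _ + 1) / (I * (1 - nome _)))
  simp only [lambertTerm]
  rw [← h1, ← h2]
  have h6 := sub_ne_zero.2 h4.symm
  have h7 := sub_ne_zero.2 h5.symm
  have h8 := I_sq
  field_simp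
  rw [h8]
  ring

theorem nome_conditions {τ z : ℂ} (h : (τ, z) ∈ latticeCompl) (n : ℕ) :
    nome z * nome τ ^ (n + 1) ≠ 1 ∧ nome (-z) * nome τ ^ (n + 1) ≠ 1 := by
  rw [← nome_nat_mul, ← nome_add, ← nome_add]
  refine ⟨?_, fun h6 => ?_⟩
  · have := exp_two_pi_ne_one (add_mul_mem_integerComplement h (n + 1 : ℕ))
    push_cast at this ⊢
    exact this
  · refine exp_two_pi_ne_one (add_mul_mem_integerComplement h (-(n + 1 : ℕ))) ?_
    change nome _ = 1
    rw [show z + ((-((n + 1 : ℕ) : ℤ) : ℤ) : ℂ) * τ = -(-z + (n + 1 : ℕ) * τ) by push_cast; ring,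
      nome_neg, h6, inv_one]

theorem mem_integerComplement_of_mem {τ z : ℂ} (h : (τ, z) ∈ latticeCompl) :
    z ∈ integerComplement := by
  simpa using add_mul_mem_integerComplement h 0

theorem differentiableOn_eisOne : DifferentiableOn ℂ eisOne latticeCompl := by
  rintro ⟨τ, z⟩ h
  have h1 := (hasFDerivAt_tsum_lambertTerm (x := (nome τ, z)) (norm_nome_lt_one h.1)
    (fun n => (nome_conditions h n).1) (fun n => (nome_conditions h n).2)).2.differentiableAt
  have h2 : DifferentiableAt ℂ (fun p : ℂ × ℂ => (nome p.1, p.2)) (τ, z) := by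
    unfold nome; fun_prop
  have h3 : DifferentiableAt ℂ (fun p : ℂ × ℂ => piCot p.2) (τ, z) :=
    DifferentiableAt.comp (g := piCot) (τ, z)
      (hasDerivAt_piCot (mem_integerComplement_of_mem h)).differentiableAt differentiableAt_snd
  exact (h3.fun_add (DifferentiableAt.comp (τ, z) h1 h2)).differentiableWithinAt

theorem hasSum_eisOne {τ z : ℂ} (h : (τ, z) ∈ latticeCompl) :
    HasSum (fun a : ℤ => piCot (z + a * τ)) (eisOne (τ, z)) (symmetricIcc ℤ) := by
  have h1 := (summable_lambertTerm (x := (nome τ, z)) (norm_nome_lt_one h.1)).hasSum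
  have h2 := hasSum_symmetricIcc_of_nat (f := fun a : ℤ => piCot (z + a * τ))
    (h1.congr_fun fun n => ?_)
  · simpa [eisOne] using h2
  · rw [lambertTerm_nome h n]
    push_cast
    ring_nf

theorem twistedEisenstein_one (p : latticeCompl) : twistedEisenstein 1 p = eisOne p := by
  obtain ⟨⟨τ, z⟩, h⟩ := p
  rw [twistedEisenstein, if_neg (by norm_num)]
  simp only [pow_one]
  rw [← (hasSum_eisOne h).tsum_eq]
  exact tsum_congr fun a => (hasSum_piCot (add_mul_mem_integerComplement h a)).tsum_eq

theorem eisOne_neg (τ z : ℂ) : eisOne (τ, -z) = -eisOne (τ, z) := by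
  simp only [eisOne, piCot_neg, lambertTerm_neg, tsum_neg]
  ring

theorem eisOne_add_one (τ z : ℂ) : eisOne (τ, z + 1) = eisOne (τ, z) := by
  have h1 : nome (z + 1) = nome z := by
    have := exp_two_pi_add_int z 1
    rwa [Int.cast_one] at this
  have h2 : nome (-(z + 1)) = nome (-z) := by rw [nome_neg, nome_neg, h1]
  simp only [eisOne, piCot_add_one, lambertTerm, h1, h2]

theorem tendsto_piCot {τ : ℂ} (hτ : 0 < τ.im) (z : ℂ) :
    Tendsto (fun n : ℕ => piCot (z + n * τ)) atTop (𝓝 (-(Real.pi * I))) := by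
  have h1 : ∀ n : ℕ, piCot (z + n * τ) = Real.pi * ((nome z * nome τ ^ n + 1) /
      (I * (1 - nome z * nome τ ^ n))) := fun n => by
    rw [piCot_eq_exp, ← nome_nat_mul, ← nome_add]; rfl
  simp only [h1]
  have h2 : Tendsto (fun n : ℕ => nome z * nome τ ^ n) atTop (𝓝 0) := by
    simpa using (tendsto_pow_atTop_nhds_zero_of_norm_lt_one (norm_nome_lt_one hτ)).const_mul (nome z)
  have h3 := ((h2.add_const 1).div ((h2.const_sub 1).const_mul I) (by simp)).const_mul (Real.pi : ℂ)
  have h4 : -(Real.pi * I : ℂ) = Real.pi * ((0 + 1) / (I * (1 - 0))) := by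
    rw [sub_zero, zero_add, mul_one, one_div, inv_I]
    ring
  rw [h4]
  exact h3

/-- Shifting z by τ moves the window of each symmetric partial sum by one row. By oddness, the row
gained and the row lost contribute two cotangent values far up in the upper half-plane, each tending
to −πi. -/
theorem eisOne_add_tau {τ z : ℂ} (h : (τ, z) ∈ latticeCompl) :
    eisOne (τ, z + τ) = eisOne (τ, z) - 2 * Real.pi * I := by
  have h' : (τ, z + τ) ∈ latticeCompl := by simpa using (translate_mem_iff 1 0).2 h
  have h1 := hasSum_symmetricIcc_iff.1 (hasSum_eisOne h)
  have h2 := hasSum_symmetricIcc_iff.1 (hasSum_eisOne h')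
  have h3 : ∀ N : ℕ, ∑ a ∈ Finset.Icc (-(N : ℤ)) N, piCot (z + τ + a * τ) =
      ∑ a ∈ Finset.Icc (-(N : ℤ)) N, piCot (z + a * τ) + piCot (z + τ + N * τ) +
        piCot (-z + N * τ) := by
    intro N
    induction N with
    | zero => simp [piCot_neg]
    | succ N ih =>
      push_cast
      rw [Finset.sum_Icc_succ_eq_add_endpoints, Finset.sum_Icc_succ_eq_add_endpoints, ih]
      push_cast
      have h4 : piCot (-z + N * τ) = -piCot (z + τ + (-1 + -(N : ℂ)) * τ) := by
        rw [← piCot_neg]; ring_nf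
      have h5 : piCot (-z + (N + 1) * τ) = -piCot (z + (-1 + -(N : ℂ)) * τ) := by
        rw [← piCot_neg]; ring_nf
      have h6 : piCot (z + (N + 1) * τ) = piCot (z + τ + N * τ) := by ring_nf
      rw [h5, h6, h4]
      ring_nf
  simp only [h3] at h2
  have h4 := (h1.add (tendsto_piCot h.1 (z + τ))).add (tendsto_piCot h.1 (-z))
  rw [tendsto_nhds_unique h2 h4]
  ring

end QuasiJacobi

end

/-! ### Higher E_n as derivatives of E_1, and their identification with lattice sums. -/

noncomputable section

namespace QuasiJacobi
open Complex Filter Topology Metric SummationFilter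

/-- The partial derivative of a function of `(τ, z)` with respect to `z`. -/
def zDeriv (f : ℂ × ℂ → ℂ) (p : ℂ × ℂ) : ℂ := fderiv ℂ f p (0, 1)

theorem hasDerivAt_zDeriv {f : ℂ × ℂ → ℂ} {x y : ℂ} (h : DifferentiableAt ℂ f (x, y)) :
    HasDerivAt (fun w => f (x, w)) (zDeriv f (x, y)) y :=
  h.hasFDerivAt.comp_hasDerivAt y ((hasDerivAt_const y x).prodMk (hasDerivAt_id y))

/-- The functions `E_{n+1}`, defined as iterated derivatives of `E_1`. -/
def eis : ℕ → ℂ × ℂ → ℂ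
  | 0 => eisOne
  | n + 1 => fun p => -(1 / ((n : ℂ) + 1)) * zDeriv (eis n) p

theorem differentiableOn_eis (n : ℕ) : DifferentiableOn ℂ (eis n) latticeCompl := by
  induction n with
  | zero => exact differentiableOn_eisOne
  | succ n ih => exact (differentiableOn_fderiv_apply isOpen_latticeCompl ih _).const_mul _

theorem differentiableAt_eis (n : ℕ) {p : ℂ × ℂ} (h : p ∈ latticeCompl) :
    DifferentiableAt ℂ (eis n) p :=
  (differentiableOn_eis n).differentiableAt (isOpen_latticeCompl.mem_nhds h)

theorem hasDerivAt_eis (n : ℕ) {τ z : ℂ} (h : (τ, z) ∈ latticeCompl) :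
    HasDerivAt (fun w => eis n (τ, w)) (-(n + 1) * eis (n + 1) (τ, z)) z := by
  refine (hasDerivAt_zDeriv (differentiableAt_eis n h)).congr_deriv ?_
  have : (n : ℂ) + 1 ≠ 0 := Nat.cast_add_one_ne_zero n
  simp only [eis]
  field_simp

/-- Termwise z-differentiation of the cotangent and Lambert expansion: each row π cot π(z + aτ)
yields minus its row of inverse squares. This identifies −∂E_1/∂z with the Eisenstein-summed E_2. -/
theorem hasSum_eis_one {τ z : ℂ} (h : (τ, z) ∈ latticeCompl) :
    HasSum (fun a : ℤ => ∑' b : ℤ, 1 / (z + a * τ + b) ^ 2) (eis 1 (τ, z)) (symmetricIcc ℤ) := by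
  obtain ⟨h1, h2⟩ := hasFDerivAt_tsum_lambertTerm (x := (nome τ, z)) (norm_nome_lt_one h.1)
    (fun n => (nome_conditions h n).1) (fun n => (nome_conditions h n).2)
  have h3 := hasDerivAt_zDeriv h2.differentiableAt
  have h4 := hasDerivAt_piCot (mem_integerComplement_of_mem h)
  have h5 : HasSum (fun n => zDeriv (lambertTerm n) (nome τ, z))
      (zDeriv (fun y => ∑' n, lambertTerm n y) (nome τ, z)) := by
    have := (ContinuousLinearMap.apply ℂ ℂ ((0, 1) : ℂ × ℂ)).hasSum h1.hasSum
    rw [zDeriv, h2.fderiv]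
    simpa [zDeriv] using this
  have h6 := (h4.add h3).unique (hasDerivAt_eis 0 h)
  have h7 : eis 1 (τ, z) = ∑' b : ℤ, 1 / (z + b) ^ 2 -
      zDeriv (fun y => ∑' n, lambertTerm n y) (nome τ, z) := by
    push_cast at h6
    linear_combination h6
  have h8 := hasSum_symmetricIcc_of_nat (f := fun a : ℤ => ∑' b : ℤ, 1 / (z + a * τ + b) ^ 2)
    (s := -zDeriv (fun y => ∑' n, lambertTerm n y) (nome τ, z)) (h5.neg.congr_fun fun n => ?_)
  · rw [h7, sub_eq_add_neg]
    simpa using h8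
  · have h9 := hasDerivAt_zDeriv (differentiableAt_lambertTerm (n := n) (x := (nome τ, z))
      (nome_conditions h n).1 (nome_conditions h n).2)
    have hm1 := add_mul_mem_integerComplement h (n + 1)
    have hm2 := add_mul_mem_integerComplement h (-(n + 1))
    push_cast at hm1 hm2 ⊢
    have h10 := ((hasDerivAt_piCot hm1).comp_add_const z _).add
      ((hasDerivAt_piCot hm2).comp_add_const z _)
    have h11 := h9.congr_of_eventuallyEq (f₁ := (fun w => piCot (w + (n + 1) * τ)) +
      fun w => piCot (w + -(n + 1) * τ)) ?_
    · rw [h11.unique h10]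
      ring
    · filter_upwards [(isOpen_slice τ).mem_nhds h] with w hw
      rw [lambertTerm_nome hw n, Pi.add_apply]
      ring_nf

theorem twistedEisenstein_two (p : latticeCompl) : twistedEisenstein 2 p = eis 1 p := by
  obtain ⟨⟨τ, z⟩, h⟩ := p
  rw [twistedEisenstein, if_neg (by norm_num), ← (hasSum_eis_one h).tsum_eq]
  refine tsum_congr fun a => ?_
  exact tsum_eq_of_summable_unconditional (summable_one_div_add_int_pow _ le_rfl)

/-- The series of ℘ converges absolutely and may be summed by rows; its row a is the difference of
the corresponding rows of E_2 and e_2. Adding back the Eisenstein sum of the latter gives E_2. -/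
theorem eis_one_eq_weierstrassP {τ z : ℂ} (h : (τ, z) ∈ latticeCompl) :
    eis 1 (τ, z) = (periodPair τ h.1).weierstrassP z + EisensteinSeries.G2 ⟨τ, h.1⟩ := by
  set P := periodPair τ h.1
  -- The series of ℘ has terms in z − ω; evaluating at −z and using that ℘ is even gives the terms
  -- in z + ω.
  have h1 := P.hasSum_weierstrassP (-z)
  rw [← P.latticeEquivProd.symm.toEquiv.hasSum_iff, P.weierstrassP_neg] at h1
  have h2 : HasSum (fun ab : ℤ × ℤ => 1 / (z + ab.1 * τ + ab.2) ^ 2 - 1 / (ab.1 * τ + ab.2) ^ 2)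
      (P.weierstrassP z) := by
    refine h1.congr_fun fun ab => ?_
    have := P.latticeEquiv_symm_apply ab
    simp only [Function.comp_apply, LinearEquiv.coe_toEquiv, this]
    simp only [P, periodPair, mul_one]
    rw [show -z - (ab.1 * τ + ab.2) = -(z + ab.1 * τ + ab.2) by ring, neg_sq]
  have h3 : ∀ a : ℤ, HasSum (fun b : ℤ => 1 / (z + a * τ + b) ^ 2 - 1 / (a * τ + b) ^ 2)
      (∑' b : ℤ, 1 / (z + a * τ + b) ^ 2 - EisensteinSeries.e2Summand a ⟨τ, h.1⟩) := fun a => by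
    refine (summable_one_div_add_int_pow _ le_rfl).hasSum.sub ?_
    refine HasSum.congr_fun (EisensteinSeries.e2Summand_summable a ⟨τ, h.1⟩).hasSum fun b => ?_
    simp [EisensteinSeries.eisSummand, zpow_neg]
  have h4 : HasSum (fun a : ℤ => ∑' b : ℤ, 1 / (z + a * τ + b) ^ 2 -
      EisensteinSeries.e2Summand a ⟨τ, h.1⟩) (P.weierstrassP z) (symmetricIcc ℤ) :=
    (h2.prod_fiberwise h3).mono_left SummationFilter.LeAtTop.le_atTop
  refine (hasSum_eis_one h).unique ((HasSum.add h4
    (EisensteinSeries.summable_e2Summand_symmetricIcc ⟨τ, h.1⟩).hasSum).congr_fun fun a => ?_)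
  exact (sub_add_cancel _ _).symm

theorem iteratedDeriv_eis (n : ℕ) {τ z : ℂ} (h : (τ, z) ∈ latticeCompl) :
    iteratedDeriv n (fun w => eis 1 (τ, w)) z =
      (-1) ^ n * (n + 1).factorial * eis (n + 1) (τ, z) := by
  induction n generalizing z with
  | zero => simp
  | succ n ih =>
    rw [iteratedDeriv_succ]
    have h1 : iteratedDeriv n (fun w => eis 1 (τ, w)) =ᶠ[𝓝 z]
        fun w => (-1) ^ n * (n + 1).factorial * eis (n + 1) (τ, w) := by
      filter_upwards [(isOpen_slice τ).mem_nhds h] with w hw using ih hw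
    rw [h1.deriv_eq, ((hasDerivAt_eis (n + 1) h).const_mul _).deriv, Nat.factorial_succ (n + 1)]
    push_cast
    ring

/-- Read off from the Taylor series of ℘ at z. Excluding n = 0 avoids the convergence-producing
constants, which affect only the zeroth coefficient. -/
theorem iteratedDeriv_weierstrassP (P : PeriodPair) {n : ℕ} (hn : n ≠ 0) {z : ℂ}
    (h : z ∉ P.lattice) :
    iteratedDeriv n P.weierstrassP z = (n + 1).factorial * P.sumInvPow z (n + 2) := by
  obtain ⟨r, hr, hrs⟩ := nhds_basis_closedBall.mem_iff.1
    (P.isClosed_lattice.isOpen_compl.mem_nhds h)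
  have h1 := (P.hasFPowerSeriesOnBall_weierstrassP z ⟨r, hr.le⟩ hr hrs).factorial_smul 1 n
  rw [iteratedDeriv_eq_iteratedFDeriv, ← h1, PeriodPair.weierstrassPSeries,
    FormalMultilinearSeries.apply_eq_prod_smul_coeff, FormalMultilinearSeries.coeff_ofScalars,
    if_neg hn, Nat.factorial_succ]
  simp
  ring

theorem eis_eq_sumInvPow {n : ℕ} (hn : n ≠ 0) {τ z : ℂ} (h : (τ, z) ∈ latticeCompl) :
    (-1) ^ n * eis (n + 1) (τ, z) = (periodPair τ h.1).sumInvPow z (n + 2) := by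
  have h1 := iteratedDeriv_eis n h
  have h2 : (fun w => eis 1 (τ, w)) =ᶠ[𝓝 z] fun w => EisensteinSeries.G2 ⟨τ, h.1⟩ +
      (periodPair τ h.1).weierstrassP w := by
    filter_upwards [(isOpen_slice τ).mem_nhds h] with w hw
    rw [eis_one_eq_weierstrassP hw, add_comm]
  rw [h2.iteratedDeriv_eq, iteratedDeriv_const_add (Nat.pos_of_ne_zero hn),
    iteratedDeriv_weierstrassP _ hn ((mem_latticeCompl_iff h.1).1 h)] at h1
  have h3 : ((n + 1).factorial : ℂ) ≠ 0 := Nat.cast_ne_zero.2 (n + 1).factorial_ne_zero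
  refine mul_left_cancel₀ h3 ?_
  rw [h1]
  ring

theorem twistedEisenstein_eq_eis (n : ℕ) (p : latticeCompl) :
    twistedEisenstein (n + 1) p = eis n p := by
  match n with
  | 0 => exact twistedEisenstein_one p
  | 1 => exact twistedEisenstein_two p
  | n + 2 =>
    obtain ⟨⟨τ, z⟩, h⟩ := p
    have h1 := eis_eq_sumInvPow (Nat.succ_ne_zero n) h
    set P := periodPair τ h.1
    have h2 := P.hasSum_sumInvPow z (r := n + 1 + 2) (by lia)
    -- Replacing ω by −ω turns ω − z into −(z + ω); the resulting sign cancels the (−1)^(n+1) of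
    -- `eis_eq_sumInvPow`.
    rw [← ((Equiv.neg _).trans P.latticeEquivProd.symm.toEquiv).hasSum_iff] at h2
    rw [twistedEisenstein, if_pos (by lia)]
    have h3 : (eis (n + 1 + 1) (τ, z)) = (-1) ^ (n + 1) * P.sumInvPow z (n + 1 + 2) := by
      rw [← h1, ← mul_assoc, ← mul_pow]; simp
    change _ = eis (n + 1 + 1) (τ, z)
    rw [h3]
    refine HasSum.tsum_eq ((h2.mul_left _).congr_fun fun ab => ?_)
    have := P.latticeEquiv_symm_apply (-ab)
    simp only [Function.comp_apply, Equiv.trans_apply, Equiv.neg_apply, LinearEquiv.coe_toEquiv,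
      this]
    simp only [P, periodPair, mul_one, Prod.fst_neg, Prod.snd_neg, Int.cast_neg]
    rw [show -(ab.1 : ℂ) * τ + -ab.2 - z = -(z + ab.1 * τ + ab.2) by ring, neg_pow (z + _ + _),
      mul_inv, ← mul_assoc, ← inv_pow (-1 : ℂ), inv_neg_one, ← pow_add,
      Even.neg_one_pow ⟨n + 2, by lia⟩]
    simp

end QuasiJacobi

end

/-! ### Laurent behaviour at z = 0 in the nome coordinate, and translation laws. -/

noncomputable section

namespace QuasiJacobi
open Complex Filter Topology Metric SummationFilter

/-- A neighbourhood of the disc `z = 0`, in the coordinates `(q, z)`, in which the functions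
`z ^ n * E_n` are holomorphic. -/
def nomeDomain : Set (ℂ × ℂ) :=
  {x | ‖x.1‖ < 1 ∧ ‖x.2‖ < 1 ∧ ‖nome x.2 * x.1‖ < 1 ∧ ‖nome (-x.2) * x.1‖ < 1}

theorem isOpen_nomeDomain : IsOpen nomeDomain := by
  have h := differentiable_nome.continuous
  exact (isOpen_lt continuous_fst.norm continuous_const).inter
    ((isOpen_lt continuous_snd.norm continuous_const).inter
      ((isOpen_lt (f := fun x : ℂ × ℂ => ‖nome x.2 * x.1‖) (by fun_prop) continuous_const).inter
        (isOpen_lt (f := fun x : ℂ × ℂ => ‖nome (-x.2) * x.1‖) (by fun_prop) continuous_const)))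

theorem mem_nomeDomain_of_norm_lt_one {q : ℂ} (hq : ‖q‖ < 1) : (q, 0) ∈ nomeDomain := by
  simp [nomeDomain, nome_zero, hq]

/-- `z ^ N * F` is a holomorphic function of `(q, z)` near `z = 0` with value `1` at `z = 0`. -/
def HasNormalizedExpansion (N : ℕ) (F : ℂ × ℂ → ℂ) : Prop :=
  ∃ g : ℂ × ℂ → ℂ, DifferentiableOn ℂ g nomeDomain ∧ (∀ q, ‖q‖ < 1 → g (q, 0) = 1) ∧
    ∀ p ∈ latticeCompl, (nome p.1, p.2) ∈ nomeDomain → p.2 ^ N * F p = g (nome p.1, p.2)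

theorem differentiableOn_tsum_lambertTerm :
    DifferentiableOn ℂ (fun x => ∑' n, lambertTerm n x) nomeDomain := by
  intro x hx
  have h : ∀ w : ℂ, ‖w * x.1‖ < 1 → ∀ n : ℕ, w * x.1 ^ (n + 1) ≠ 1 := fun w hw n h => by
    rw [pow_succ', ← mul_assoc] at h
    have h1 : ‖w * x.1 * x.1 ^ n‖ < 1 := by
      rw [norm_mul, norm_pow]
      exact mul_lt_one_of_nonneg_of_lt_one_left (norm_nonneg _) hw
        (pow_le_one₀ (norm_nonneg _) hx.1.le)
    rw [h, norm_one] at h1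
    exact h1.false
  exact (hasFDerivAt_tsum_lambertTerm hx.1 (h _ hx.2.2.1)
    (h _ hx.2.2.2)).2.differentiableAt.differentiableWithinAt

/-- z·π cot πz is cos πz divided by sin πz/(πz). Written as a divided slope of the sine, the
denominator is holomorphic and nonzero for |z| < 1, also at z = 0. The Lambert series is holomorphic
on the domain and acquires a factor z. -/
theorem hasNormalizedExpansion_eisOne : HasNormalizedExpansion 1 eisOne := by
  have h0 : ∀ z : ℂ, ‖z‖ < 1 → z ≠ 0 → dslope sin 0 (Real.pi * z) = sin (Real.pi * z) / (Real.pi * z) ∧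
      sin (Real.pi * z) ≠ 0 := by
    intro z hz hz0
    have h1 : (Real.pi * z : ℂ) ≠ 0 := mul_ne_zero (by simp [Real.pi_ne_zero]) hz0
    refine ⟨?_, fun h => ?_⟩
    · rw [dslope_of_ne _ h1, slope_def_field]
      simp
    · obtain ⟨k, hk⟩ := Complex.sin_eq_zero_iff.1 h
      have h2 : z = k := by
        rw [mul_comm] at hk
        exact mul_right_cancel₀ (by simp [Real.pi_ne_zero]) hk
      rw [h2, norm_intCast] at hz
      have h3 : k = 0 := by
        rw [← Int.abs_lt_one_iff]
        exact_mod_cast hz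
      exact hz0 (by rw [h2, h3, Int.cast_zero])
  refine ⟨fun x => cos (Real.pi * x.2) * (dslope sin 0 (Real.pi * x.2))⁻¹ +
    x.2 * ∑' n, lambertTerm n x, ?_, fun q hq => by simp, fun p hp hpW => ?_⟩
  · refine DifferentiableOn.add (DifferentiableOn.mul (by fun_prop) (DifferentiableOn.inv ?_ ?_))
      (DifferentiableOn.mul (by fun_prop) differentiableOn_tsum_lambertTerm)
    · have h2 : Differentiable ℂ (dslope sin (0 : ℂ)) :=
        differentiableOn_univ.1 ((Complex.differentiableOn_dslope univ_mem).2
          differentiable_sin.differentiableOn)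
      exact (h2.comp (by fun_prop : Differentiable ℂ fun x : ℂ × ℂ => (Real.pi : ℂ) * x.2)).differentiableOn
    · intro x hx
      by_cases hx0 : x.2 = 0
      · simp [hx0]
      · rw [(h0 _ hx.2.1 hx0).1]
        exact div_ne_zero (h0 _ hx.2.1 hx0).2 (mul_ne_zero (by simp [Real.pi_ne_zero]) hx0)
  · have hp0 : p.2 ≠ 0 := by simpa using hp.2 0 0
    obtain ⟨h2, h3⟩ := h0 _ hpW.2.1 hp0
    have : (Real.pi : ℂ) ≠ 0 := by simp [Real.pi_ne_zero]
    simp only [eisOne, piCot, cot_eq_cos_div_sin, h2]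
    field_simp

/-- From z^N F = g follows z^(N+1) ∂F/∂z = z ∂g/∂z − N g, so multiplication by −1/N restores the
value 1 at z = 0. -/
theorem HasNormalizedExpansion.zDeriv {N : ℕ} {F : ℂ × ℂ → ℂ} (h : HasNormalizedExpansion N F)
    (hF : DifferentiableOn ℂ F latticeCompl) (hN : N ≠ 0) :
    HasNormalizedExpansion (N + 1) fun p => -(1 / (N : ℂ)) * zDeriv F p := by
  obtain ⟨g, hg, hg1, hgF⟩ := h
  have hN' : (N : ℂ) ≠ 0 := Nat.cast_ne_zero.2 hN
  refine ⟨fun x => -(1 / (N : ℂ)) * (x.2 * QuasiJacobi.zDeriv g x - N * g x), ?_, fun q hq => ?_, ?_⟩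
  · exact (((differentiableOn_snd).mul (differentiableOn_fderiv_apply isOpen_nomeDomain hg _)).sub
      (hg.const_mul _)).const_mul _
  · simp only [hg1 q hq]
    field_simp
    ring
  · rintro ⟨τ, z⟩ hp hpW
    have h1 := hasDerivAt_zDeriv (hF.differentiableAt (isOpen_latticeCompl.mem_nhds hp))
    have h2 := hasDerivAt_zDeriv (hg.differentiableAt (isOpen_nomeDomain.mem_nhds hpW))
    have h3 := (hasDerivAt_pow N z).mul h1
    have h4 : (fun w => g (nome τ, w)) =ᶠ[𝓝 z] (fun w => w ^ N) * fun w => F (τ, w) := by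
      have h5 : {w : ℂ | (nome τ, w) ∈ nomeDomain} ∈ 𝓝 z :=
        (isOpen_nomeDomain.preimage (by fun_prop : Continuous fun w : ℂ => (nome τ, w))).mem_nhds hpW
      filter_upwards [(isOpen_slice τ).mem_nhds hp, h5] with w hw hw2
      exact (hgF _ hw hw2).symm
    have h6 := h2.unique (h3.congr_of_eventuallyEq h4)
    have h7 := hgF _ hp hpW
    obtain ⟨M, rfl⟩ := Nat.exists_eq_succ_of_ne_zero hN
    simp only at h7 ⊢
    rw [h6, ← h7]
    simp only [Nat.succ_eq_add_one, Nat.add_sub_cancel]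
    field_simp
    ring

theorem hasNormalizedExpansion_eis (n : ℕ) : HasNormalizedExpansion (n + 1) (eis n) := by
  induction n with
  | zero => exact hasNormalizedExpansion_eisOne
  | succ n ih =>
    have := ih.zDeriv (differentiableOn_eis n) n.succ_ne_zero
    simpa [eis] using this

theorem eisOne_add {τ z : ℂ} (h : (τ, z) ∈ latticeCompl) (m n : ℤ) :
    eisOne (τ, z + m * τ + n) = eisOne (τ, z) - 2 * Real.pi * I * m := by
  have h1 : Function.Periodic (fun w => eisOne (τ, w)) 1 := fun w => eisOne_add_one τ w
  have h2 := h1.int_mul n (z + m * τ)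
  simp only [mul_one] at h2
  rw [h2]
  induction m with
  | zero => simp
  | succ m ih =>
    have h3 : (τ, z + m * τ) ∈ latticeCompl := by simpa using (translate_mem_iff (m : ℤ) 0).2 h
    have h4 := eisOne_add_tau h3
    have := h1.int_mul n (z + m * τ)
    simp only [mul_one] at this
    push_cast at ih ⊢
    rw [show z + (m + 1) * τ = z + m * τ + τ by ring, h4, ih this]
    ring
  | pred m ih =>
    have h3 : (τ, z + (-(m : ℂ) - 1) * τ) ∈ latticeCompl := by
      simpa using (translate_mem_iff (-(m : ℤ) - 1) 0).2 h
    have h4 := eisOne_add_tau h3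
    rw [show z + (-(m : ℂ) - 1) * τ + τ = z + -m * τ by ring] at h4
    have := h1.int_mul n (z + (-(m : ℤ) : ℤ) * τ)
    simp only [mul_one] at this
    have h5 := ih this
    push_cast at h5 ⊢
    linear_combination h5 - h4

/-- Differentiation in z removes the additive constant, which is why only E_1 fails to be periodic.
-/
theorem eis_succ_add_of_add {k : ℕ} {τ s c : ℂ}
    (hs : ∀ w, (τ, w) ∈ latticeCompl → (τ, w + s) ∈ latticeCompl)
    (hc : ∀ w, (τ, w) ∈ latticeCompl → eis k (τ, w + s) = eis k (τ, w) + c) {z : ℂ}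
    (h : (τ, z) ∈ latticeCompl) : eis (k + 1) (τ, z + s) = eis (k + 1) (τ, z) := by
  have h2 := ((hasDerivAt_eis k (hs z h)).comp_add_const z _).unique
    (((hasDerivAt_eis k h).add_const c).congr_of_eventuallyEq (by
      filter_upwards [(isOpen_slice τ).mem_nhds h] with v hv using hc v hv))
  exact mul_left_cancel₀ (neg_ne_zero.2 (Nat.cast_add_one_ne_zero k)) h2

theorem eis_succ_add (k : ℕ) {τ z : ℂ} (h : (τ, z) ∈ latticeCompl) (m n : ℤ) :
    eis (k + 1) (τ, z + m * τ + n) = eis (k + 1) (τ, z) := by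
  have hs : ∀ w, (τ, w) ∈ latticeCompl → (τ, w + (m * τ + n)) ∈ latticeCompl := fun w hw => by
    rw [← add_assoc]; exact (translate_mem_iff m n).2 hw
  rw [add_assoc]
  induction k generalizing z with
  | zero =>
    refine eis_succ_add_of_add (c := -(2 * Real.pi * I * m)) hs (fun w hw => ?_) h
    rw [← add_assoc, eis, eisOne_add hw, sub_eq_add_neg]
  | succ k ih => exact eis_succ_add_of_add (c := 0) hs (fun w hw => by rw [ih hw, add_zero]) h

theorem exists_eis_add (k : ℕ) (m n : ℤ) : ∃ c : ℂ, ∀ τ z : ℂ, (τ, z) ∈ latticeCompl →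
    eis k (τ, z + m * τ + n) = eis k (τ, z) + c := by
  cases k with
  | zero => exact ⟨-(2 * Real.pi * I * m), fun τ z h => by rw [eis, eisOne_add h, sub_eq_add_neg]⟩
  | succ k => exact ⟨0, fun τ z h => by rw [eis_succ_add k h, add_zero]⟩

end QuasiJacobi

end

/-! ### The algebra of admissible coefficients, containing the E_n and e_2. -/

noncomputable section

namespace QuasiJacobi
open Complex Filter Topology Metric SummationFilter

theorem Holomorphic.add {f g : latticeCompl → ℂ} (hf : Holomorphic f) (hg : Holomorphic g) :
    Holomorphic (f + g) := by
  obtain ⟨F, hF, hfF⟩ := hf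
  obtain ⟨G, hG, hgG⟩ := hg
  exact ⟨F + G, hF.add hG, fun p => by simp [hfF, hgG]⟩

theorem Holomorphic.mul {f g : latticeCompl → ℂ} (hf : Holomorphic f) (hg : Holomorphic g) :
    Holomorphic (f * g) := by
  obtain ⟨F, hF, hfF⟩ := hf
  obtain ⟨G, hG, hgG⟩ := hg
  exact ⟨F * G, hF.mul hG, fun p => by simp [hfF, hgG]⟩

theorem holomorphic_const (c : ℂ) : Holomorphic fun _ => c :=
  ⟨fun _ => c, by fun_prop, fun _ => rfl⟩

/-- The locus h ≠ 0 is open by continuity, so a point where k ≠ 0 can be found inside it. Hence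
products of local denominators are again legitimate denominators. -/
theorem subset_closure_inter_ne_zero {X : Type*} [TopologicalSpace X] {U V : Set X} {h k : X → ℂ}
    (hU : IsOpen U) (hV : IsOpen V) (hh : ContinuousOn h U)
    (hUh : U ⊆ closure {y ∈ U | h y ≠ 0}) (hVk : V ⊆ closure {y ∈ V | k y ≠ 0}) :
    U ∩ V ⊆ closure {y ∈ U ∩ V | h y * k y ≠ 0} := by
  intro y hy
  rw [_root_.mem_closure_iff]
  intro O hO hyO
  obtain ⟨y₁, hy₁, hy₁U, hy₁h⟩ := _root_.mem_closure_iff.1 (hUh hy.1) (O ∩ V) (hO.inter hV) ⟨hyO, hy.2⟩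
  have h1 : IsOpen (U ∩ h ⁻¹' {0}ᶜ) := hh.isOpen_inter_preimage hU isOpen_compl_singleton
  obtain ⟨y₂, hy₂, hy₂V, hy₂k⟩ := _root_.mem_closure_iff.1 (hVk hy₁.2) (O ∩ (U ∩ h ⁻¹' {0}ᶜ))
    (hO.inter h1) ⟨hy₁.1, hy₁U, hy₁h⟩
  exact ⟨y₂, hy₂.1, ⟨hy₂.2.1, hy₂V⟩, mul_ne_zero hy₂.2.2 hy₂k⟩

theorem Meromorphic.add {f g : latticeCompl → ℂ} (hf : Meromorphic f) (hg : Meromorphic g) :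
    Meromorphic (f + g) := by
  intro x hx
  obtain ⟨U, a, h, hU, hxU, ha, hh, hUh, hf⟩ := hf x hx
  obtain ⟨V, b, k, hV, hxV, hb, hk, hVk, hg⟩ := hg x hx
  have hl := Set.inter_subset_left (s := U) (t := V)
  have hr := Set.inter_subset_right (s := U) (t := V)
  refine ⟨U ∩ V, fun y => a y * k y + b y * h y, fun y => h y * k y, hU.inter hV, ⟨hxU, hxV⟩,
    ((ha.mono hl).mul (hk.mono hr)).add ((hb.mono hr).mul (hh.mono hl)),
    (hh.mono hl).mul (hk.mono hr), subset_closure_inter_ne_zero hU hV hh.continuousOn hUh hVk,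
    fun p hp => ?_⟩
  simp only [Pi.add_apply, ← hf p hp.1, ← hg p hp.2]
  ring

theorem Meromorphic.mul {f g : latticeCompl → ℂ} (hf : Meromorphic f) (hg : Meromorphic g) :
    Meromorphic (f * g) := by
  intro x hx
  obtain ⟨U, a, h, hU, hxU, ha, hh, hUh, hf⟩ := hf x hx
  obtain ⟨V, b, k, hV, hxV, hb, hk, hVk, hg⟩ := hg x hx
  have hl := Set.inter_subset_left (s := U) (t := V)
  have hr := Set.inter_subset_right (s := U) (t := V)
  refine ⟨U ∩ V, fun y => a y * b y, fun y => h y * k y, hU.inter hV, ⟨hxU, hxV⟩,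
    (ha.mono hl).mul (hb.mono hr), (hh.mono hl).mul (hk.mono hr),
    subset_closure_inter_ne_zero hU hV hh.continuousOn hUh hVk, fun p hp => ?_⟩
  simp only [Pi.mul_apply, ← hf p hp.1, ← hg p hp.2]
  ring

theorem meromorphic_const (c : ℂ) : Meromorphic fun _ => c := fun x _ =>
  ⟨Set.univ, fun _ => c, fun _ => 1, isOpen_univ, trivial, by fun_prop, by fun_prop,
    fun y _ => subset_closure ⟨trivial, one_ne_zero⟩, fun _ _ => one_mul c⟩

/-- The `l`-th root `exp (2 π i τ / l)` of the nome. -/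
def nomeRoot (l : ℕ) (τ : ℂ) : ℂ := exp (2 * Real.pi * I * τ / l)

theorem nomeRoot_pow {l m : ℕ} (hm : 0 < m) (τ : ℂ) :
    nomeRoot (l * m) τ ^ m = nomeRoot l τ := by
  rw [nomeRoot, nomeRoot, ← exp_nat_mul]
  have : (m : ℂ) ≠ 0 := Nat.cast_ne_zero.2 hm.ne'
  congr 1
  push_cast
  field_simp

theorem nomeRoot_one (τ : ℂ) : nomeRoot 1 τ = nome τ := by simp [nomeRoot, nome]

/-- `z ^ N * f` is given near the cusp by a holomorphic function `g` of `(exp (2 π i τ / l), z)`. -/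
def ExpandsAs (f : latticeCompl → ℂ) (l N : ℕ) (ε : ℝ) (g : ℂ × ℂ → ℂ) : Prop :=
  DifferentiableOn ℂ g (ball 0 ε) ∧ ∀ p : latticeCompl,
    ‖nomeRoot l p.1.1‖ < ε → ‖p.1.2‖ < ε → p.1.2 ^ N * f p = g (nomeRoot l p.1.1, p.1.2)

/-- Substituting q^(1/l) = (q^(1/(lm)))^m lets two expansions be brought to a common root of q. The
bound δ ≤ 1 ensures that taking m-th powers does not leave the ball. -/
theorem ExpandsAs.refine {f : latticeCompl → ℂ} {l N : ℕ} {ε : ℝ} {g : ℂ × ℂ → ℂ}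
    (h : ExpandsAs f l N ε g) {m : ℕ} (hm : 0 < m) {δ : ℝ} (hδ : δ ≤ ε) (hδ1 : δ ≤ 1) :
    ExpandsAs f (l * m) N δ fun x => g (x.1 ^ m, x.2) := by
  have h1 : ∀ w : ℂ, ‖w‖ < δ → ‖w ^ m‖ < ε := fun w hw => by
    rw [norm_pow]
    exact (pow_le_of_le_one (norm_nonneg _) (hw.le.trans hδ1) hm.ne').trans_lt (hw.trans_le hδ)
  refine ⟨h.1.comp (by fun_prop) fun x hx => ?_, fun p hp1 hp2 => ?_⟩
  · rw [mem_ball_zero_iff, Prod.norm_def, max_lt_iff] at hx ⊢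
    exact ⟨h1 _ hx.1, hx.2.trans_le hδ⟩
  · have h2 := h1 _ hp1
    simp only [nomeRoot_pow hm] at h2 ⊢
    exact h.2 p h2 (hp2.trans_le hδ)

theorem HasExpansion.exists_common {f g : latticeCompl → ℂ} (hf : HasExpansion f)
    (hg : HasExpansion g) : ∃ (l N M : ℕ) (ε : ℝ) (a b : ℂ × ℂ → ℂ), 0 < l ∧ 0 < ε ∧
      ExpandsAs f l N ε a ∧ ExpandsAs g l M ε b := by
  obtain ⟨l, N, ε, a, hl, hε, ha⟩ := hf
  obtain ⟨m, M, δ, b, hm, hδ, hb⟩ := hg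
  have ha : ExpandsAs f l N ε a := ha
  have hb : ExpandsAs g m M δ b := hb
  have hb' := hb.refine hl (δ := min 1 (min ε δ)) (min_le_of_right_le (min_le_right _ _))
    (min_le_left _ _)
  rw [mul_comm] at hb'
  exact ⟨l * m, N, M, min 1 (min ε δ), _, _, by positivity, by positivity,
    ha.refine hm (min_le_of_right_le (min_le_left _ _)) (min_le_left _ _), hb'⟩

theorem HasExpansion.add {f g : latticeCompl → ℂ} (hf : HasExpansion f) (hg : HasExpansion g) :
    HasExpansion (f + g) := by
  obtain ⟨l, N, M, ε, a, b, hl, hε, ha, hb⟩ := hf.exists_common hg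
  refine ⟨l, N + M, ε, fun x => x.2 ^ M * a x + x.2 ^ N * b x, hl, hε,
    (DifferentiableOn.mul (by fun_prop) ha.1).add (DifferentiableOn.mul (by fun_prop) hb.1),
    fun p hp1 hp2 => ?_⟩
  have h1 := ha.2 p hp1 hp2
  have h2 := hb.2 p hp1 hp2
  rw [nomeRoot] at h1 h2
  simp only [Pi.add_apply, ← h1, ← h2]
  ring

theorem HasExpansion.mul {f g : latticeCompl → ℂ} (hf : HasExpansion f) (hg : HasExpansion g) :
    HasExpansion (f * g) := by
  obtain ⟨l, N, M, ε, a, b, hl, hε, ha, hb⟩ := hf.exists_common hg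
  refine ⟨l, N + M, ε, fun x => a x * b x, hl, hε, ha.1.mul hb.1, fun p hp1 hp2 => ?_⟩
  have h1 := ha.2 p hp1 hp2
  have h2 := hb.2 p hp1 hp2
  rw [nomeRoot] at h1 h2
  simp only [Pi.mul_apply, ← h1, ← h2]
  ring

theorem hasExpansion_const (c : ℂ) : HasExpansion fun _ => c :=
  ⟨1, 0, 1, fun _ => c, one_pos, one_pos, by fun_prop, fun _ _ _ => by simp⟩

/-- The algebra of admissible coefficients. -/
def coefficients : Subalgebra ℂ (latticeCompl → ℂ) where
  carrier := {f | IsCoefficient f}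
  mul_mem' hf hg := ⟨hf.1.mul hg.1, hf.2.mul hg.2, hf.3.mul hg.3⟩
  add_mem' hf hg := ⟨hf.1.add hg.1, hf.2.add hg.2, hf.3.add hg.3⟩
  algebraMap_mem' c := ⟨holomorphic_const c, meromorphic_const c, hasExpansion_const c⟩

/-- The translation law moves the singularity along z = mτ + n to the one along z = 0 at the cost of
a constant, so (z − mτ − n)^N is a local denominator there. The expansion at the cusp is the
normalized one, with l = 1. -/
theorem isCoefficient_of_hasNormalizedExpansion {f : ℂ × ℂ → ℂ} {N : ℕ}
    (hf : DifferentiableOn ℂ f latticeCompl) (hN : HasNormalizedExpansion N f)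
    (hadd : ∀ m n : ℤ, ∃ c : ℂ, ∀ τ z : ℂ, (τ, z) ∈ latticeCompl →
      f (τ, z + m * τ + n) = f (τ, z) + c) : IsCoefficient fun p => f p := by
  obtain ⟨g, hg, -, hgf⟩ := hN
  refine ⟨⟨f, hf, fun _ => rfl⟩, ?_, ?_⟩
  · rintro ⟨τ₀, z₀⟩ hτ₀
    by_cases hx : (τ₀, z₀) ∈ latticeCompl
    · exact ⟨latticeCompl, f, fun _ => 1, isOpen_latticeCompl, hx, hf, by fun_prop,
        fun y hy => subset_closure ⟨hy, one_ne_zero⟩, fun p _ => one_mul _⟩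
    · obtain ⟨m, n, rfl⟩ : ∃ m n : ℤ, z₀ = m * τ₀ + n := by
        have hτ₀ : 0 < τ₀.im := hτ₀
        simpa [latticeCompl, hτ₀] using hx
      obtain ⟨c, hc⟩ := hadd m n
      set φ : ℂ × ℂ → ℂ × ℂ := fun p => (nome p.1, p.2 - m * p.1 - n) with hφ
      have hφd : Differentiable ℂ φ := by
        have := differentiable_nome
        fun_prop
      refine ⟨φ ⁻¹' nomeDomain, fun p => g (φ p) + c * (p.2 - m * p.1 - n) ^ N,
        fun p => (p.2 - m * p.1 - n) ^ N, isOpen_nomeDomain.preimage hφd.continuous, ?_,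
        (hg.comp hφd.differentiableOn fun _ h => h).add (by fun_prop), by fun_prop, ?_, ?_⟩
      · simpa [hφ] using mem_nomeDomain_of_norm_lt_one (norm_nome_lt_one hτ₀)
      · intro p hp
        by_cases hp0 : p.2 - m * p.1 - n = 0
        · have h1 : Tendsto (fun t : ℂ => (p.1, p.2 + t)) (𝓝[≠] 0) (𝓝 p) := by
            have : Continuous fun t : ℂ => (p.1, p.2 + t) := by fun_prop
            simpa using (this.tendsto 0).mono_left nhdsWithin_le_nhds
          refine mem_closure_of_tendsto h1 ?_
          filter_upwards [h1.eventually_mem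
            ((isOpen_nomeDomain.preimage hφd.continuous).mem_nhds hp), self_mem_nhdsWithin]
            with t ht ht0
          refine ⟨ht, pow_ne_zero _ ?_⟩
          rw [show p.2 + t - m * p.1 - n = t by linear_combination hp0]
          exact ht0
        · exact subset_closure ⟨hp, pow_ne_zero _ hp0⟩
      · rintro ⟨⟨τ, z⟩, hp⟩ hpU
        have h1 : (τ, z - m * τ - n) ∈ latticeCompl := by
          refine (translate_mem_iff m n).1 ?_
          rwa [show z - m * τ - n + m * τ + n = z by ring]
        have h2 := hc _ _ h1
        rw [show z - m * τ - n + m * τ + n = z by ring] at h2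
        have h3 := hgf _ h1 hpU
        simp only at h3 ⊢
        rw [h2, hφ, ← h3]
        ring
  · obtain ⟨ε, hε, hball⟩ := Metric.isOpen_iff.1 isOpen_nomeDomain 0
      (mem_nomeDomain_of_norm_lt_one (q := 0) (by simp))
    refine ⟨1, N, ε, g, one_pos, hε, hg.mono hball, fun p hp1 hp2 => ?_⟩
    change ‖nomeRoot 1 p.1.1‖ < ε at hp1
    change _ = g (nomeRoot 1 p.1.1, p.1.2)
    rw [nomeRoot_one] at hp1 ⊢
    refine hgf p p.2 (hball ?_)
    rw [mem_ball_zero_iff, Prod.norm_def]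
    exact max_lt hp1 hp2

theorem isCoefficient_eis (n : ℕ) : IsCoefficient fun p => eis n p :=
  isCoefficient_of_hasNormalizedExpansion (differentiableOn_eis n) (hasNormalizedExpansion_eis n)
    (exists_eis_add n)

/-- The power series of `e_2` in the nome. -/
def eisensteinTwoSeries (q : ℂ) : ℂ :=
  2 * riemannZeta 2 - 8 * Real.pi ^ 2 * ∑' n : ℕ+, (ArithmeticFunction.sigma 1 n : ℂ) * q ^ (n : ℕ)

theorem eisensteinTwo_eq (p : latticeCompl) :
    eisensteinTwo p = eisensteinTwoSeries (nome p.1.1) := by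
  rw [eisensteinTwo, EisensteinSeries.G2_eq_tsum_cexp]
  simp [eisensteinTwoSeries, nome]

theorem sigma_one_le_sq (n : ℕ) : (ArithmeticFunction.sigma 1 n : ℝ) ≤ (n : ℝ) ^ 2 :=
  (Nat.cast_le.2 (ArithmeticFunction.sigma_le_pow_succ 1 n)).trans_eq (Nat.cast_pow n 2)

theorem summable_pnat_pow_mul_pow {r : ℝ} (hr0 : 0 ≤ r) (hr1 : r < 1) (k : ℕ) :
    Summable fun n : ℕ+ => ((n : ℕ) : ℝ) ^ k * r ^ (n : ℕ) := by
  have h := summable_pow_mul_geometric_of_norm_lt_one k (r := r) (by rwa [Real.norm_of_nonneg hr0])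
  have h1 := h.comp_injective PNat.coe_injective
  exact h1

theorem differentiableOn_tsum_mul_pow {c : ℕ → ℂ} {k : ℕ} (hc : ∀ n, ‖c n‖ ≤ (n : ℝ) ^ k) :
    DifferentiableOn ℂ (fun q : ℂ => ∑' n : ℕ+, c n * q ^ (n : ℕ)) (ball 0 1) := by
  intro q hq
  rw [mem_ball_zero_iff] at hq
  obtain ⟨r, hr, hr1⟩ := exists_between hq
  have h2 : DifferentiableOn ℂ (fun q : ℂ => ∑' n : ℕ+, c n * q ^ (n : ℕ)) (ball 0 r) := by
    refine differentiableOn_tsum_of_summable_norm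
      (summable_pnat_pow_mul_pow ((norm_nonneg _).trans hr.le) hr1 k) (fun n => by fun_prop)
      isOpen_ball fun n w hw => ?_
    rw [mem_ball_zero_iff] at hw
    rw [norm_mul, norm_pow]
    exact mul_le_mul (hc n) (pow_le_pow_left₀ (norm_nonneg w) hw.le _) (by positivity)
      (by positivity)
  exact (h2.differentiableAt (isOpen_ball.mem_nhds
    (mem_ball_zero_iff.2 hr))).differentiableWithinAt

theorem differentiableOn_eisensteinTwoSeries :
    DifferentiableOn ℂ eisensteinTwoSeries (ball 0 1) := by
  have h := differentiableOn_tsum_mul_pow (c := fun n => (ArithmeticFunction.sigma 1 n : ℂ)) (k := 2)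
    fun n => by rw [norm_natCast]; exact sigma_one_le_sq n
  unfold eisensteinTwoSeries
  exact (h.const_mul _).const_sub _

theorem isCoefficient_eisensteinTwo : IsCoefficient eisensteinTwo := by
  have h1 : DifferentiableOn ℂ (fun x : ℂ × ℂ => eisensteinTwoSeries (nome x.1))
      {x | 0 < x.1.im} := by
    refine differentiableOn_eisensteinTwoSeries.comp
      (differentiable_nome.comp differentiable_fst).differentiableOn fun x hx => ?_
    rw [mem_ball_zero_iff]
    exact norm_nome_lt_one hx
  refine ⟨⟨_, h1.mono fun x hx => hx.1, eisensteinTwo_eq⟩, fun x hx => ?_, ?_⟩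
  · refine ⟨{x | 0 < x.1.im}, _, fun _ => 1, ?_, hx, h1, by fun_prop,
      fun y hy => subset_closure ⟨hy, one_ne_zero⟩, fun p _ => ?_⟩
    · exact isOpen_lt continuous_const (by fun_prop)
    · rw [one_mul, eisensteinTwo_eq]
  · refine ⟨1, 0, 1, fun x => eisensteinTwoSeries x.1, one_pos, one_pos, ?_, fun p hp1 hp2 => ?_⟩
    · refine differentiableOn_eisensteinTwoSeries.comp differentiableOn_fst fun x hx => ?_
      rw [mem_ball_zero_iff] at hx ⊢
      exact (norm_fst_le x).trans_lt hx
    · rw [pow_zero, one_mul, eisensteinTwo_eq]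
      change _ = eisensteinTwoSeries (nomeRoot 1 p.1.1)
      rw [nomeRoot_one]

end QuasiJacobi

end

/-! ### Modular transformation of E_n, e_2, λ and μ. -/

noncomputable section

namespace QuasiJacobi
open Complex Filter Topology Metric SummationFilter

theorem tendsto_div_const_punctured {j : ℂ} (hj : j ≠ 0) :
    Tendsto (fun z : ℂ => z / j) (𝓝[≠] 0) (𝓝[≠] 0) := by
  refine tendsto_nhdsWithin_iff.2 ⟨?_, ?_⟩
  · have : Continuous fun z : ℂ => z / j := by fun_prop
    simpa using (this.tendsto 0).mono_left nhdsWithin_le_nhds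
  · filter_upwards [self_mem_nhdsWithin] with z hz using div_ne_zero hz hj

/-- The factor of automorphy `c τ + d`. -/
def autFactor (γ : SL(2, ℤ)) (τ : ℂ) : ℂ := ((γ 1 0 : ℤ) : ℂ) * τ + ((γ 1 1 : ℤ) : ℂ)

/-- The point `(a τ + b) / (c τ + d)`. -/
def mobius (γ : SL(2, ℤ)) (τ : ℂ) : ℂ :=
  (((γ 0 0 : ℤ) : ℂ) * τ + ((γ 0 1 : ℤ) : ℂ)) / autFactor γ τ

theorem autFactor_ne_zero (γ : SL(2, ℤ)) {τ : ℂ} (hτ : 0 < τ.im) : autFactor γ τ ≠ 0 :=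
  denom_ne_zero γ τ hτ

theorem mobius_mem (γ : SL(2, ℤ)) {τ z : ℂ} (h : (τ, z) ∈ latticeCompl) :
    (mobius γ τ, z / autFactor γ τ) ∈ latticeCompl := modular_mem γ (τ, z) h

theorem modularAct_fst (γ : SL(2, ℤ)) (p : latticeCompl) :
    (modularAct γ p).1.1 = mobius γ p.1.1 := rfl

theorem modularAct_snd (γ : SL(2, ℤ)) (p : latticeCompl) :
    (modularAct γ p).1.2 = p.1.2 / autFactor γ p.1.1 := rfl

theorem det_cast (γ : SL(2, ℤ)) : ((γ 0 0 : ℤ) : ℂ) * γ 1 1 - γ 0 1 * γ 1 0 = 1 := by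
  have := γ.det_coe
  rw [Matrix.det_fin_two] at this
  exact_mod_cast this

theorem tendsto_of_hasNormalizedExpansion {N : ℕ} {F : ℂ × ℂ → ℂ} (h : HasNormalizedExpansion N F)
    {τ : ℂ} (hτ : 0 < τ.im) :
    Tendsto (fun z => z ^ N * F (τ, z)) (𝓝[≠] 0) (𝓝 1) := by
  obtain ⟨g, hg, hg1, hgF⟩ := h
  have h0 := mem_nomeDomain_of_norm_lt_one (norm_nome_lt_one hτ)
  have h1 : ContinuousAt (fun z : ℂ => g (nome τ, z)) 0 :=
    ContinuousAt.comp (f := fun z : ℂ => (nome τ, z)) (g := g)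
      (hg.continuousOn.continuousAt (isOpen_nomeDomain.mem_nhds h0)) (by fun_prop)
  have h2 := h1.tendsto.mono_left (nhdsWithin_le_nhds (s := {0}ᶜ))
  rw [hg1 _ (norm_nome_lt_one hτ)] at h2
  have h3 : {z : ℂ | (nome τ, z) ∈ nomeDomain} ∈ 𝓝[≠] 0 := mem_nhdsWithin_of_mem_nhds <|
    (isOpen_nomeDomain.preimage (by fun_prop : Continuous fun z : ℂ => (nome τ, z))).mem_nhds h0
  refine h2.congr' ?_
  filter_upwards [h3, eventually_mem_slice hτ] with z hz hz2
  exact (hgF _ hz2 hz).symm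

theorem differentiableAt_eis_slice (n : ℕ) {τ z : ℂ} (h : (τ, z) ∈ latticeCompl) :
    DifferentiableAt ℂ (fun w => eis n (τ, w)) z := (hasDerivAt_eis n h).differentiableAt

/-- The difference of the two sides is doubly periodic: the linear term compensates the
quasi-periods of the two E_1. Its simple poles cancel, both having residue j, so it is constant in
z; being odd, it vanishes. -/
theorem eisOne_mobius (γ : SL(2, ℤ)) {τ z : ℂ} (h : (τ, z) ∈ latticeCompl) :
    eisOne (mobius γ τ, z / autFactor γ τ) =
      autFactor γ τ * eisOne (τ, z) + 2 * Real.pi * I * (γ 1 0 : ℤ) * z := by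
  have hτ := h.1
  set j := autFactor γ τ with hj
  have hj0 : j ≠ 0 := autFactor_ne_zero γ hτ
  have hγτ : 0 < (mobius γ τ).im := (mobius_mem γ h).1
  have hdet := det_cast γ
  set k : ℂ → ℂ := fun z => eisOne (mobius γ τ, z / j) - j * eisOne (τ, z) -
    2 * Real.pi * I * (γ 1 0 : ℤ) * z with hk
  have hd1 : ∀ w, (τ, w) ∈ latticeCompl → DifferentiableAt ℂ (fun z => eisOne (mobius γ τ, z / j)) w :=
    fun w hw => DifferentiableAt.comp (g := fun z => eisOne (mobius γ τ, z)) (f := fun z => z / j) w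
      (differentiableAt_eis_slice 0 (mobius_mem γ hw)) (by fun_prop)
  have hd2 : ∀ w, (τ, w) ∈ latticeCompl → DifferentiableAt ℂ (fun z => eisOne (τ, z)) w :=
    fun w hw => differentiableAt_eis_slice 0 hw
  have hkd : ∀ w, (τ, w) ∈ latticeCompl → DifferentiableAt ℂ k w := fun w hw =>
    ((hd1 w hw).fun_sub ((hd2 w hw).const_mul _)).fun_sub (by fun_prop)
  have hp1 : ∀ w, (τ, w) ∈ latticeCompl → k (w + 1) = k w := by
    intro w hw
    have h1 := eisOne_add (mobius_mem γ hw) (-γ 1 0) (γ 0 0)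
    -- The lattice vector 1/j equals −c·γτ + a because ad − bc = 1; likewise τ/j = d·γτ − b below.
    have h2 : w / j + ((-γ 1 0 : ℤ) : ℂ) * mobius γ τ + (γ 0 0 : ℤ) = (w + 1) / j := by
      rw [mobius, ← hj]
      field_simp
      rw [hj, autFactor]
      push_cast
      linear_combination hdet
    rw [← hj, h2] at h1
    simp only [hk]
    rw [h1, eisOne_add_one]
    push_cast
    ring
  have hp2 : ∀ w, (τ, w) ∈ latticeCompl → k (w + τ) = k w + 0 := by
    intro w hw
    have h1 := eisOne_add (mobius_mem γ hw) (γ 1 1) (-γ 0 1)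
    have h2 : w / j + (γ 1 1 : ℤ) * mobius γ τ + ((-γ 0 1 : ℤ) : ℂ) = (w + τ) / j := by
      rw [mobius, ← hj]
      field_simp
      rw [hj, autFactor]
      push_cast
      linear_combination τ * hdet
    rw [← hj, h2] at h1
    simp only [hk]
    rw [h1, eisOne_add_tau hw, hj, autFactor]
    ring
  have hb : IsBoundedUnder (· ≤ ·) (𝓝[≠] 0) fun w => ‖k w‖ := by
    have hu1 := (tendsto_of_hasNormalizedExpansion hasNormalizedExpansion_eisOne hτ).const_mul j
    have hu2 := ((tendsto_of_hasNormalizedExpansion hasNormalizedExpansion_eisOne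
      hγτ).comp (tendsto_div_const_punctured hj0)).const_mul j
    have hu := hu2.sub hu1
    rw [sub_self] at hu
    have hu' : Tendsto (fun z => z * (eisOne (mobius γ τ, z / j) - j * eisOne (τ, z)))
        (𝓝[≠] 0) (𝓝 0) := by
      refine hu.congr fun w => ?_
      simp only [Function.comp_apply, pow_one]
      field_simp
    have hb := isBoundedUnder_sub_div (c := 0) ?_ hu'
    · obtain ⟨B, hB⟩ := hb
      have hlin : ∀ᶠ z : ℂ in 𝓝[≠] 0, ‖2 * Real.pi * I * (γ 1 0 : ℤ) * z‖ ≤ 1 := by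
        have : Continuous fun z : ℂ => ‖2 * Real.pi * I * (γ 1 0 : ℤ) * z‖ := by fun_prop
        have h1 := (this.tendsto 0).mono_left (nhdsWithin_le_nhds (s := {0}ᶜ))
        simp only [mul_zero, norm_zero] at h1
        exact h1.eventually_le_const one_pos
      refine ⟨B + 1, eventually_map.2 ?_⟩
      filter_upwards [eventually_map.1 hB, hlin, self_mem_nhdsWithin] with z h1 h2 h3
      rw [sub_zero, mul_div_cancel_left₀ _ h3] at h1
      exact (norm_sub_le _ _).trans (add_le_add h1 h2)
    · filter_upwards [eventually_mem_slice hτ] with w hw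
      exact differentiableAt_id.fun_mul ((hd1 w hw).fun_sub ((hd2 w hw).const_mul _))
  obtain ⟨-, C, hC⟩ := eq_const_of_quasiPeriodic (κ := 0) hτ hkd hp1 hp2 hb
  have hz' : (τ, -z) ∈ latticeCompl := by
    refine ⟨hτ, fun a b hab => h.2 (-a) (-b) ?_⟩
    push_cast
    simp only at hab ⊢
    linear_combination -hab
  have h1 := hC z h
  have h2 := hC (-z) hz'
  simp only [hk, neg_div, eisOne_neg] at h1 h2
  have h3 : C = 0 := by
    have : 2 * C = 0 := by linear_combination -h1 - h2
    simpa using this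
  rw [h3] at h1
  linear_combination h1

/-- Chain rule in z. The constant error disappears and the slope of the linear one becomes a
constant, so the error 2πicz of E_1 turns into a constant for E_2 and is gone from E_3 on. -/
theorem eis_succ_mobius_of_mobius (γ : SL(2, ℤ)) {k : ℕ} {τ c : ℂ} {l : ℂ}
    (hc : ∀ w, (τ, w) ∈ latticeCompl → eis k (mobius γ τ, w / autFactor γ τ) =
      autFactor γ τ ^ (k + 1) * eis k (τ, w) + l * w + c) {z : ℂ} (h : (τ, z) ∈ latticeCompl) :
    eis (k + 1) (mobius γ τ, z / autFactor γ τ) =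
      autFactor γ τ ^ (k + 2) * eis (k + 1) (τ, z) - autFactor γ τ / (k + 1) * l := by
  have hj0 : autFactor γ τ ≠ 0 := autFactor_ne_zero γ h.1
  have h1 := (hasDerivAt_eis k (mobius_mem γ h)).comp z ((hasDerivAt_id z).div_const _)
  have h2 := ((((hasDerivAt_eis k h).const_mul (autFactor γ τ ^ (k + 1))).fun_add
    ((hasDerivAt_id z).const_mul l)).add_const c).congr_of_eventuallyEq (by
      filter_upwards [(isOpen_slice τ).mem_nhds h] with v hv using hc v hv)
  have h3 := h1.unique h2
  have h4 : (k : ℂ) + 1 ≠ 0 := Nat.cast_add_one_ne_zero k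
  field_simp at h3 ⊢
  linear_combination -h3

theorem eis_one_mobius (γ : SL(2, ℤ)) {τ z : ℂ} (h : (τ, z) ∈ latticeCompl) :
    eis 1 (mobius γ τ, z / autFactor γ τ) =
      autFactor γ τ ^ 2 * eis 1 (τ, z) - 2 * Real.pi * I * (γ 1 0 : ℤ) * autFactor γ τ := by
  rw [eis_succ_mobius_of_mobius γ (k := 0) (c := 0) (l := 2 * Real.pi * I * (γ 1 0 : ℤ))
    (fun w hw => ?_) h]
  · push_cast
    ring
  · rw [eis, eisOne_mobius γ hw]
    ring

theorem eis_add_two_mobius (γ : SL(2, ℤ)) (k : ℕ) {τ z : ℂ} (h : (τ, z) ∈ latticeCompl) :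
    eis (k + 2) (mobius γ τ, z / autFactor γ τ) =
      autFactor γ τ ^ (k + 3) * eis (k + 2) (τ, z) := by
  induction k generalizing z with
  | zero =>
    rw [eis_succ_mobius_of_mobius γ (k := 1) (l := 0)
      (c := -(2 * Real.pi * I * (γ 1 0 : ℤ) * autFactor γ τ)) (fun w hw => ?_) h]
    · ring
    · rw [eis_one_mobius γ hw, zero_mul, add_zero, sub_eq_add_neg]
  | succ k ih =>
    rw [eis_succ_mobius_of_mobius γ (k := k + 2) (l := 0) (c := 0) (fun w hw => ?_) h]
    · ring
    · rw [ih hw]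
      ring

theorem eisensteinTwo_modularAct (γ : SL(2, ℤ)) (p : latticeCompl) :
    eisensteinTwo (modularAct γ p) = autFactor γ p.1.1 ^ 2 * eisensteinTwo p -
      2 * Real.pi * I * (γ 1 0 : ℤ) * autFactor γ p.1.1 := by
  obtain ⟨⟨τ, z⟩, h⟩ := p
  have hj0 : autFactor γ τ ≠ 0 := autFactor_ne_zero γ h.1
  have h1 := congrFun (EisensteinSeries.G2_slash_action γ) ⟨τ, h.1⟩
  have h2 : γ • (⟨τ, h.1⟩ : UpperHalfPlane) = ⟨mobius γ τ, (mobius_mem γ h).1⟩ := by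
    ext
    rw [UpperHalfPlane.specialLinearGroup_apply]
    simp [mobius, autFactor]
  have h3 : UpperHalfPlane.denom γ (⟨τ, h.1⟩ : UpperHalfPlane) = autFactor γ τ := by
    simp [UpperHalfPlane.denom, autFactor]
  rw [ModularForm.SL_slash_apply, h2, Pi.sub_apply, EisensteinSeries.D2, h3] at h1
  change EisensteinSeries.G2 ⟨mobius γ τ, _⟩ = autFactor γ τ ^ 2 * EisensteinSeries.G2 ⟨τ, _⟩ -
    2 * Real.pi * I * (γ 1 0 : ℤ) * autFactor γ τ
  rw [zpow_neg, ← div_eq_mul_inv, div_eq_iff (zpow_ne_zero _ hj0)] at h1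
  rw [h1]
  field_simp

theorem eisensteinTwo_translate (m n : ℤ) (p : latticeCompl) :
    eisensteinTwo (translate m n p) = eisensteinTwo p := rfl

theorem conj_autFactor (γ : SL(2, ℤ)) (τ : ℂ) :
    starRingEnd ℂ (autFactor γ τ) = autFactor γ (starRingEnd ℂ τ) := by
  simp [autFactor]

theorem sub_conj_ne_zero {τ : ℂ} (hτ : 0 < τ.im) : τ - starRingEnd ℂ τ ≠ 0 := by
  rw [sub_conj]
  simp [hτ.ne']

theorem mobius_sub_conj (γ : SL(2, ℤ)) {τ : ℂ} (hτ : 0 < τ.im) :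
    mobius γ τ - starRingEnd ℂ (mobius γ τ) =
      (τ - starRingEnd ℂ τ) / (autFactor γ τ * autFactor γ (starRingEnd ℂ τ)) := by
  have hj0 := autFactor_ne_zero γ hτ
  have hj1 : autFactor γ (starRingEnd ℂ τ) ≠ 0 := by
    rw [← conj_autFactor]; simpa using hj0
  have hdet := det_cast γ
  simp only [mobius, map_div₀, conj_autFactor, map_add, map_mul, map_intCast]
  rw [div_sub_div _ _ hj0 hj1]
  congr 1
  simp only [autFactor]
  linear_combination (τ - starRingEnd ℂ τ) * hdet

theorem mu_modularAct (γ : SL(2, ℤ)) (p : latticeCompl) :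
    mu (modularAct γ p) = autFactor γ p.1.1 ^ 2 * mu p - (γ 1 0 : ℤ) * autFactor γ p.1.1 := by
  have hj0 := autFactor_ne_zero γ p.2.1
  have hj1 : autFactor γ (starRingEnd ℂ p.1.1) ≠ 0 := by
    rw [← conj_autFactor]; simpa using hj0
  have h := sub_conj_ne_zero p.2.1
  rw [mu, mu, modularAct_fst, mobius_sub_conj γ p.2.1]
  field_simp
  simp only [autFactor]
  ring

theorem lam_modularAct (γ : SL(2, ℤ)) (p : latticeCompl) :
    lam (modularAct γ p) = autFactor γ p.1.1 * lam p - (γ 1 0 : ℤ) * p.1.2 := by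
  have hj0 := autFactor_ne_zero γ p.2.1
  have hj1 : autFactor γ (starRingEnd ℂ p.1.1) ≠ 0 := by
    rw [← conj_autFactor]; simpa using hj0
  have h := sub_conj_ne_zero p.2.1
  rw [lam, lam, modularAct_fst, modularAct_snd, mobius_sub_conj γ p.2.1, map_div₀, conj_autFactor]
  field_simp
  simp only [autFactor]
  ring

theorem lam_translate (m n : ℤ) (p : latticeCompl) : lam (translate m n p) = lam p + m := by
  have h := sub_conj_ne_zero p.2.1
  simp only [lam, translate, map_add, map_mul, map_intCast]
  field_simp
  ring

theorem jacobiEquations_iff {k : ℤ} {F : latticeCompl → ℂ} : JacobiEquations k F ↔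
    (∀ γ p, F (modularAct γ p) = autFactor γ p.1.1 ^ k * F p) ∧
      ∀ m n p, F (translate m n p) = F p := Iff.rfl

theorem jacobiEquations_eisOne_add_lam :
    JacobiEquations 1 fun p => eisOne p + 2 * Real.pi * I * lam p := by
  refine jacobiEquations_iff.2 ⟨fun γ p => ?_, fun m n p => ?_⟩
  · have h : eisOne (modularAct γ p) = _ := eisOne_mobius γ p.2
    rw [lam_modularAct, h, zpow_one]
    ring
  · have h : eisOne (translate m n p) = _ := eisOne_add p.2 m n
    rw [lam_translate, h]
    ring

theorem jacobiEquations_eisensteinTwo_sub_mu :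
    JacobiEquations 2 fun p => eisensteinTwo p - 2 * Real.pi * I * mu p := by
  refine jacobiEquations_iff.2 ⟨fun γ p => ?_, fun m n p => rfl⟩
  rw [mu_modularAct, eisensteinTwo_modularAct, show (2 : ℤ) = (2 : ℕ) from rfl, zpow_natCast]
  ring

theorem jacobiEquations_eis_one_sub :
    JacobiEquations 2 fun p => eis 1 p - eisensteinTwo p := by
  refine jacobiEquations_iff.2 ⟨fun γ p => ?_, fun m n p => ?_⟩
  · have h : eis 1 (modularAct γ p) = _ := eis_one_mobius γ p.2
    rw [eisensteinTwo_modularAct, h, show (2 : ℤ) = (2 : ℕ) from rfl, zpow_natCast]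
    ring
  · have h : eis 1 (translate m n p) = _ := eis_succ_add 0 p.2 m n
    rw [eisensteinTwo_translate, h]

theorem jacobiEquations_eis_add_two (k : ℕ) :
    JacobiEquations (k + 3) fun p => eis (k + 2) p := by
  refine jacobiEquations_iff.2 ⟨fun γ p => ?_, fun m n p => eis_succ_add (k + 1) p.2 m n⟩
  have h : eis (k + 2) (modularAct γ p) = _ := eis_add_two_mobius γ k p.2
  rw [h]
  norm_cast

end QuasiJacobi

end

/-! ### Level one modular forms lie in the algebra generated by the E_n and e_2. -/

noncomputable section

namespace QuasiJacobi
open Complex Filter Topology Metric SummationFilter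

/-- The algebra generated by the functions `E_n` and `e_2`. -/
def eisensteinAlgebra : Subalgebra ℂ (latticeCompl → ℂ) :=
  Algebra.adjoin ℂ ({f | ∃ n : ℕ, 1 ≤ n ∧ f = twistedEisenstein n} ∪ {eisensteinTwo})

theorem eis_mem (n : ℕ) : (fun p : latticeCompl => eis n p) ∈ eisensteinAlgebra :=
  Algebra.subset_adjoin (.inl ⟨n + 1, Nat.le_add_left 1 n,
    funext fun p => (twistedEisenstein_eq_eis n p).symm⟩)

theorem eisensteinTwo_mem : eisensteinTwo ∈ eisensteinAlgebra :=
  Algebra.subset_adjoin (.inr rfl)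

/-- A function of `τ` as a function of `(τ, z)`. -/
def pullback : (UpperHalfPlane → ℂ) →ₐ[ℂ] (latticeCompl → ℂ) where
  toFun a p := a ⟨p.1.1, p.2.1⟩
  map_one' := rfl
  map_mul' _ _ := rfl
  map_zero' := rfl
  map_add' _ _ := rfl
  commutes' _ := rfl

theorem derivWeierstrassP_eq_eis {τ z : ℂ} (h : (τ, z) ∈ latticeCompl) :
    (periodPair τ h.1).derivWeierstrassP z = -2 * eis 2 (τ, z) := by
  have h1 := hasDerivAt_eis 1 h
  rw [← PeriodPair.deriv_weierstrassP]
  have h2 : (periodPair τ h.1).weierstrassP =ᶠ[𝓝 z] fun w => eis 1 (τ, w) -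
      EisensteinSeries.G2 ⟨τ, h.1⟩ := by
    filter_upwards [(isOpen_slice τ).mem_nhds h] with w hw
    rw [eis_one_eq_weierstrassP hw, add_sub_cancel_right]
  rw [h2.deriv_eq, (h1.sub_const _).deriv]
  push_cast
  ring

/-- The Weierstrass equation with ℘ = E_2 − e_2 and ℘' = −2E_3. Once g₂ is known to lie in the
algebra, this puts g₃ there too. -/
theorem eis_two_sq {τ z : ℂ} (h : (τ, z) ∈ latticeCompl) :
    4 * eis 2 (τ, z) ^ 2 = 4 * (eis 1 (τ, z) - EisensteinSeries.G2 ⟨τ, h.1⟩) ^ 3 -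
      (periodPair τ h.1).g₂ * (eis 1 (τ, z) - EisensteinSeries.G2 ⟨τ, h.1⟩) -
        (periodPair τ h.1).g₃ := by
  have h1 := (periodPair τ h.1).derivWeierstrassP_sq z ((mem_latticeCompl_iff h.1).1 h)
  rw [derivWeierstrassP_eq_eis h, ← sub_eq_of_eq_add (eis_one_eq_weierstrassP h)] at h1
  linear_combination h1

/-- This is ℘'' = 6℘² − g₂/2 with ℘'' = 6E_4. Differentiating the Weierstrass equation gives it
multiplied by E_3; on the connected slice E_3 can be cancelled, since z³E_3 → 1 shows that it is not
identically zero. -/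
theorem g₂_eq_eis {τ z : ℂ} (h : (τ, z) ∈ latticeCompl) :
    (periodPair τ h.1).g₂ = 12 * (eis 1 (τ, z) - EisensteinSeries.G2 ⟨τ, h.1⟩) ^ 2 -
      12 * eis 3 (τ, z) := by
  have hτ := h.1
  set s := {w : ℂ | (τ, w) ∈ latticeCompl}
  set G := EisensteinSeries.G2 ⟨τ, h.1⟩
  have hd : ∀ n, DifferentiableOn ℂ (fun w => eis n (τ, w)) s := fun n w hw =>
    (differentiableAt_eis_slice n hw).differentiableWithinAt
  have ha : AnalyticOnNhd ℂ (fun w => eis 2 (τ, w)) s := (hd 2).analyticOnNhd (isOpen_slice τ)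
  have hb : AnalyticOnNhd ℂ (fun w => (periodPair τ hτ).g₂ - 12 * (eis 1 (τ, w) - G) ^ 2 +
      12 * eis 3 (τ, w)) s :=
    ((((((hd 1).sub_const G).pow 2).const_mul 12).const_sub _).add ((hd 3).const_mul 12)).analyticOnNhd
      (isOpen_slice τ)
  have hab : ∀ w ∈ s, (fun w => eis 2 (τ, w)) w * (fun w => (periodPair τ hτ).g₂ -
      12 * (eis 1 (τ, w) - G) ^ 2 + 12 * eis 3 (τ, w)) w = 0 := by
    intro w hw
    have h1 := hasDerivAt_eis 1 hw
    have h2 := hasDerivAt_eis 2 hw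
    have h3 := (h1.sub_const G)
    have h4 := (h2.fun_pow 2).const_mul 4
    have h5 := (((h3.fun_pow 3).const_mul 4).fun_sub (h3.const_mul (periodPair τ hτ).g₂)).sub_const
      (periodPair τ hτ).g₃
    have h6 := h4.unique (h5.congr_of_eventuallyEq (by
      filter_upwards [(isOpen_slice τ).mem_nhds hw] with v hv using eis_two_sq hv))
    norm_num at h6 ⊢
    have h7 : (2 : ℂ) * (eis 2 (τ, w) * ((periodPair τ hτ).g₂ -
      12 * (eis 1 (τ, w) - G) ^ 2 + 12 * eis 3 (τ, w))) = 0 := by linear_combination -h6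
    simpa using h7
  rcases AnalyticOnNhd.eq_zero_or_eq_zero_of_mul_eq_zero ha hb hab (isPreconnected_slice τ hτ)
    with h1 | h1
  · exfalso
    have h2 := tendsto_of_hasNormalizedExpansion (hasNormalizedExpansion_eis 2) hτ
    have h3 : Tendsto (fun z => z ^ (2 + 1) * eis 2 (τ, z)) (𝓝[≠] 0) (𝓝 0) := by
      refine tendsto_const_nhds.congr' ?_
      filter_upwards [eventually_mem_slice hτ] with w hw
      have : eis 2 (τ, w) = 0 := h1 w hw
      rw [this, mul_zero]
    exact zero_ne_one (tendsto_nhds_unique h3 h2)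
  · have : (periodPair τ hτ).g₂ - 12 * (eis 1 (τ, z) - G) ^ 2 + 12 * eis 3 (τ, z) = 0 := h1 z h
    linear_combination this

theorem sum_lattice_eq_eisensteinSeries {τ : ℂ} (hτ : 0 < τ.im) {k : ℕ} (hk : 3 ≤ k) :
    (periodPair τ hτ).G k = 2 * riemannZeta k * ModularForm.E hk ⟨τ, hτ⟩ := by
  have h1 := tsum_eisSummand_eq_riemannZeta_mul_eisensteinSeries hk ⟨τ, hτ⟩
  have h2 : ModularForm.E hk ⟨τ, hτ⟩ =
      (1 / 2 : ℂ) • EisensteinSeries.eisensteinSeriesSIF (N := 1) 0 k ⟨τ, hτ⟩ := rfl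
  rw [h2, EisensteinSeries.eisensteinSeriesSIF_apply]
  have h3 : (periodPair τ hτ).G k = ∑' v : Fin 2 → ℤ, EisensteinSeries.eisSummand k v ⟨τ, hτ⟩ := by
    rw [PeriodPair.G, ← (periodPair τ hτ).latticeEquivProd.symm.toEquiv.tsum_eq,
      ← (finTwoArrowEquiv ℤ).tsum_eq]
    refine tsum_congr fun v => ?_
    simp only [LinearEquiv.coe_toEquiv, PeriodPair.latticeEquiv_symm_apply]
    simp [periodPair, EisensteinSeries.eisSummand]
  rw [h3, h1, smul_eq_mul]
  ring

theorem pullback_g₂_mem : (fun p : latticeCompl => (periodPair p.1.1 p.2.1).g₂) ∈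
    eisensteinAlgebra := by
  have h1 := eisensteinAlgebra.sub_mem (eis_mem 1) eisensteinTwo_mem
  have h2 := eisensteinAlgebra.sub_mem (eisensteinAlgebra.smul_mem (pow_mem h1 2) 12)
    (eisensteinAlgebra.smul_mem (eis_mem 3) 12)
  convert h2 using 1
  funext p
  exact g₂_eq_eis p.2

theorem pullback_g₃_mem : (fun p : latticeCompl => (periodPair p.1.1 p.2.1).g₃) ∈
    eisensteinAlgebra := by
  have h1 := eisensteinAlgebra.sub_mem (eis_mem 1) eisensteinTwo_mem
  have h2 := eisensteinAlgebra.sub_mem (eisensteinAlgebra.sub_mem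
    (eisensteinAlgebra.smul_mem (pow_mem h1 3) 4) (eisensteinAlgebra.mul_mem pullback_g₂_mem h1))
    (eisensteinAlgebra.smul_mem (pow_mem (eis_mem 2) 2) 4)
  convert h2 using 1
  funext p
  have h3 := eis_two_sq p.2
  simp only [Pi.sub_apply, Pi.smul_apply, Pi.mul_apply, Pi.pow_apply, smul_eq_mul]
  change _ = 4 * (eis 1 p.1 - EisensteinSeries.G2 ⟨p.1.1, p.2.1⟩) ^ 3 -
    _ * (eis 1 p.1 - EisensteinSeries.G2 ⟨p.1.1, p.2.1⟩) - _
  linear_combination h3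

theorem pullback_E_mem {k : ℕ} (hk : 3 ≤ k)
    (h : (fun p : latticeCompl => (periodPair p.1.1 p.2.1).G k) ∈ eisensteinAlgebra) :
    pullback (ModularForm.E hk) ∈ eisensteinAlgebra := by
  have hz : riemannZeta k ≠ 0 := riemannZeta_ne_zero_of_one_lt_re <| by
    norm_cast
    exact lt_of_lt_of_le (by norm_num) hk
  convert eisensteinAlgebra.smul_mem h (2 * riemannZeta k)⁻¹ using 1
  funext p
  rw [Pi.smul_apply, sum_lattice_eq_eisensteinSeries p.2.1 hk, smul_eq_mul,
    inv_mul_cancel_left₀ (mul_ne_zero two_ne_zero hz)]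
  rfl

theorem pullback_E₄_mem : pullback ModularForm.E₄ ∈ eisensteinAlgebra := by
  refine pullback_E_mem _ ?_
  convert eisensteinAlgebra.smul_mem pullback_g₂_mem (60 : ℂ)⁻¹ using 1
  funext p
  simp [PeriodPair.g₂]

theorem pullback_E₆_mem : pullback ModularForm.E₆ ∈ eisensteinAlgebra := by
  refine pullback_E_mem _ ?_
  convert eisensteinAlgebra.smul_mem pullback_g₃_mem (140 : ℂ)⁻¹ using 1
  funext p
  simp [PeriodPair.g₃]

theorem pullback_discriminant_mem : pullback ModularForm.discriminant ∈ eisensteinAlgebra := by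
  have h := eisensteinAlgebra.smul_mem (eisensteinAlgebra.sub_mem (pow_mem pullback_E₄_mem 3)
    (pow_mem pullback_E₆_mem 2)) (1728 : ℂ)⁻¹
  convert h using 1
  funext p
  change ModularForm.discriminant _ = (1728 : ℂ)⁻¹ * (ModularForm.E₄ _ ^ 3 - ModularForm.E₆ _ ^ 2)
  rw [ModularForm.discriminant_eq_E₄_cube_sub_E₆_sq, div_eq_inv_mul]

theorem exists_four_mul_add_six_mul {n : ℕ} (hn : Even n) (h : 4 ≤ n) :
    ∃ a b : ℕ, (n : ℤ) = a * 4 + b * 6 := by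
  obtain ⟨m, rfl⟩ := hn
  obtain ⟨c, hc | hc⟩ := Nat.even_or_odd' m
  · exact ⟨c, 0, by lia⟩
  · exact ⟨c - 1, 1, by lia⟩

-- Strong induction on the weight: subtract the multiple of E₄^a E₆^b with the same constant term
-- and divide the resulting cusp form by Δ, which lowers the weight by 12. Below weight 12 the
-- quotient has negative weight and vanishes.
open ModularForm in
theorem pullback_modularForm_mem (n : ℕ) (f : ModularForm 𝒮ℒ n) :
    pullback f ∈ eisensteinAlgebra := by
  induction n using Nat.strong_induction_on with
  | _ n ih =>
  have hzero : ∀ g : UpperHalfPlane → ℂ, g = 0 → pullback g ∈ eisensteinAlgebra := by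
    rintro _ rfl
    rw [map_zero]
    exact zero_mem _
  rcases Nat.even_or_odd n with hn | hn
  swap
  · refine hzero _ ?_
    rw [levelOne_odd_weight_eq_zero (by exact_mod_cast hn) f]
    rfl
  rcases Nat.lt_or_ge n 4 with h4 | h4
  · obtain rfl | rfl : n = 0 ∨ n = 2 := by
      obtain ⟨m, rfl⟩ := hn
      lia
    · obtain ⟨c, hc⟩ := ModularFormClass.levelOne_weight_zero_const f
      rw [hc]
      exact eisensteinAlgebra.algebraMap_mem c
    · refine hzero _ ?_
      have := rank_zero_iff_forall_zero.1 levelOne_weight_two_rank_zero f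
      rw [this]
      rfl
  obtain ⟨a, b, hab⟩ := exists_four_mul_add_six_mul hn h4
  set e : ModularForm 𝒮ℒ n := mcast hab.symm ((E₄.pow a).mul (E₆.pow b)) with he
  have hecoe : (e : UpperHalfPlane → ℂ) = (E₄ : UpperHalfPlane → ℂ) ^ a * (E₆ : UpperHalfPlane → ℂ) ^ b := by
    rw [he, coe_mcast, coe_mul, coe_pow, coe_pow]
  have he0 : (UpperHalfPlane.qExpansion 1 e).coeff 0 = 1 := by
    rw [he, coe_mcast, ModularForm.qExpansion_mul one_pos one_mem_strictPeriods_SL,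
      ModularForm.qExpansion_pow one_pos one_mem_strictPeriods_SL,
      ModularForm.qExpansion_pow one_pos one_mem_strictPeriods_SL]
    simp only [PowerSeries.coeff_zero_eq_constantCoeff, map_mul, map_pow]
    rw [← PowerSeries.coeff_zero_eq_constantCoeff_apply, ← PowerSeries.coeff_zero_eq_constantCoeff_apply,
      EisensteinSeries.E_qExpansion_coeff_zero _ ⟨2, rfl⟩,
      EisensteinSeries.E_qExpansion_coeff_zero _ ⟨3, rfl⟩]
    simp
  set c := (UpperHalfPlane.qExpansion 1 f).coeff 0
  set d : ModularForm 𝒮ℒ n := f - c • e with hd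
  have hcusp : (UpperHalfPlane.qExpansion 1 d).coeff 0 = 0 := by
    rw [hd, FunLike.coe_sub, ModularForm.qExpansion_sub one_pos one_mem_strictPeriods_SL,
      FunLike.coe_smul, ModularForm.qExpansion_smul one_pos one_mem_strictPeriods_SL, map_sub,
      PowerSeries.coeff_smul, he0, smul_eq_mul, mul_one, sub_self]
  set g := CuspForm.discriminantEquiv (toCuspForm d hcusp)
  have hfg : (f : UpperHalfPlane → ℂ) = c • (e : UpperHalfPlane → ℂ) + discriminant * g := by
    rw [discriminant_mul_discriminantEquiv]
    funext τ
    rw [Pi.add_apply, toCuspForm_apply, hd]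
    simp
  have hg : pullback g ∈ eisensteinAlgebra := by
    rcases Nat.lt_or_ge n 12 with h12 | h12
    · exact hzero _ (ModularFormClass.levelOne_neg_weight_eq_zero (k := (n : ℤ) - 12) (by lia) g)
    · have := ih (n - 12) (by lia) (mcast (by push_cast [h12]; rfl) g)
      rwa [coe_mcast] at this
  rw [hfg, map_add, map_smul, map_mul, hecoe, map_mul, map_pow, map_pow]
  exact add_mem (eisensteinAlgebra.smul_mem (mul_mem (pow_mem pullback_E₄_mem a)
    (pow_mem pullback_E₆_mem b)) c) (mul_mem pullback_discriminant_mem hg)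

-- All cusps are equivalent under SL(2, ℤ), so a bound for large Im τ suffices for holomorphy at the
-- cusps. Weights k − N of leading coefficients may be negative; then the form is zero.
open scoped ModularForm in
theorem pullback_mem_of_modular {a : UpperHalfPlane → ℂ} {k : ℤ}
    (hd : DifferentiableOn ℂ (a ∘ UpperHalfPlane.ofComplex) {τ : ℂ | 0 < τ.im})
    (hγ : ∀ (γ : SL(2, ℤ)) τ, a (γ • τ) = UpperHalfPlane.denom γ τ ^ k * a τ)
    (hb : ∃ T C : ℝ, ∀ τ : UpperHalfPlane, T < τ.im → ‖a τ‖ ≤ C) :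
    pullback a ∈ eisensteinAlgebra := by
  have hslash : ∀ γ : SL(2, ℤ), a ∣[k] γ = a := fun γ => by
    funext τ
    rw [ModularForm.SL_slash_apply, hγ, mul_right_comm, zpow_neg,
      mul_inv_cancel₀ (zpow_ne_zero _ (UpperHalfPlane.denom_ne_zero _ _)), one_mul]
  set f : ModularForm 𝒮ℒ k :=
    { toFun := a
      slash_action_eq' := fun _ ⟨γ, hγ⟩ => hγ ▸ hslash γ
      holo' := UpperHalfPlane.mdifferentiable_iff.2 hd
      bdd_at_cusps' := fun {c} hc => by
        rw [Subgroup.IsArithmetic.isCusp_iff_isCusp_SL2Z] at hc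
        rw [OnePoint.isBoundedAt_iff_forall_SL2Z hc]
        intro γ _
        rw [hslash γ, UpperHalfPlane.isBoundedAtImInfty_iff]
        obtain ⟨T, C, h⟩ := hb
        exact ⟨C, T + 1, fun τ hτ => h τ (by linarith)⟩ }
  rcases lt_or_ge k 0 with hk | hk
  · have h0 : a = 0 := ModularFormClass.levelOne_neg_weight_eq_zero hk f
    rw [h0, map_zero]
    exact zero_mem _
  · lift k to ℕ using hk
    exact pullback_modularForm_mem k f

end QuasiJacobi

end

/-! ### Meromorphic Jacobi forms of index zero: induction on the pole order. -/

noncomputable section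

namespace QuasiJacobi
open Complex Filter Topology Metric SummationFilter

/-- `z ^ N * f` is bounded near `z = 0`, uniformly in `τ` near the cusp. -/
def BoundedNearCusp (N : ℕ) (f : ℂ × ℂ → ℂ) : Prop :=
  ∃ T ε C : ℝ, 1 ≤ T ∧ 0 < ε ∧ ε ≤ 1 ∧ ∀ τ z : ℂ, (τ, z) ∈ latticeCompl → T < τ.im → ‖z‖ < ε →
    ‖z ^ N * f (τ, z)‖ ≤ C

theorem norm_nomeRoot (l : ℕ) (τ : ℂ) : ‖nomeRoot l τ‖ = Real.exp (-(2 * Real.pi * τ.im / l)) := by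
  rw [nomeRoot, norm_exp]
  congr 1
  rw [show (2 * Real.pi * I * τ / l : ℂ) = ((2 * Real.pi / l : ℝ) : ℂ) * (I * τ) by
    push_cast; ring, re_ofReal_mul]
  simp
  ring

theorem exists_norm_nomeRoot_lt {l : ℕ} (hl : 0 < l) {ε : ℝ} (hε : 0 < ε) :
    ∃ T : ℝ, 1 ≤ T ∧ ∀ τ : ℂ, T < τ.im → ‖nomeRoot l τ‖ < ε := by
  have h1 : Tendsto (fun y : ℝ => Real.exp (-(2 * Real.pi * y / l))) atTop (𝓝 0) := by
    refine Real.tendsto_exp_neg_atTop_nhds_zero.comp ?_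
    have : Tendsto (fun y : ℝ => (2 * Real.pi / l) * y) atTop atTop :=
      tendsto_id.const_mul_atTop (by positivity)
    exact this.congr fun y => by ring
  obtain ⟨T, hT⟩ := eventually_atTop.1 (h1.eventually_lt_const hε)
  exact ⟨max 1 T, le_max_left _ _, fun τ hτ => by
    rw [norm_nomeRoot]
    exact hT _ ((le_max_right _ _).trans hτ.le)⟩

theorem boundedNearCusp_of_expansion {f g : ℂ × ℂ → ℂ} {l N : ℕ} (hl : 0 < l)
    (hg : ContinuousAt g 0) {U : Set (ℂ × ℂ)} (hU : U ∈ 𝓝 0)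
    (h : ∀ τ z : ℂ, (τ, z) ∈ latticeCompl → (nomeRoot l τ, z) ∈ U →
      z ^ N * f (τ, z) = g (nomeRoot l τ, z)) : BoundedNearCusp N f := by
  have h1 : ∀ᶠ x in 𝓝 (0 : ℂ × ℂ), ‖g x‖ < ‖g 0‖ + 1 ∧ x ∈ U :=
    (hg.norm.eventually_lt_const (by simp)).and hU
  obtain ⟨ε, hε, hball⟩ := Metric.eventually_nhds_iff_ball.1 h1
  obtain ⟨T, hT1, hT⟩ := exists_norm_nomeRoot_lt hl hε
  refine ⟨T, min 1 ε, ‖g 0‖ + 1, hT1, by positivity, min_le_left _ _, fun τ z hp hτ hz => ?_⟩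
  have h2 : (nomeRoot l τ, z) ∈ ball (0 : ℂ × ℂ) ε := by
    rw [mem_ball_zero_iff, Prod.norm_def]
    exact max_lt (hT τ hτ) (hz.trans_le (min_le_right _ _))
  obtain ⟨h3, h4⟩ := hball _ h2
  rw [h τ z hp h4]
  exact h3.le

theorem boundedNearCusp_of_hasExpansion {f : ℂ × ℂ → ℂ}
    (h : HasExpansion fun p : latticeCompl => f p) : ∃ N, BoundedNearCusp N f := by
  obtain ⟨l, N, ε, g, hl, hε, hg, h⟩ := h
  refine ⟨N, boundedNearCusp_of_expansion (g := g) hl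
    (hg.continuousOn.continuousAt (ball_mem_nhds 0 hε)) (ball_mem_nhds 0 hε) fun τ z hp hpU => ?_⟩
  rw [mem_ball_zero_iff, Prod.norm_def, max_lt_iff] at hpU
  exact h ⟨(τ, z), hp⟩ hpU.1 hpU.2

theorem HasNormalizedExpansion.boundedNearCusp {N : ℕ} {F : ℂ × ℂ → ℂ}
    (h : HasNormalizedExpansion N F) : BoundedNearCusp N F := by
  obtain ⟨g, hg, -, hgF⟩ := h
  have h0 := isOpen_nomeDomain.mem_nhds (mem_nomeDomain_of_norm_lt_one (q := 0) (by simp))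
  refine boundedNearCusp_of_expansion (l := 1) one_pos (hg.continuousOn.continuousAt h0) h0
    fun τ z hp hU => ?_
  rw [nomeRoot_one] at hU ⊢
  exact hgF _ hp hU

theorem boundedNearCusp_of_fst {a : ℂ → ℂ} {T C : ℝ} (h : ∀ τ : ℂ, 0 < τ.im → T < τ.im → ‖a τ‖ ≤ C) :
    BoundedNearCusp 0 fun p => a p.1 :=
  ⟨max 1 T, 1, C, le_max_left _ _, one_pos, le_rfl, fun τ z hp hτ _ => by
    simpa using h τ hp.1 ((le_max_right _ _).trans_lt hτ)⟩

theorem BoundedNearCusp.mul {N M : ℕ} {f g : ℂ × ℂ → ℂ} (hf : BoundedNearCusp N f)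
    (hg : BoundedNearCusp M g) : BoundedNearCusp (N + M) fun p => f p * g p := by
  obtain ⟨T, ε, C, hT, hε, hε1, hf⟩ := hf
  obtain ⟨S, δ, D, hS, hδ, hδ1, hg⟩ := hg
  refine ⟨max T S, min ε δ, C * D, le_max_of_le_left hT, by positivity, min_le_of_left_le hε1,
    fun τ z hp hτ hz => ?_⟩
  have h1 := hf τ z hp ((le_max_left _ _).trans_lt hτ) (hz.trans_le (min_le_left _ _))
  have h2 := hg τ z hp ((le_max_right _ _).trans_lt hτ) (hz.trans_le (min_le_right _ _))
  rw [pow_add, mul_mul_mul_comm, norm_mul]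
  exact mul_le_mul h1 h2 (norm_nonneg _) ((norm_nonneg _).trans h1)

theorem BoundedNearCusp.sub {N : ℕ} {f g : ℂ × ℂ → ℂ} (hf : BoundedNearCusp N f)
    (hg : BoundedNearCusp N g) : BoundedNearCusp N fun p => f p - g p := by
  obtain ⟨T, ε, C, hT, hε, hε1, hf⟩ := hf
  obtain ⟨S, δ, D, hS, hδ, hδ1, hg⟩ := hg
  refine ⟨max T S, min ε δ, C + D, le_max_of_le_left hT, by positivity, min_le_of_left_le hε1,
    fun τ z hp hτ hz => ?_⟩
  have h1 := hf τ z hp ((le_max_left _ _).trans_lt hτ) (hz.trans_le (min_le_left _ _))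
  have h2 := hg τ z hp ((le_max_right _ _).trans_lt hτ) (hz.trans_le (min_le_right _ _))
  rw [mul_sub]
  exact (norm_sub_le _ _).trans (add_le_add h1 h2)

theorem BoundedNearCusp.mono {N M : ℕ} {f : ℂ × ℂ → ℂ} (hf : BoundedNearCusp N f) (h : N ≤ M) :
    BoundedNearCusp M f := by
  obtain ⟨T, ε, C, hT, hε, hε1, hf⟩ := hf
  refine ⟨T, ε, C, hT, hε, hε1, fun τ z hp hτ hz => ?_⟩
  obtain ⟨m, rfl⟩ := Nat.exists_eq_add_of_le' h
  rw [pow_add, mul_assoc, norm_mul, norm_pow]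
  exact (mul_le_of_le_one_left (norm_nonneg _)
    (pow_le_one₀ (norm_nonneg z) (hz.le.trans hε1))).trans (hf τ z hp hτ hz)

/-- The Schwarz lemma on a punctured disc. -/
theorem norm_le_of_tendsto_zero {u : ℂ → ℂ} {ε C : ℝ}
    (hd : ∀ z, z ≠ 0 → ‖z‖ < ε → DifferentiableAt ℂ u z) (hu : Tendsto u (𝓝[≠] 0) (𝓝 0))
    (hC : ∀ z, z ≠ 0 → ‖z‖ < ε → ‖u z‖ ≤ C) {z : ℂ} (hz0 : z ≠ 0) (hz : ‖z‖ < ε) :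
    ‖u z‖ ≤ C / ε * ‖z‖ := by
  set v := Function.update u 0 0 with hv
  have hv0 : v 0 = 0 := by simp [hv]
  have hve : ∀ z, z ≠ 0 → v z = u z := fun z hz => by simp [hv, hz]
  have hC0 : 0 ≤ C := (norm_nonneg _).trans (hC z hz0 hz)
  have hvd : DifferentiableOn ℂ v (ball 0 ε) := by
    refine (differentiableOn_compl_singleton_and_continuousAt_iff
      (isOpen_ball.mem_nhds (mem_ball_self ((norm_nonneg z).trans_lt hz)))).1 ⟨fun w hw => ?_, ?_⟩
    · have hw0 : w ≠ 0 := hw.2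
      refine ((hd w hw0 (by simpa using hw.1)).congr_of_eventuallyEq ?_).differentiableWithinAt
      filter_upwards [isOpen_ne.mem_nhds hw0] with x hx using hve x hx
    · rwa [hv, continuousAt_update_same]
  have h1 := Complex.dist_le_div_mul_dist_of_mapsTo_ball (c := 0) (R₁ := ε) (R₂ := C) hvd
    (fun w hw => ?_) (mem_ball_zero_iff.2 hz)
  · simpa [hv0, hve z hz0] using h1
  · rw [hv0, mem_closedBall_zero_iff]
    by_cases hw0 : w = 0
    · simpa [hw0, hv0] using hC0
    · rw [hve w hw0]
      exact hC w hw0 (mem_ball_zero_iff.1 hw)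

/-- Schwarz's lemma on each slice: once the leading coefficient vanishes, one factor z can be
divided out at the cost of 1/ε, uniformly in τ. -/
theorem BoundedNearCusp.of_tendsto_zero {N : ℕ} {f : ℂ × ℂ → ℂ} (hf : BoundedNearCusp (N + 1) f)
    (hd : DifferentiableOn ℂ f latticeCompl)
    (h0 : ∀ τ : ℂ, 0 < τ.im → Tendsto (fun z => z ^ (N + 1) * f (τ, z)) (𝓝[≠] 0) (𝓝 0)) :
    BoundedNearCusp N f := by
  obtain ⟨T, ε, C, hT, hε, hε1, hf⟩ := hf
  refine ⟨T, ε, C / ε, hT, hε, hε1, fun τ z hp hτ hz => ?_⟩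
  have hz0 : z ≠ 0 := by simpa using hp.2 0 0
  -- Here the normalizations T ≥ 1 and ε ≤ 1 in `BoundedNearCusp` are used: the punctured disc
  -- contains no lattice point.
  have hmem : ∀ w, w ≠ 0 → ‖w‖ < ε → (τ, w) ∈ latticeCompl := fun w hw0 hw =>
    mem_latticeCompl_of_norm_lt one_pos (hT.trans_lt hτ) hw0 (by rw [min_self]; exact hw.trans_le hε1)
  have h1 := norm_le_of_tendsto_zero (u := fun w => w ^ (N + 1) * f (τ, w))
    (fun w hw0 hw => ?_) (h0 τ hp.1) (fun w hw0 hw => hf τ w (hmem w hw0 hw) hτ hw) hz0 hz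
  · rw [pow_succ', mul_assoc, norm_mul, mul_comm] at h1
    exact le_of_mul_le_mul_right h1 (norm_pos_iff.2 hz0)
  · have h2 : DifferentiableAt ℂ f (τ, w) :=
      hd.differentiableAt (isOpen_latticeCompl.mem_nhds (hmem w hw0 hw))
    exact DifferentiableAt.fun_mul (by fun_prop) (hasDerivAt_zDeriv h2).differentiableAt

theorem coe_smul_eq_mobius (γ : SL(2, ℤ)) (τ : UpperHalfPlane) :
    ((γ • τ : UpperHalfPlane) : ℂ) = mobius γ τ := by
  rw [UpperHalfPlane.specialLinearGroup_apply]
  simp [mobius, autFactor]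

theorem denom_eq_autFactor (γ : SL(2, ℤ)) (τ : UpperHalfPlane) :
    UpperHalfPlane.denom γ τ = autFactor γ τ := by
  simp [UpperHalfPlane.denom, autFactor]

/-- The leading Laurent coefficient at `z = 0` of a Jacobi form is a modular form. -/
theorem leadingCoefficient_mobius {f : ℂ × ℂ → ℂ} {k : ℤ} {N : ℕ}
    (hf : JacobiEquations k fun p => f p) {a : ℂ → ℂ}
    (ha : ∀ τ : ℂ, 0 < τ.im → Tendsto (fun z => z ^ N * f (τ, z)) (𝓝[≠] 0) (𝓝 (a τ)))
    (γ : SL(2, ℤ)) {τ : ℂ} (hτ : 0 < τ.im) :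
    a (mobius γ τ) = autFactor γ τ ^ (k - N) * a τ := by
  have hj := autFactor_ne_zero γ hτ
  have hγτ : 0 < (mobius γ τ).im := by
    have := (γ • (⟨τ, hτ⟩ : UpperHalfPlane)).im_pos
    rwa [← UpperHalfPlane.coe_im, coe_smul_eq_mobius] at this
  have h1 := (ha _ hγτ).comp (tendsto_div_const_punctured hj)
  have h2 := (ha τ hτ).const_mul (autFactor γ τ ^ (k - N))
  refine tendsto_nhds_unique (h1.congr' ?_) h2
  filter_upwards [eventually_mem_slice hτ] with z hz
  have h3 : f (mobius γ τ, z / autFactor γ τ) = autFactor γ τ ^ k * f (τ, z) := hf.1 γ ⟨(τ, z), hz⟩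
  rw [Function.comp_apply, h3, zpow_sub₀ hj, zpow_natCast, div_pow]
  field_simp

theorem pullback_leadingCoefficient_mem {f : ℂ × ℂ → ℂ} {k : ℤ} {N : ℕ}
    (hf : JacobiEquations k fun p => f p) {a : ℂ → ℂ}
    (had : DifferentiableOn ℂ a {τ : ℂ | 0 < τ.im})
    (ha : ∀ τ : ℂ, 0 < τ.im → Tendsto (fun z => z ^ N * f (τ, z)) (𝓝[≠] 0) (𝓝 (a τ)))
    {T C : ℝ} (hb : ∀ τ : ℂ, 0 < τ.im → T < τ.im → ‖a τ‖ ≤ C) :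
    (fun p : latticeCompl => a p.1.1) ∈ eisensteinAlgebra := by
  refine pullback_mem_of_modular (a := fun τ : UpperHalfPlane => a τ) (k := k - N) ?_
    (fun γ τ => ?_) ⟨T, C, fun τ hτ => hb τ τ.im_pos hτ⟩
  · refine had.congr fun τ hτ => ?_
    rw [Function.comp_apply, UpperHalfPlane.ofComplex_apply_of_im_pos hτ]
  · rw [coe_smul_eq_mobius, denom_eq_autFactor]
    exact leadingCoefficient_mobius hf ha γ τ.im_pos

/-- For `N ≥ 2` there is a Jacobi form of weight `N` with polar part `z ^ (-N)`. -/
theorem exists_jacobiForm_pole {N : ℕ} (hN : 2 ≤ N) : ∃ e : ℂ × ℂ → ℂ,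
    DifferentiableOn ℂ e latticeCompl ∧ (fun p : latticeCompl => e p) ∈ eisensteinAlgebra ∧
      JacobiEquations N (fun p => e p) ∧ BoundedNearCusp N e ∧
        ∀ τ : ℂ, 0 < τ.im → Tendsto (fun z => z ^ N * e (τ, z)) (𝓝[≠] 0) (𝓝 1) := by
  obtain rfl | ⟨n, rfl⟩ : N = 2 ∨ ∃ n, N = n + 3 := by
    rcases Nat.exists_eq_add_of_le' hN with ⟨m, rfl⟩
    rcases m with _ | m
    · exact .inl rfl
    · exact .inr ⟨m, rfl⟩
  · have hs := differentiableOn_eisensteinTwoSeries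
    -- Order two is the one case needing a correction: E_2 is not modular, E_2 − e_2 = ℘ is. The
    -- nome series provides e_2 as a total function of τ with a bound at the cusp.
    set e₂ : ℂ → ℂ := fun τ => eisensteinTwoSeries (nome τ) with he₂
    have heq : (fun p : latticeCompl => eis 1 p - e₂ p.1.1) = fun p : latticeCompl =>
        eis 1 p - eisensteinTwo p := funext fun p => by rw [eisensteinTwo_eq]
    have hd2 : DifferentiableOn ℂ e₂ {τ : ℂ | 0 < τ.im} := hs.comp
      differentiable_nome.differentiableOn fun τ hτ => mem_ball_zero_iff.2 (norm_nome_lt_one hτ)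
    have hb2 : BoundedNearCusp 0 fun p => e₂ p.1 := by
      refine boundedNearCusp_of_expansion (l := 1) (g := fun x => eisensteinTwoSeries x.1)
        (U := Set.univ) one_pos ?_ univ_mem fun τ z _ _ => ?_
      · exact ContinuousAt.comp (g := eisensteinTwoSeries) (f := Prod.fst)
          (hs.continuousOn.continuousAt (ball_mem_nhds 0 one_pos)) continuousAt_fst
      · rw [nomeRoot_one, pow_zero, one_mul]
    refine ⟨fun p => eis 1 p - e₂ p.1, ?_, ?_, ?_, ?_, fun τ hτ => ?_⟩
    · exact (differentiableOn_eis 1).sub (hd2.comp differentiableOn_fst fun p hp => hp.1)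
    · rw [heq]
      exact sub_mem (eis_mem 1) eisensteinTwo_mem
    · beta_reduce
      rw [heq]
      exact jacobiEquations_eis_one_sub
    · exact (hasNormalizedExpansion_eis 1).boundedNearCusp.sub (hb2.mono zero_le_two)
    · have h1 := tendsto_of_hasNormalizedExpansion (hasNormalizedExpansion_eis 1) hτ
      have h2 : Tendsto (fun z : ℂ => z ^ 2 * e₂ τ) (𝓝[≠] 0) (𝓝 0) := by
        have : Continuous fun z : ℂ => z ^ 2 * e₂ τ := by fun_prop
        simpa using (this.tendsto 0).mono_left (nhdsWithin_le_nhds (s := {0}ᶜ))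
      have h3 := h1.sub h2
      rw [sub_zero] at h3
      exact h3.congr fun z => by ring
  · exact ⟨eis (n + 2), differentiableOn_eis _, eis_mem _,
      by exact_mod_cast jacobiEquations_eis_add_two n,
      (hasNormalizedExpansion_eis (n + 2)).boundedNearCusp,
      fun τ hτ => tendsto_of_hasNormalizedExpansion (hasNormalizedExpansion_eis (n + 2)) hτ⟩

theorem exists_leadingCoefficient {N : ℕ} {f : ℂ × ℂ → ℂ}
    (hd : DifferentiableOn ℂ f latticeCompl) (hb : BoundedNearCusp N f) :
    ∃ (a : ℂ → ℂ) (T C : ℝ), DifferentiableOn ℂ a {τ : ℂ | 0 < τ.im} ∧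
      (∀ τ : ℂ, 0 < τ.im → Tendsto (fun z => z ^ N * f (τ, z)) (𝓝[≠] 0) (𝓝 (a τ))) ∧
      ∀ τ : ℂ, 0 < τ.im → T < τ.im → ‖a τ‖ ≤ C := by
  obtain ⟨T, ε, C, hT, hε, hε1, hb⟩ := hb
  have hev : ∀ τ : ℂ, 0 < τ.im → T < τ.im → ∀ᶠ z in 𝓝[≠] (0 : ℂ), ‖z ^ N * f (τ, z)‖ ≤ C := by
    intro τ hτ hTτ
    filter_upwards [eventually_mem_slice hτ, mem_nhdsWithin_of_mem_nhds (ball_mem_nhds 0 hε)]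
      with z hz hzε using hb τ z hz hTτ (mem_ball_zero_iff.1 hzε)
  obtain ⟨a, had, ha⟩ := exists_leading_coefficient (T := T) hd N fun τ hτ hTτ =>
    ⟨C, eventually_map.2 (hev τ hτ hTτ)⟩
  exact ⟨a, T, C, had, ha, fun τ hτ hTτ => le_of_tendsto (ha τ hτ).norm (hev τ hτ hTτ)⟩

theorem JacobiEquations.apply_add {f : ℂ × ℂ → ℂ} {k : ℤ} (hf : JacobiEquations k fun p => f p)
    {τ z : ℂ} (h : (τ, z) ∈ latticeCompl) : f (τ, z + 1) = f (τ, z) ∧ f (τ, z + τ) = f (τ, z) := by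
  have h1 := hf.2 0 1 ⟨(τ, z), h⟩
  have h2 := hf.2 1 0 ⟨(τ, z), h⟩
  simp only [translate] at h1 h2
  constructor
  · simpa using h1
  · simpa using h2

theorem differentiableAt_slice {f : ℂ × ℂ → ℂ} (hd : DifferentiableOn ℂ f latticeCompl) {τ z : ℂ}
    (h : (τ, z) ∈ latticeCompl) : DifferentiableAt ℂ (fun w => f (τ, w)) z :=
  (hasDerivAt_zDeriv (hd.differentiableAt (isOpen_latticeCompl.mem_nhds h))).differentiableAt

/-- A Jacobi form has no simple poles along `z = 0`. -/
theorem leadingCoefficient_eq_zero {f : ℂ × ℂ → ℂ} {k : ℤ}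
    (hd : DifferentiableOn ℂ f latticeCompl) (hf : JacobiEquations k fun p => f p) {τ a : ℂ}
    (hτ : 0 < τ.im) (ha : Tendsto (fun z => z ^ 1 * f (τ, z)) (𝓝[≠] 0) (𝓝 a)) : a = 0 := by
  -- f − aE_1 has period 1, quasi-period 2πia along τ and a bounded singularity at 0, so the
  -- Liouville argument forces 2πia = 0.
  have h1 := tendsto_of_hasNormalizedExpansion hasNormalizedExpansion_eisOne hτ
  have hdd : ∀ z, (τ, z) ∈ latticeCompl →
      DifferentiableAt ℂ (fun z => f (τ, z) - a * eisOne (τ, z)) z := fun z hz =>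
    (differentiableAt_slice hd hz).fun_sub ((differentiableAt_eis_slice 0 hz).const_mul a)
  have h2 : Tendsto (fun z => z * (f (τ, z) - a * eisOne (τ, z))) (𝓝[≠] 0) (𝓝 0) := by
    have := ha.sub (h1.const_mul a)
    rw [mul_one, sub_self] at this
    exact this.congr fun z => by ring
  obtain ⟨B, hB⟩ := isBoundedUnder_sub_div (c := 0) (by
    filter_upwards [eventually_mem_slice hτ] with w hw using differentiableAt_id.fun_mul (hdd w hw)) h2
  obtain ⟨h3, -⟩ := eq_const_of_quasiPeriodic (κ := 2 * Real.pi * I * a) hτ hdd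
    (fun z hz => by rw [(hf.apply_add hz).1, eisOne_add_one])
    (fun z hz => by rw [(hf.apply_add hz).2, eisOne_add_tau hz]; ring) ⟨B, eventually_map.2 (by
      filter_upwards [eventually_map.1 hB, self_mem_nhdsWithin] with z hz hz0
      rwa [sub_zero, mul_div_cancel_left₀ _ hz0] at hz)⟩
  simpa [Real.pi_ne_zero] using h3

/-- Meromorphic Jacobi forms of index zero are polynomials in the functions `E_n` and `e_2`. -/
theorem mem_eisensteinAlgebra_of_jacobiEquations (N : ℕ) {k : ℤ} {f : ℂ × ℂ → ℂ}
    (hd : DifferentiableOn ℂ f latticeCompl) (hf : JacobiEquations k fun p => f p)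
    (hb : BoundedNearCusp N f) : (fun p : latticeCompl => f p) ∈ eisensteinAlgebra := by
  induction N generalizing f with
  | zero =>
    -- Each slice is an elliptic function without poles, hence constant in z and equal to its limit
    -- a(τ), a modular form of weight k.
    obtain ⟨a, T, C, had, ha, haC⟩ := exists_leadingCoefficient hd hb
    convert pullback_leadingCoefficient_mem hf had ha haC using 1
    funext ⟨⟨τ, z⟩, h⟩
    obtain ⟨-, c, hc⟩ := eq_const_of_quasiPeriodic (κ := 0) h.1
      (fun z hz => differentiableAt_slice hd hz) (fun z hz => (hf.apply_add hz).1)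
      (fun z hz => by rw [(hf.apply_add hz).2, add_zero])
      (by simpa using (ha τ h.1).norm.isBoundedUnder_le)
    have h1 : Tendsto (fun _ : ℂ => c) (𝓝[≠] (0 : ℂ)) (𝓝 (a τ)) := by
      refine (ha τ h.1).congr' ?_
      filter_upwards [eventually_mem_slice h.1] with z hz
      rw [pow_zero, one_mul, hc z hz]
    change f (τ, z) = a τ
    rw [hc z h]
    exact tendsto_nhds_unique tendsto_const_nhds h1
  | succ N ih =>
    obtain ⟨a, T, C, had, ha, haC⟩ := exists_leadingCoefficient hd hb
    rcases N with _ | N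
    · refine ih hd hf (hb.of_tendsto_zero hd fun τ hτ => ?_)
      have h1 := ha τ hτ
      rwa [leadingCoefficient_eq_zero hd hf hτ h1] at h1
    · obtain ⟨e, hed, hemem, heJ, heb, he1⟩ := exists_jacobiForm_pole (N := N + 1 + 1) (by lia)
      have hmem := pullback_leadingCoefficient_mem hf had ha haC
      -- The weights k − (N + 2) of a and N + 2 of e add up to k, so `r` is again a Jacobi form of
      -- weight k, with its pole of order N + 2 removed.
      set r : ℂ × ℂ → ℂ := fun p => f p - a p.1 * e p with hr
      have hrd : DifferentiableOn ℂ r latticeCompl :=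
        hd.sub ((had.comp differentiableOn_fst fun p hp => hp.1).mul hed)
      have hrJ : JacobiEquations k fun p => r p := by
        refine jacobiEquations_iff.2 ⟨fun γ p => ?_, fun m n p => ?_⟩
        · have h1 : f (modularAct γ p) = _ := hf.1 γ p
          have h2 : e (modularAct γ p) = _ := heJ.1 γ p
          have h3 := leadingCoefficient_mobius hf ha γ p.2.1
          have hj := autFactor_ne_zero γ p.2.1
          simp only [hr]
          rw [h1, h2, modularAct_fst, h3]
          change autFactor γ p.1.1 ^ k * f p - _ * (autFactor γ p.1.1 ^ _ * e p) = _
          rw [zpow_sub₀ hj]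
          field_simp
        · have h1 : f (translate m n p) = _ := hf.2 m n p
          have h2 : e (translate m n p) = _ := heJ.2 m n p
          simp only [hr]
          rw [h1, h2]
          rfl
      have hrb : BoundedNearCusp (N + 1 + 1) r := by
        have := (boundedNearCusp_of_fst haC).mul heb
        rw [zero_add] at this
        exact hb.sub this
      have hr0 : ∀ τ : ℂ, 0 < τ.im →
          Tendsto (fun z => z ^ (N + 1 + 1) * r (τ, z)) (𝓝[≠] 0) (𝓝 0) := fun τ hτ => by
        have := (ha τ hτ).sub ((he1 τ hτ).const_mul (a τ))
        rw [mul_one, sub_self] at this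
        exact this.congr fun z => by simp only [hr]; ring
      have h1 := ih hrd hrJ (hrb.of_tendsto_zero hrd hr0)
      convert add_mem h1 (mul_mem hmem hemem) using 1
      funext p
      simp [hr]

end QuasiJacobi

end

/-! ### Algebraic independence of λ and μ over the holomorphic functions. -/

noncomputable section

namespace QuasiJacobi
open Complex Filter Topology Metric SummationFilter

theorem hasDerivAt_line {f : ℂ → ℂ} {f' z e : ℂ} (h : HasDerivAt f f' z) :
    HasDerivAt (fun t : ℝ => f (z + t * e)) (e * f') 0 := by
  have hlin : HasDerivAt (fun t : ℝ => z + t * e) e 0 := by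
    have := ((Complex.ofRealCLM.hasDerivAt (x := (0 : ℝ))).mul_const e).const_add z
    simpa using this
  have h2 : HasDerivAt f f' (z + (0 : ℝ) * e) := by simpa using h
  exact h2.scomp (0 : ℝ) hlin

/-- Holomorphic functions are linearly independent over the powers of a function `w` with
nowhere vanishing `∂w / ∂z̄`. -/
theorem coeff_eq_zero_of_sum_mul_pow_eq_zero {U : Set ℂ} (hU : IsOpen U) {w wx wy : ℂ → ℂ}
    (hx : ∀ z ∈ U, HasDerivAt (fun t : ℝ => w (z + t)) (wx z) 0)
    (hy : ∀ z ∈ U, HasDerivAt (fun t : ℝ => w (z + t * I)) (wy z) 0)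
    (hne : ∀ z ∈ U, wx z + I * wy z ≠ 0) (n : ℕ) {c : ℕ → ℂ → ℂ}
    (hc : ∀ i, DifferentiableOn ℂ (c i) U)
    (h : ∀ z ∈ U, ∑ i ∈ Finset.range n, c i z * w z ^ i = 0) :
    ∀ i < n, ∀ z ∈ U, c i z = 0 := by
  induction n generalizing c with
  | zero => simp
  | succ n ih =>
    -- Differentiate the relation along 1 and along I. The combination ∂x + i∂y annihilates the
    -- coefficients, and after dividing by the nonvanishing factor a relation with coefficients (i +
    -- 1)c_(i+1) and one power of w fewer remains.
    have hderiv : ∀ z ∈ U, ∀ (e d : ℂ), HasDerivAt (fun t : ℝ => w (z + t * e)) d 0 →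
        ∑ i ∈ Finset.range (n + 1), (e * deriv (c i) z * w z ^ i +
          c i z * (i * w z ^ (i - 1) * d)) = 0 := by
      intro z hz e d hd
      have h1 : ∀ i, HasDerivAt (fun t : ℝ => c i (z + t * e) * w (z + t * e) ^ i)
          (e * deriv (c i) z * w z ^ i + c i z * (i * w z ^ (i - 1) * d)) 0 := by
        intro i
        have h2 := hasDerivAt_line (e := e) ((hc i).differentiableAt (hU.mem_nhds hz)).hasDerivAt
        have h3 := h2.fun_mul (hd.fun_pow i)
        simpa using h3
      have h2 := HasDerivAt.fun_sum fun i (_ : i ∈ Finset.range (n + 1)) => h1 i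
      refine h2.unique ((hasDerivAt_const (0 : ℝ) (0 : ℂ)).congr_of_eventuallyEq ?_)
      have h3 : Tendsto (fun t : ℝ => z + t * e) (𝓝 0) (𝓝 z) := by
        have : Continuous fun t : ℝ => z + t * e := by fun_prop
        simpa using this.tendsto 0
      filter_upwards [h3.eventually_mem (hU.mem_nhds hz)] with t ht using h _ ht
    have hsucc : ∀ i < n, ∀ z ∈ U, ((i : ℂ) + 1) * c (i + 1) z = 0 := by
      refine ih (c := fun i z => ((i : ℂ) + 1) * c (i + 1) z) (fun i => (hc (i + 1)).const_mul _)
        fun z hz => ?_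
      have h1 := hderiv z hz 1 (wx z) (by simpa using hx z hz)
      have h2 := hderiv z hz I (wy z) (hy z hz)
      have h3 : (∑ i ∈ Finset.range (n + 1), c i z * (i * w z ^ (i - 1))) *
          (wx z + I * wy z) = 0 := by
        have h4 := congrArg₂ (fun x y => x + I * y) h1 h2
        simp only [mul_zero, add_zero] at h4
        rw [← h4, Finset.mul_sum, Finset.sum_mul, ← Finset.sum_add_distrib]
        refine Finset.sum_congr rfl fun i _ => ?_
        linear_combination -(deriv (c i) z * w z ^ i) * I_sq
      have h4 := (mul_eq_zero.1 h3).resolve_right (hne z hz)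
      rw [Finset.sum_range_succ'] at h4
      simp only [Nat.cast_zero, zero_mul, mul_zero, add_zero, Nat.add_sub_cancel] at h4
      rw [← h4]
      refine Finset.sum_congr rfl fun i _ => ?_
      push_cast
      ring
    have hpos : ∀ i < n, ∀ z ∈ U, c (i + 1) z = 0 := fun i hi z hz =>
      (mul_eq_zero.1 (hsucc i hi z hz)).resolve_left (Nat.cast_add_one_ne_zero i)
    intro i hi z hz
    rcases i with _ | i
    · have h1 := h z hz
      rw [Finset.sum_range_succ', Finset.sum_eq_zero fun i hi => by
        rw [hpos i (Finset.mem_range.1 hi) z hz, zero_mul]] at h1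
      simpa using h1
    · exact hpos i (by lia) z hz

theorem mu_eq (p : latticeCompl) : mu p = -(I / 2) * (p.1.1.im : ℂ)⁻¹ := by
  rw [mu, sub_conj]
  have : (p.1.1.im : ℂ) ≠ 0 := by exact_mod_cast p.2.1.ne'
  push_cast
  field_simp
  simp

theorem lam_eq (p : latticeCompl) : lam p = p.1.2.im * (p.1.1.im : ℂ)⁻¹ := by
  rw [lam, sub_conj, sub_conj]
  have : (p.1.1.im : ℂ) ≠ 0 := by exact_mod_cast p.2.1.ne'
  push_cast
  field_simp

/-- The functions `λ + A` and `μ + B` are algebraically independent over the holomorphic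
functions. -/
theorem eq_zero_of_sum_lam_mu_eq_zero {A B : ℂ × ℂ → ℂ} (hA : DifferentiableOn ℂ A latticeCompl)
    (hB : DifferentiableOn ℂ B latticeCompl) {h : ℕ → ℕ → latticeCompl → ℂ}
    (hh : ∀ i j, Holomorphic (h i j)) (s t : ℕ)
    (hsum : ∀ p : latticeCompl, ∑ i ∈ Finset.range s, ∑ j ∈ Finset.range t,
      h i j p * (lam p + A p) ^ i * (mu p + B p) ^ j = 0) :
    ∀ i < s, ∀ j < t, h i j = 0 := by
  choose H hH hhH using hh
  have hslice : ∀ {F : ℂ × ℂ → ℂ}, DifferentiableOn ℂ F latticeCompl → ∀ τ : ℂ,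
      DifferentiableOn ℂ (fun z => F (τ, z)) {z | (τ, z) ∈ latticeCompl} := fun hF τ z hz =>
    (differentiableAt_slice hF hz).differentiableWithinAt
  -- For fixed τ, μ is constant in z while (∂x + i∂y)λ = i/Im τ ≠ 0, so the powers of λ + A separate
  -- first.
  have step1 : ∀ i < s, ∀ p : latticeCompl,
      ∑ j ∈ Finset.range t, H i j p * (mu p + B p) ^ j = 0 := by
    rintro i hi ⟨⟨τ, z⟩, hp⟩
    have hτ := hp.1
    have hτ0 : (τ.im : ℂ) ≠ 0 := by exact_mod_cast hτ.ne'
    have hAd : ∀ w, (τ, w) ∈ latticeCompl →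
        HasDerivAt (fun z => A (τ, z)) (deriv (fun z => A (τ, z)) w) w := fun w hw =>
      (differentiableAt_slice hA hw).hasDerivAt
    have key := coeff_eq_zero_of_sum_mul_pow_eq_zero (isOpen_slice τ)
      (w := fun z => z.im * (τ.im : ℂ)⁻¹ + A (τ, z)) (wx := fun z => deriv (fun z => A (τ, z)) z)
      (wy := fun z => (τ.im : ℂ)⁻¹ + I * deriv (fun z => A (τ, z)) z) (fun w hw => ?_)
      (fun w hw => ?_) (fun w hw => ?_) s
      (c := fun i z => ∑ j ∈ Finset.range t, H i j (τ, z) * (-(I / 2) * (τ.im : ℂ)⁻¹ + B (τ, z)) ^ j)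
      (fun i => ?_) (fun w hw => ?_) i hi z hp
    · rw [← key]
      exact Finset.sum_congr rfl fun j _ => by rw [mu_eq]
    · have := (hasDerivAt_line (e := 1) (hAd w hw)).const_add (w.im * (τ.im : ℂ)⁻¹)
      simpa using this
    · have h1 := hasDerivAt_line (e := I) (hAd w hw)
      have h2 : HasDerivAt (fun t : ℝ => ((w + t * I).im : ℂ) * (τ.im : ℂ)⁻¹) (τ.im : ℂ)⁻¹ 0 := by
        have := ((Complex.ofRealCLM.hasDerivAt (x := (0 : ℝ))).const_add (w.im : ℂ)).mul_const
          (τ.im : ℂ)⁻¹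
        simpa using this
      exact h2.add h1
    · have : deriv (fun z => A (τ, z)) w + I * ((τ.im : ℂ)⁻¹ + I * deriv (fun z => A (τ, z)) w) =
          I * (τ.im : ℂ)⁻¹ := by
        linear_combination deriv (fun z => A (τ, z)) w * I_sq
      rw [this]
      exact mul_ne_zero I_ne_zero (inv_ne_zero hτ0)
    · exact DifferentiableOn.fun_sum fun j _ =>
        (hslice (hH i j) τ).mul (((hslice hB τ).const_add _).pow j)
    · rw [← hsum ⟨(τ, w), hw⟩]
      refine Finset.sum_congr rfl fun i _ => ?_
      rw [Finset.sum_mul]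
      refine Finset.sum_congr rfl fun j _ => ?_
      rw [lam_eq, mu_eq, hhH]
      ring
  intro i hi j hj
  funext ⟨⟨τ, z⟩, hp⟩
  have hopen : IsOpen {τ : ℂ | (τ, z) ∈ latticeCompl} :=
    isOpen_latticeCompl.preimage (by fun_prop : Continuous fun τ : ℂ => (τ, z))
  have hslice' : ∀ {F : ℂ × ℂ → ℂ}, DifferentiableOn ℂ F latticeCompl → ∀ τ : ℂ,
      (τ, z) ∈ latticeCompl → DifferentiableAt ℂ (fun τ => F (τ, z)) τ := fun hF τ hτ =>
    DifferentiableAt.comp (f := fun τ : ℂ => (τ, z)) τ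
      (hF.differentiableAt (isOpen_latticeCompl.mem_nhds hτ)) (by fun_prop)
  -- Now z is fixed and τ varies: (∂x + i∂y)μ = −1/(2(Im τ)²) ≠ 0 separates the powers of μ + B.
  have key := coeff_eq_zero_of_sum_mul_pow_eq_zero hopen
    (w := fun τ => -(I / 2) * (τ.im : ℂ)⁻¹ + B (τ, z)) (wx := fun τ => deriv (fun τ => B (τ, z)) τ)
    (wy := fun τ => -(I / 2) * -((τ.im : ℂ) ^ 2)⁻¹ + I * deriv (fun τ => B (τ, z)) τ) (fun w hw => ?_)
    (fun w hw => ?_) (fun w hw => ?_) t (c := fun j τ => H i j (τ, z))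
    (fun j w hw => (hslice' (hH i j) w hw).differentiableWithinAt) (fun w hw => ?_) j hj τ hp
  · rw [hhH]
    exact key
  · have := (hasDerivAt_line (e := 1) (hslice' hB w hw).hasDerivAt).const_add (-(I / 2) * (w.im : ℂ)⁻¹)
    simpa using this
  · have hw0 : (w.im : ℂ) ≠ 0 := by exact_mod_cast hw.1.ne'
    have h1 := hasDerivAt_line (e := I) (hslice' hB w hw).hasDerivAt
    have h2 : HasDerivAt (fun t : ℝ => -(I / 2) * ((w + t * I).im : ℂ)⁻¹)
        (-(I / 2) * -((w.im : ℂ) ^ 2)⁻¹) 0 := by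
      have h3 := (Complex.ofRealCLM.hasDerivAt (x := (0 : ℝ))).const_add (w.im : ℂ)
      have h4 := (h3.fun_inv (by simpa using hw0)).const_mul (-(I / 2))
      simpa [neg_div] using h4
    exact h2.add h1
  · have hw0 : (w.im : ℂ) ≠ 0 := by exact_mod_cast hw.1.ne'
    have : deriv (fun τ => B (τ, z)) w + I * (-(I / 2) * -((w.im : ℂ) ^ 2)⁻¹ +
        I * deriv (fun τ => B (τ, z)) w) = -(2⁻¹ * ((w.im : ℂ) ^ 2)⁻¹) := by
      linear_combination (deriv (fun τ => B (τ, z)) w + 2⁻¹ * ((w.im : ℂ) ^ 2)⁻¹) * I_sq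
    rw [this]
    exact neg_ne_zero.2 (mul_ne_zero (by norm_num) (inv_ne_zero (pow_ne_zero 2 hw0)))
  · rw [← step1 i hi ⟨(w, z), hw⟩]
    exact Finset.sum_congr rfl fun j _ => by rw [mu_eq]

end QuasiJacobi

end

/-! ### Polynomials in λ and μ with admissible coefficients; the two inclusions. -/

noncomputable section

namespace QuasiJacobi
open Complex Filter Topology Metric SummationFilter Polynomial

/-- Evaluation of a polynomial in two variables with admissible coefficients. -/
def evalPoly (x y : latticeCompl → ℂ) : coefficients[X][X] →+* (latticeCompl → ℂ) :=
  eval₂RingHom (eval₂RingHom (algebraMap coefficients (latticeCompl → ℂ)) x) y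

/-- The constant term of a polynomial in two variables, as a function. -/
def constTerm (P : coefficients[X][X]) : latticeCompl → ℂ := (P.coeff 0).coeff 0

/-- As evaluation at (0, 0), the constant term is a ring homomorphism; closure of quasi-Jacobi forms
under products rests on this. -/
theorem constTerm_eq_evalPoly (P : coefficients[X][X]) : constTerm P = evalPoly 0 0 P := by
  rw [evalPoly, coe_eval₂RingHom, eval₂_at_zero, coe_eval₂RingHom, eval₂_at_zero]
  rfl

theorem isCoefficient_coeff (P : coefficients[X][X]) (i j : ℕ) :
    IsCoefficient ((P.coeff j).coeff i : latticeCompl → ℂ) := ((P.coeff j).coeff i).2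

theorem exists_evalPoly_eq_sum (P : coefficients[X][X]) : ∃ s t : ℕ, ∀ x y : latticeCompl → ℂ,
    evalPoly x y P = ∑ i ∈ Finset.range (s + 1), ∑ j ∈ Finset.range (t + 1),
      ((P.coeff j).coeff i : latticeCompl → ℂ) * x ^ i * y ^ j := by
  refine ⟨(Finset.range (P.natDegree + 1)).sup fun j => (P.coeff j).natDegree, P.natDegree,
    fun x y => ?_⟩
  rw [Finset.sum_comm, evalPoly, coe_eval₂RingHom, eval₂_eq_sum_range]
  refine Finset.sum_congr rfl fun j hj => ?_
  have := Finset.le_sup (f := fun j => (P.coeff j).natDegree) hj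
  rw [coe_eval₂RingHom, eval₂_eq_sum_range' _ (Nat.lt_succ_of_le this), Finset.sum_mul]
  rfl

theorem exists_isQuasiJacobi_of_polynomial {k : ℤ} {P : coefficients[X][X]}
    (h : JacobiEquations k (evalPoly lam mu P)) : ∃ s t, IsQuasiJacobi k s t (constTerm P) := by
  obtain ⟨s, t, hP⟩ := exists_evalPoly_eq_sum P
  refine ⟨s, t, fun i j => (P.coeff j).coeff i, ⟨fun i j => isCoefficient_coeff P i j, ?_⟩, rfl⟩
  convert h using 1
  rw [hP]
  funext p
  simp [polyLamMu, Finset.sum_apply]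

theorem IsQuasiJacobi.exists_polynomial {k : ℤ} {s t : ℕ} {f₀ : latticeCompl → ℂ}
    (h : IsQuasiJacobi k s t f₀) : ∃ P : coefficients[X][X],
      JacobiEquations k (evalPoly lam mu P) ∧ constTerm P = f₀ := by
  obtain ⟨f, ⟨hf, hJ⟩, rfl⟩ := h
  refine ⟨∑ i ∈ Finset.range (s + 1), ∑ j ∈ Finset.range (t + 1),
    monomial j (monomial i ⟨f i j, hf i j⟩), ?_, ?_⟩
  · convert hJ using 1
    funext p
    simp only [map_sum, evalPoly, coe_eval₂RingHom, eval₂_monomial, Finset.sum_apply, Pi.mul_apply,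
      Pi.pow_apply, polyLamMu]
    rfl
  · simp only [constTerm_eq_evalPoly, map_sum, evalPoly, coe_eval₂RingHom, eval₂_monomial]
    rw [Finset.sum_eq_single 0 (fun i _ hi => Finset.sum_eq_zero fun j _ => by simp [hi])
      (by simp), Finset.sum_eq_single 0 (fun j _ hj => by simp [hj]) (by simp)]
    simp

theorem JacobiEquations.mul {k l : ℤ} {F G : latticeCompl → ℂ} (hF : JacobiEquations k F)
    (hG : JacobiEquations l G) : JacobiEquations (k + l) (F * G) := by
  refine jacobiEquations_iff.2 ⟨fun γ p => ?_, fun m n p => ?_⟩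
  · have h1 : F (modularAct γ p) = autFactor γ p.1.1 ^ k * F p := hF.1 γ p
    have h2 : G (modularAct γ p) = autFactor γ p.1.1 ^ l * G p := hG.1 γ p
    rw [Pi.mul_apply, Pi.mul_apply, h1, h2, zpow_add₀ (autFactor_ne_zero γ p.2.1)]
    ring
  · rw [Pi.mul_apply, Pi.mul_apply, hF.2, hG.2]

theorem JacobiEquations.const_mul {k : ℤ} {F : latticeCompl → ℂ} (hF : JacobiEquations k F)
    (c : ℂ) : JacobiEquations k fun p => c * F p := by
  refine jacobiEquations_iff.2 ⟨fun γ p => ?_, fun m n p => ?_⟩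
  · have h1 : F (modularAct γ p) = autFactor γ p.1.1 ^ k * F p := hF.1 γ p
    rw [h1]
    ring
  · rw [hF.2]

/-- Quasi-Jacobi forms of all depths, in terms of polynomials. -/
def IsQuasiJacobiPoly (f : latticeCompl → ℂ) : Prop :=
  ∃ (k : ℤ) (P : coefficients[X][X]), JacobiEquations k (evalPoly lam mu P) ∧ constTerm P = f

theorem isQuasiJacobiPoly_iff {f : latticeCompl → ℂ} :
    IsQuasiJacobiPoly f ↔ ∃ (k : ℤ) (s t : ℕ), IsQuasiJacobi k s t f := by
  constructor
  · rintro ⟨k, P, hP, rfl⟩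
    exact ⟨k, exists_isQuasiJacobi_of_polynomial hP⟩
  · rintro ⟨k, s, t, h⟩
    exact ⟨k, h.exists_polynomial⟩

theorem IsQuasiJacobiPoly.mul {f g : latticeCompl → ℂ} (hf : IsQuasiJacobiPoly f)
    (hg : IsQuasiJacobiPoly g) : IsQuasiJacobiPoly (f * g) := by
  obtain ⟨k, P, hP, rfl⟩ := hf
  obtain ⟨l, Q, hQ, rfl⟩ := hg
  refine ⟨k + l, P * Q, ?_, ?_⟩
  · rw [map_mul]
    exact hP.mul hQ
  · simp only [constTerm_eq_evalPoly, map_mul]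

theorem evalPoly_C_C (x y : latticeCompl → ℂ) (f : coefficients) :
    evalPoly x y (C (C f)) = f := by
  simp only [evalPoly, coe_eval₂RingHom, eval₂_C]
  rfl

theorem evalPoly_C_X (x y : latticeCompl → ℂ) : evalPoly x y (C X) = x := by
  simp [evalPoly]

theorem evalPoly_X (x y : latticeCompl → ℂ) : evalPoly x y X = y := by
  simp [evalPoly]

/-- `E_n` as an admissible coefficient. -/
def eisCoeff (n : ℕ) : coefficients := ⟨fun p => eis n p, isCoefficient_eis n⟩

/-- `e_2` as an admissible coefficient. -/
def eisTwoCoeff : coefficients := ⟨eisensteinTwo, isCoefficient_eisensteinTwo⟩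

theorem isQuasiJacobiPoly_one : IsQuasiJacobiPoly 1 :=
  ⟨0, 1, by rw [map_one]; exact jacobiEquations_iff.2 ⟨fun γ p => by simp, fun m n p => rfl⟩,
    by rw [constTerm_eq_evalPoly, map_one]⟩

/-- The completions are E_1 + 2πiλ, then E_2 − 2πiμ = (E_2 − e_2) + (e_2 − 2πiμ), and E_n itself for
n ≥ 3; recall that `eis n` is E_(n+1). -/
theorem isQuasiJacobiPoly_eis (n : ℕ) : IsQuasiJacobiPoly fun p => eis n p := by
  match n with
  | 0 =>
    refine ⟨1, C (C (eisCoeff 0)) + C (C (algebraMap ℂ coefficients (2 * Real.pi * I))) * C X, ?_, ?_⟩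
    · rw [map_add, map_mul, evalPoly_C_C, evalPoly_C_C, evalPoly_C_X]
      exact jacobiEquations_eisOne_add_lam
    · rw [constTerm_eq_evalPoly, map_add, map_mul, evalPoly_C_C, evalPoly_C_C, evalPoly_C_X,
        mul_zero, add_zero]
      rfl
  | 1 =>
    refine ⟨2, C (C (eisCoeff 1)) + C (C (algebraMap ℂ coefficients (-(2 * Real.pi * I)))) * X, ?_, ?_⟩
    · rw [map_add, map_mul, evalPoly_C_C, evalPoly_C_C, evalPoly_X]
      have h0 : ((eisCoeff 1 : latticeCompl → ℂ) +
          (algebraMap ℂ coefficients (-(2 * Real.pi * I)) : latticeCompl → ℂ) * mu) =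
          fun p : latticeCompl => eis 1 p - 2 * Real.pi * I * mu p := _root_.funext fun p => by
        change eis 1 p + -(2 * Real.pi * I) * mu p = eis 1 p - 2 * Real.pi * I * mu p
        ring
      rw [h0]
      have h1 := jacobiEquations_eis_one_sub
      have h2 := jacobiEquations_eisensteinTwo_sub_mu
      refine jacobiEquations_iff.2 ⟨fun γ p => ?_, fun m n p => ?_⟩
      · have h3 := congrArg₂ (· + ·) (h1.1 γ p) (h2.1 γ p)
        simp only [← mul_add, sub_add_sub_cancel] at h3
        exact h3
      · have h3 := congrArg₂ (· + ·) (h1.2 m n p) (h2.2 m n p)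
        simp only [sub_add_sub_cancel] at h3
        exact h3
    · rw [constTerm_eq_evalPoly, map_add, map_mul, evalPoly_C_C, evalPoly_C_C, evalPoly_X,
        mul_zero, add_zero]
      rfl
  | n + 2 =>
    refine ⟨n + 3, C (C (eisCoeff (n + 2))), ?_, ?_⟩
    · rw [evalPoly_C_C]
      exact jacobiEquations_eis_add_two n
    · rw [constTerm_eq_evalPoly, evalPoly_C_C]
      rfl

theorem isQuasiJacobiPoly_eisensteinTwo : IsQuasiJacobiPoly eisensteinTwo := by
  refine ⟨2, C (C eisTwoCoeff) + C (C (algebraMap ℂ coefficients (-(2 * Real.pi * I)))) * X, ?_, ?_⟩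
  · rw [map_add, map_mul, evalPoly_C_C, evalPoly_C_C, evalPoly_X]
    convert jacobiEquations_eisensteinTwo_sub_mu using 1
    funext p
    change eisensteinTwo p + -(2 * Real.pi * I) * mu p = eisensteinTwo p - 2 * Real.pi * I * mu p
    ring
  · rw [constTerm_eq_evalPoly, map_add, map_mul, evalPoly_C_C, evalPoly_C_C, evalPoly_X,
      mul_zero, add_zero]
    rfl

theorem quasiJacobiForms_eq_span :
    quasiJacobiForms = Submodule.span ℂ {f | IsQuasiJacobiPoly f} := by
  simp only [quasiJacobiForms, isQuasiJacobiPoly_iff]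

/-- Products of quasi-Jacobi forms are quasi-Jacobi, with weights adding, so their span is a
subalgebra; it then suffices that it contains the generators. -/
theorem toSubmodule_eisensteinAlgebra_le :
    Subalgebra.toSubmodule eisensteinAlgebra ≤ quasiJacobiForms := by
  rw [quasiJacobiForms_eq_span]
  set V := Submodule.span ℂ {f | IsQuasiJacobiPoly f}
  have hmul : ∀ f g, f ∈ V → g ∈ V → f * g ∈ V := fun f g hf hg => by
    have := Submodule.mul_mem_mul hf hg
    rw [Submodule.span_mul_span] at this
    refine Submodule.span_mono ?_ this
    rintro _ ⟨f, hf, g, hg, rfl⟩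
    exact IsQuasiJacobiPoly.mul hf hg
  have h : eisensteinAlgebra ≤ V.toSubalgebra (Submodule.subset_span isQuasiJacobiPoly_one) hmul := by
    refine Algebra.adjoin_le ?_
    rintro f (⟨n, hn, rfl⟩ | rfl)
    · obtain ⟨n, rfl⟩ := Nat.exists_eq_add_of_le' hn
      refine Submodule.subset_span ?_
      convert isQuasiJacobiPoly_eis n using 1
      exact iff_of_eq (congrArg _ (_root_.funext (twistedEisenstein_eq_eis n)))
    · exact Submodule.subset_span isQuasiJacobiPoly_eisensteinTwo
  exact fun f hf => h hf

/-- The substitution `(X, Y) ↦ (X - a, Y - b)`. -/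
def shift (a b : coefficients) : coefficients[X][X] →+* coefficients[X][X] :=
  eval₂RingHom (eval₂RingHom ((C : coefficients[X] →+* coefficients[X][X]).comp C)
    (C (X + C ((-1 : ℂ) • a)))) (X + C (C ((-1 : ℂ) • b)))

theorem evalPoly_shift (a b : coefficients) (x y : latticeCompl → ℂ) (P : coefficients[X][X]) :
    evalPoly (x + a) (y + b) (shift a b P) = evalPoly x y P := by
  have : (evalPoly (x + a) (y + b)).comp (shift a b) = evalPoly x y := by
    refine Polynomial.ringHom_ext' (Polynomial.ringHom_ext' ?_ ?_) ?_
    · refine RingHom.ext fun f => ?_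
      simp only [shift, RingHom.comp_apply, coe_eval₂RingHom, eval₂_C, evalPoly_C_C]
    · simp only [shift, RingHom.comp_apply, coe_eval₂RingHom, eval₂_C, eval₂_X, map_add,
        evalPoly_C_C, evalPoly_C_X]
      change x + (a : latticeCompl → ℂ) + (-1 : ℂ) • (a : latticeCompl → ℂ) = x
      rw [neg_one_smul, add_neg_cancel_right]
    · simp only [shift, RingHom.comp_apply, coe_eval₂RingHom, eval₂_X, map_add,
        evalPoly_C_C, evalPoly_X]
      change y + (b : latticeCompl → ℂ) + (-1 : ℂ) • (b : latticeCompl → ℂ) = y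
      rw [neg_one_smul, add_neg_cancel_right]
  exact DFunLike.congr_fun this P

theorem Holomorphic.comp_modularAct {f : latticeCompl → ℂ} (hf : Holomorphic f) (γ : SL(2, ℤ)) :
    Holomorphic fun p => f (modularAct γ p) := by
  obtain ⟨F, hF, hfF⟩ := hf
  refine ⟨fun p => F (mobius γ p.1, p.2 / autFactor γ p.1), fun p hp => ?_, fun p => hfF _⟩
  have hj : autFactor γ p.1 ≠ 0 := autFactor_ne_zero γ hp.1
  have h1 := hF.differentiableAt (isOpen_latticeCompl.mem_nhds (mobius_mem γ hp))
  have h3 : DifferentiableAt ℂ (fun p : ℂ × ℂ => autFactor γ p.1) p := by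
    unfold autFactor; fun_prop
  have h4 : DifferentiableAt ℂ (fun p : ℂ × ℂ => (mobius γ p.1, p.2 / autFactor γ p.1)) p := by
    simp only [mobius, div_eq_mul_inv]
    exact (DifferentiableAt.fun_mul (by fun_prop) (h3.fun_inv hj)).prodMk
      (DifferentiableAt.fun_mul (by fun_prop) (h3.fun_inv hj))
  exact (DifferentiableAt.comp (g := F) p h1 h4).differentiableWithinAt

theorem Holomorphic.comp_translate {f : latticeCompl → ℂ} (hf : Holomorphic f) (m n : ℤ) :
    Holomorphic fun p => f (translate m n p) := by
  obtain ⟨F, hF, hfF⟩ := hf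
  exact ⟨fun p => F (p.1, p.2 + m * p.1 + n), hF.comp (by fun_prop) fun p hp => translate_mem m n p hp,
    fun p => hfF _⟩

theorem holomorphic_autFactor_zpow (γ : SL(2, ℤ)) (k : ℤ) :
    Holomorphic fun p => autFactor γ p.1.1 ^ k := by
  refine ⟨fun p => autFactor γ p.1 ^ k, fun p hp => ?_, fun p => rfl⟩
  have h3 : DifferentiableAt ℂ (fun p : ℂ × ℂ => autFactor γ p.1) p := by
    unfold autFactor; fun_prop
  exact (h3.zpow (.inl (autFactor_ne_zero γ hp.1))).differentiableWithinAt

theorem Holomorphic.sub {f g : latticeCompl → ℂ} (hf : Holomorphic f) (hg : Holomorphic g) :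
    Holomorphic fun p => f p - g p := by
  obtain ⟨F, hF, hfF⟩ := hf
  obtain ⟨G, hG, hgG⟩ := hg
  exact ⟨fun p => F p - G p, hF.sub hG, fun p => congrArg₂ _ (hfF p) (hgG p)⟩

/-- `E_1 / (2 π i)`. -/
def lamShift : coefficients := (2 * Real.pi * I : ℂ)⁻¹ • eisCoeff 0

/-- `-e_2 / (2 π i)`. -/
def muShift : coefficients := -((2 * Real.pi * I : ℂ)⁻¹) • eisTwoCoeff

theorem jacobiEquations_lam_add : JacobiEquations 1 (lam + lamShift) := by
  have h := jacobiEquations_eisOne_add_lam.const_mul (2 * Real.pi * I)⁻¹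
  convert h using 1
  funext p
  have : (2 * Real.pi * I : ℂ) ≠ 0 := by simp [Real.pi_ne_zero]
  change lam p + (2 * Real.pi * I : ℂ)⁻¹ * eisOne p = _
  rw [mul_add, inv_mul_cancel_left₀ this, add_comm]

theorem jacobiEquations_mu_add : JacobiEquations 2 (mu + muShift) := by
  have h := jacobiEquations_eisensteinTwo_sub_mu.const_mul (-(2 * Real.pi * I)⁻¹)
  convert h using 1
  funext p
  have : (2 * Real.pi * I : ℂ) ≠ 0 := by simp [Real.pi_ne_zero]
  change mu p + -(2 * Real.pi * I : ℂ)⁻¹ * eisensteinTwo p = _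
  rw [mul_sub, neg_mul _ (2 * Real.pi * I * mu p), inv_mul_cancel_left₀ this]
  ring

/-- λ + `lamShift` and μ + `muShift` are Jacobi of weights 1 and 2, so each functional equation of
the sum becomes a polynomial relation in them with holomorphic coefficients. By algebraic
independence it holds coefficient by coefficient. -/
theorem jacobiEquations_coeff {k : ℤ} {g : ℕ → ℕ → latticeCompl → ℂ}
    (hg : ∀ i j, Holomorphic (g i j)) {s t : ℕ}
    (h : JacobiEquations k (∑ i ∈ Finset.range (s + 1), ∑ j ∈ Finset.range (t + 1),
      g i j * (lam + lamShift) ^ i * (mu + muShift) ^ j)) :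
    ∀ i < s + 1, ∀ j < t + 1, JacobiEquations (k - i - 2 * j) (g i j) := by
  obtain ⟨A, hA, hAe⟩ := lamShift.2.holomorphic
  obtain ⟨B, hB, hBe⟩ := muShift.2.holomorphic
  have hα := jacobiEquations_lam_add
  have hβ := jacobiEquations_mu_add
  intro i hi j hj
  refine jacobiEquations_iff.2 ⟨fun γ p => ?_, fun m n p => ?_⟩
  · have h1 := eq_zero_of_sum_lam_mu_eq_zero hA hB (h := fun i j p =>
      autFactor γ p.1.1 ^ ((i : ℤ) + 2 * j) * g i j (modularAct γ p) -
        autFactor γ p.1.1 ^ k * g i j p)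
      (fun i j => ((holomorphic_autFactor_zpow γ _).mul ((hg i j).comp_modularAct γ)).sub
        ((holomorphic_autFactor_zpow γ k).mul (hg i j))) (s + 1) (t + 1) (fun p => ?_) i hi j hj
    · have h2 := congrFun h1 p
      have hj0 := autFactor_ne_zero γ p.2.1
      simp only [Pi.zero_apply, sub_eq_zero] at h2
      rw [sub_sub, zpow_sub₀ hj0, div_mul_eq_mul_div, eq_div_iff (zpow_ne_zero _ hj0), ← h2,
        mul_comm]
    · have h2 := h.1 γ p
      change _ = autFactor γ p.1.1 ^ k * _ at h2
      simp only [Finset.sum_apply, Pi.mul_apply, Pi.pow_apply] at h2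
      rw [← sub_eq_zero, Finset.mul_sum, ← Finset.sum_sub_distrib] at h2
      rw [← h2]
      refine Finset.sum_congr rfl fun i _ => ?_
      rw [Finset.mul_sum, ← Finset.sum_sub_distrib]
      refine Finset.sum_congr rfl fun j _ => ?_
      have h3 : (lam + lamShift : latticeCompl → ℂ) (modularAct γ p) = autFactor γ p.1.1 ^ (1 : ℤ) * _ :=
        hα.1 γ p
      have h4 : (mu + muShift : latticeCompl → ℂ) (modularAct γ p) = autFactor γ p.1.1 ^ (2 : ℤ) * _ :=
        hβ.1 γ p
      have h5 : lam p + A p = (lam + lamShift : latticeCompl → ℂ) p := by rw [← hAe]; rfl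
      have h6 : mu p + B p = (mu + muShift : latticeCompl → ℂ) p := by rw [← hBe]; rfl
      rw [h3, h4, h5, h6, zpow_one, show ((i : ℤ) + 2 * j) = ((i + 2 * j : ℕ) : ℤ) by push_cast; rfl,
        show (2 : ℤ) = (2 : ℕ) from rfl, zpow_natCast, zpow_natCast]
      ring
  · have h1 := eq_zero_of_sum_lam_mu_eq_zero hA hB (h := fun i j p =>
      g i j (translate m n p) - g i j p)
      (fun i j => ((hg i j).comp_translate m n).sub (hg i j)) (s + 1) (t + 1) (fun p => ?_) i hi j hj
    · exact sub_eq_zero.1 (congrFun h1 p)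
    · have h2 := h.2 m n p
      simp only [Finset.sum_apply, Pi.mul_apply, Pi.pow_apply] at h2
      rw [← sub_eq_zero, ← Finset.sum_sub_distrib] at h2
      rw [← h2]
      refine Finset.sum_congr rfl fun i _ => ?_
      rw [← Finset.sum_sub_distrib]
      refine Finset.sum_congr rfl fun j _ => ?_
      have h5 : lam p + A p = (lam + lamShift : latticeCompl → ℂ) p := by rw [← hAe]; rfl
      have h6 : mu p + B p = (mu + muShift : latticeCompl → ℂ) p := by rw [← hBe]; rfl
      rw [hα.2, hβ.2, h5, h6]
      ring

theorem IsCoefficient.mem_eisensteinAlgebra {f : latticeCompl → ℂ} {k : ℤ} (hf : IsCoefficient f)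
    (hJ : JacobiEquations k f) : f ∈ eisensteinAlgebra := by
  obtain ⟨F, hF, hfF⟩ := hf.holomorphic
  obtain rfl : f = fun p : latticeCompl => F p := funext hfF
  obtain ⟨N, hN⟩ := boundedNearCusp_of_hasExpansion hf.hasExpansion
  exact mem_eisensteinAlgebra_of_jacobiEquations N hF hJ hN

/-- After the shift the coefficients are meromorphic Jacobi forms, hence in the algebra. The
constant term is the shifted polynomial evaluated at `lamShift` and `muShift`, which are multiples
of E_1 and e_2. -/
theorem IsQuasiJacobiPoly.mem_eisensteinAlgebra {f : latticeCompl → ℂ} (hf : IsQuasiJacobiPoly f) :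
    f ∈ eisensteinAlgebra := by
  obtain ⟨k, P, hP, rfl⟩ := hf
  obtain ⟨s, t, hst⟩ := exists_evalPoly_eq_sum (shift lamShift muShift P)
  rw [← evalPoly_shift lamShift muShift, hst] at hP
  have hcoeff := jacobiEquations_coeff (fun i j => (isCoefficient_coeff _ i j).holomorphic) hP
  rw [constTerm_eq_evalPoly, ← evalPoly_shift lamShift muShift, hst, zero_add, zero_add]
  have hA : (lamShift : latticeCompl → ℂ) ∈ eisensteinAlgebra :=
    eisensteinAlgebra.smul_mem (eis_mem 0) _
  have hB : (muShift : latticeCompl → ℂ) ∈ eisensteinAlgebra :=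
    eisensteinAlgebra.smul_mem eisensteinTwo_mem _
  refine sum_mem fun i hi => sum_mem fun j hj => mul_mem (mul_mem ?_ (pow_mem hA i)) (pow_mem hB j)
  exact (isCoefficient_coeff _ i j).mem_eisensteinAlgebra
    (hcoeff i (Finset.mem_range.1 hi) j (Finset.mem_range.1 hj))

theorem quasiJacobiForms_le : quasiJacobiForms ≤ Subalgebra.toSubmodule eisensteinAlgebra := by
  rw [quasiJacobiForms_eq_span, Submodule.span_le]
  exact fun f hf => IsQuasiJacobiPoly.mem_eisensteinAlgebra hf

end QuasiJacobi

end

theorem mainTheorem2 :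
    QuasiJacobi.quasiJacobiForms =
      Subalgebra.toSubmodule (Algebra.adjoin ℂ
        ({f | ∃ n : ℕ, 1 ≤ n ∧ f = QuasiJacobi.twistedEisenstein n} ∪
          {QuasiJacobi.eisensteinTwo})) :=
  le_antisymm QuasiJacobi.quasiJacobiForms_le QuasiJacobi.toSubmodule_eisensteinAlgebra_le
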